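/- For a random variable $X$ with density $p$ (absolutely continuous on every compact interval) put $$I(X)=\int_{-\infty}^{\infty}\frac{p'(x)^2}{p(x)}\,dx ,\qquad I(X\|Z)=\int_{-\infty}^{\infty}\Big(\frac{p'(x)}{p(x)}-\frac{\varphi'(x)}{\varphi(x)}\Big)^2p(x)\,dx ,$$ where the integrands are $0$ at points with $p(x)=0$, $Z\sim N(0,1)$ and $\varphi(x)=(2\pi)^{-1/2}e^{-x^2/2}$; if $X$ has no such density, put $I(X)=I(X\|Z)=+\infty$. **Theorem 1.1.** Let $X_1,X_2,\dots$ be independent identically distributed real random variables with $\mathbf E X_1=0$, $\mathrm{Var}(X_1)=1$ and $\mathbf E|X_1|^s<\infty$ for an integer $s\ge 2$. Put $Z_n=(X_1+\dots+X_n)/\sqrt n$ and assume that $I(Z_{n_0})<+\infty$ for some $n_0\ge 1$. Then for all sufficiently large $n$ one has $I(Z_n)<\infty$ and $I(Z_n\|Z)=I(Z_n)-I(Z)$, and, as $n\to\infty$, $$I(Z_n\|Z)=\sum_{j=1}^{\lfloor (s-2)/2\rfloor}\frac{c_j}{n^j}+o\Big(n^{-\frac{s-2}{2}}(\log n)^{-\frac{(s-3)_+}{2}}\Big).$$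 The coefficients are $$c_j=\sum_{k=2}^{2j}(-1)^k\sum_{\substack{r_1,\dots,r_k\ge 1\\ r_1+\dots+r_k=2j}}\int_{-\infty}^{\infty}(q_{r_1}'+xq_{r_1})(q_{r_2}'+xq_{r_2})\,q_{r_3}\cdots q_{r_k}\,\frac{dx}{\varphi^{k-1}},$$ where $$q_k(x)=\varphi(x)\sum H_{k+2l}(x)\prod_{i=1}^{k}\frac{1}{r_i!}\Big(\frac{\gamma_{i+2}}{(i+2)!}\Big)^{r_i},$$ the sum running over all integers $r_1,\dots,r_k\ge 0$ with $r_1+2r_2+\dots+kr_k=k$, and $l=r_1+\dots+r_k$. Here $H_m$ is the monic Chebyshev–Hermite polynomial of degree $m$, orthogonal with respect to $\varphi\,dx$, and $\gamma_r=i^{-r}\frac{d^r}{dt^r}\log\mathbf E e^{itX_1}\big|_{t=0}$ is the $r$-th cumulant of $X_1$ ($r\le s$). For every $j\ge1$, the expression $c_j$ is a polynomial in $\gamma_3,\dots,\gamma_{2j+1}$, with coefficients that depend only on $j$; in particular $c_1=\gamma_3^2/2$. -/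

import Mathlib

open MeasureTheory ProbabilityTheory Filter Asymptotics
open scoped NNReal ENNReal

namespace FisherCLT

/-- `p` is an absolutely continuous probability density of the law `μ` on the real line:
`p` is nonnegative, absolutely continuous on every compact interval, and `μ = p dx`. -/
structure IsACDensity (μ : Measure ℝ) (p : ℝ → ℝ) : Prop where
  nonneg : ∀ x, 0 ≤ p x
  absCont : ∀ a b, AbsolutelyContinuousOnInterval p a b
  eq_withDensity : μ = volume.withDensity fun x => ENNReal.ofReal (p x)

/-- An absolutely continuous density is unique, if it exists; so the infima below
range over at most one function. -/
theorem IsACDensity.unique {μ : Measure ℝ} {p q : ℝ → ℝ}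
    (hp : IsACDensity μ p) (hq : IsACDensity μ q) : p = q := by
  have cont : ∀ {f : ℝ → ℝ}, IsACDensity μ f → Continuous f := by
    intro f hf
    rw [continuous_iff_continuousAt]
    intro x
    refine (hf.absCont (x - 1) (x + 1)).uniformContinuousOn.continuousOn.continuousAt ?_
    rw [Set.uIcc_of_le (by linarith)]
    exact Icc_mem_nhds (by linarith) (by linarith)
  have hpc := cont hp
  have hqc := cont hq
  have h : (fun x => ENNReal.ofReal (p x)) =ᵐ[volume] fun x => ENNReal.ofReal (q x) := by
    refine (withDensity_eq_iff_of_sigmaFinite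
      (ENNReal.continuous_ofReal.comp hpc).measurable.aemeasurable
      (ENNReal.continuous_ofReal.comp hqc).measurable.aemeasurable).1 ?_
    exact hp.eq_withDensity.symm.trans hq.eq_withDensity
  have h' : p =ᵐ[volume] q := by
    filter_upwards [h] with x hx
    exact (ENNReal.ofReal_eq_ofReal_iff (hp.nonneg x) (hq.nonneg x)).1 hx
  exact (Continuous.ae_eq_iff_eq volume hpc hqc).1 h'

/-- The Fisher information `I(X) = ∫ p'(x)² / p(x) dx` of a law `μ` with absolutely
continuous density `p`, and `I(X) = ∞` if there is no such density (empty infimum).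
Where `p x = 0`, the integrand is `0`. -/
noncomputable def fisherInfo (μ : Measure ℝ) : ℝ≥0∞ :=
  ⨅ (p : ℝ → ℝ) (_ : IsACDensity μ p), ∫⁻ x, ENNReal.ofReal (deriv p x ^ 2 / p x)

/-- The relative Fisher information `I(X||Z) = ∫ (p'/p - φ'/φ)² p dx` of a law `μ` with
absolutely continuous density `p` with respect to `Z ∼ N(a, v)` with density `φ`;
it is `∞` if `μ` has no absolutely continuous density. -/
noncomputable def relFisherInfo (μ : Measure ℝ) (a : ℝ) (v : ℝ≥0) : ℝ≥0∞ :=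
  ⨅ (p : ℝ → ℝ) (_ : IsACDensity μ p),
    ∫⁻ x, ENNReal.ofReal
      ((deriv p x / p x - deriv (gaussianPDFReal a v) x / gaussianPDFReal a v x) ^ 2 * p x)

/-- The normalized sum `Z_n` of the first `n` variables of the sequence
`X 0, X 1, X 2, …`. -/
noncomputable def normSum {Ω : Type*} (X : ℕ → Ω → ℝ) (n : ℕ) (ω : Ω) : ℝ :=
  (∑ i ∈ Finset.range n, X i ω) / √(n : ℝ)

/-- The `r`-th cumulant `i^{-r} (d/dt)^r log E e^{itX} |_{t=0}` of a law `μ` on the line.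
This number is real whenever `μ` is a probability measure with a finite absolute moment of
order `r`. -/
noncomputable def cumulant (μ : Measure ℝ) (r : ℕ) : ℝ :=
  ((Complex.I ^ r)⁻¹ * iteratedDeriv r (fun t : ℝ => Complex.log (charFun μ t)) 0).re

/-- The nonnegative integer solutions of `r_1 + 2 r_2 + ⋯ + k r_k = k`
(`r_{i+1}` is written `r i`; each `r_i` is at most `k`). -/
def weightedSolutions (k : ℕ) : Finset (Fin k → ℕ) :=
  (Fintype.piFinset fun _ : Fin k => Finset.range (k + 1)).filter
    fun r => ∑ i : Fin k, ((i : ℕ) + 1) * r i = k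

/-- The Edgeworth function `q_k` built from the cumulants `γ_3, …, γ_{k+2}`:
`q_k = φ ∑ H_{k+2j} ∏_i (γ_{i+2} / (i+2)!)^{r_i} / r_i!`, with `j = r_1 + ⋯ + r_k`. -/
noncomputable def edgeworthFun (γ : ℕ → ℝ) (k : ℕ) (x : ℝ) : ℝ :=
  gaussianPDFReal 0 1 x *
    ∑ r ∈ weightedSolutions k,
      Polynomial.aeval x (Polynomial.hermite (k + 2 * ∑ i, r i)) *
        ∏ i : Fin k,
          (γ ((i : ℕ) + 3) / (((i : ℕ) + 3).factorial : ℝ)) ^ r i / ((r i).factorial : ℝ)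

/-- The `k`-tuples of positive integers with sum `m`. -/
def positiveTuples (k m : ℕ) : Finset (Fin k → ℕ) :=
  (Fintype.piFinset fun _ : Fin k => Finset.Icc 1 m).filter fun r => ∑ i, r i = m

/-- The coefficient
`c_j = ∑_{k=2}^{2j} (-1)^k ∑_{r_1 + ⋯ + r_k = 2j}
  ∫ (q_{r_1}' + x q_{r_1}) (q_{r_2}' + x q_{r_2}) q_{r_3} ⋯ q_{r_k} dx / φ^{k-1}`. -/
noncomputable def fisherCoeff (γ : ℕ → ℝ) (j : ℕ) : ℝ :=
  ∑ k ∈ Finset.Icc 2 (2 * j), (-1 : ℝ) ^ k *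
    ∑ r ∈ positiveTuples k (2 * j),
      ∫ x : ℝ,
        (∏ i : Fin k,
          if (i : ℕ) < 2 then
            deriv (edgeworthFun γ (r i)) x + x * edgeworthFun γ (r i) x
          else edgeworthFun γ (r i) x) / gaussianPDFReal 0 1 x ^ (k - 1)

end FisherCLT

open FisherCLT

namespace FisherCLT

/-! ### Calculus lemmas -/

/-! Write K = s - 2, z = n^(-1/2), f for the characteristic function of X_1 and L = f'/f. The plan
is to approximate the density of Z_n by p = φS + r with S = 1 + ∑_{k ≤ K} z^k q_k/φ, where r, r',
r'' are o(z^K) with the weight (1+|x|)^(K+2), and to insert this into ∫ (p'+xp)²/p.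

Fourier side. F(t) = f(zt)^n solves F' = z⁻¹ L(zt) F. The transform u of φS solves the same equation
with L replaced by its Taylor polynomial, up to a defect of order z^(K+1) (`derivative_edgePoly`).
So G = F - u satisfies a linear equation with G(0) = 0, whose forcing is o(z^K) times a Gaussian for
|t| < δ√n, since L is K+1 times differentiable. A Grönwall estimate (`norm_le_of_linear_ode`) and
the Leibniz rule bound G and its derivatives up to order K+2 (`exists_cfDiff_bound_inner`). No
moment beyond s is needed. For |t| ≥ δ√n, finiteness of I(Z_{n₀}) gives |t||f(t)|^{n₀} ≤ C, hence
sup |f| < 1 away from 0, and everything is exponentially small (`cfDiff_bound_outer`). Fourier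
inversion yields `density_approx`.

Real side. The line is cut at |x| = T with T² = K log n + (K+2) log log n. Inside, |S - 1| ≤ 1/4 and
|r| ≤ φ/4, so the integrand is φ S'² ∑_{k<K} (1-S)^k up to controlled errors (`abs_sq_div_sub_le`).
Outside, φ is no longer a lower bound for p. There (p'+xp)²/p ≤ 2p'²/p + 2x²p, and p'² ≤ 4Mp holds
for a nonnegative p with |p''| ≤ M nearby (`sq_deriv_le_mul_of_nonneg`). The tail of x²p needs care
for K = 1, where the weight of r is just too weak for absolute integration; the equality of second
moments replaces the tail by an integral over [-T,T], which is small because G''(0) = 0. With this T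
the critical errors are all of size z^K (log n)^(-(K-1)/2), with an arbitrarily small factor.

Coefficients. Multiplying out ∫ φ S'² ∑ (1-S)^k in powers of z, odd powers vanish by parity and
z^(2j) = n^(-j) carries c_j (`exists_integral_expansionPoly_bound`). The identity I(X) = I(X||Z) + 1
is an integration by parts, ∫ x p' = -1. -/

theorem iteratedDeriv_comp_mul_left_real (j : ℕ) (f : ℝ → ℂ) (c : ℝ) :
    iteratedDeriv j (fun x => f (c * x)) = fun x => c ^ j • iteratedDeriv j f (c * x) := by
  induction j with
  | zero => simp
  | succ j ih =>
    rw [iteratedDeriv_succ, ih, iteratedDeriv_succ]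
    ext x
    have h := deriv_comp_mul_left c (iteratedDeriv j f) x
    rw [deriv_fun_const_smul_field, h, smul_smul, pow_succ]

theorem contDiffAt_iteratedDeriv {f : ℝ → ℂ} {x : ℝ} {m k j : ℕ} (hf : ContDiffAt ℝ m f x)
    (h : k + j ≤ m) : ContDiffAt ℝ k (iteratedDeriv j f) x := by
  rw [iteratedDeriv_eq_equiv_comp]
  exact (LinearIsometryEquiv.contDiff _).contDiffAt.comp x
    (hf.iteratedFDeriv_right (m := k) (i := j) (by exact_mod_cast h))

/-- Grönwall after removal of the Gaussian: W = e^(t²/4) G solves W' = (a + t/2) W + e^(t²/4) b. For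
t > 0 the new coefficient has nonpositive real part and the new forcing is at most B, so |W| grows
at rate at most B. -/
theorem norm_le_of_linear_ode_nonneg {G a b : ℝ → ℂ} {ℓ B : ℝ} (hB : 0 ≤ B)
    (hG : ∀ t, |t| < ℓ → HasDerivAt G (a t * G t + b t) t)
    (hre : ∀ t, |t| < ℓ → t * (a t).re ≤ -(t ^ 2 / 2))
    (hb : ∀ t, |t| < ℓ → ‖b t‖ ≤ B * Real.exp (-(t ^ 2 / 4)))
    (h0 : G 0 = 0) {t : ℝ} (ht0 : 0 ≤ t) (ht : t < ℓ) :
    ‖G t‖ ≤ B * t * Real.exp (-(t ^ 2 / 4)) := by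
  set W : ℝ → ℂ := fun t => (Real.exp (t ^ 2 / 4) : ℂ) * G t with hW
  have hWd : ∀ x, |x| < ℓ → HasDerivAt W
      ((a x + x / 2) * W x + (Real.exp (x ^ 2 / 4) : ℂ) * b x) x := by
    intro x hx
    have h1 : HasDerivAt (fun t : ℝ => Real.exp (t ^ 2 / 4)) (Real.exp (x ^ 2 / 4) * (x / 2)) x := by
      have := (((hasDerivAt_id x).pow 2).div_const 4).exp
      convert! this using 1
      simp
      ring
    have h2 := h1.ofReal_comp.mul (hG x hx)
    convert! h2 using 1
    simp only [hW]
    push_cast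
    ring
  have key : ∀ η > 0, ‖W t‖ ≤ η + B * t := by
    intro η hη
    -- |W| need not be differentiable where W vanishes. N is a differentiable majorant with N(0) =
    -- η, and η tends to 0 at the end.
    set N : ℝ → ℝ := fun x => Real.sqrt (‖W x‖ ^ 2 + η ^ 2) with hN
    have hpos : ∀ x, 0 < ‖W x‖ ^ 2 + η ^ 2 := fun x => by positivity
    have hNd : ∀ x, |x| < ℓ → HasDerivAt N
        ((2 * inner ℝ (W x) ((a x + x / 2) * W x + (Real.exp (x ^ 2 / 4) : ℂ) * b x)) / (2 * N x)) x := by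
      intro x hx
      have h1 := ((hWd x hx).norm_sq).add_const (η ^ 2)
      exact h1.sqrt (hpos x).ne'
    have hbound : ∀ x ∈ interior (Set.Icc (0 : ℝ) t), deriv N x ≤ B := by
      intro x hx
      rw [interior_Icc] at hx
      have hxl : |x| < ℓ := by rw [abs_of_pos hx.1]; exact hx.2.trans ht
      rw [(hNd x hxl).deriv]
      have hNpos : 0 < N x := Real.sqrt_pos.2 (hpos x)
      have hWN : ‖W x‖ ≤ N x := Real.le_sqrt_of_sq_le (by nlinarith [sq_nonneg η])
      rw [div_le_iff₀ (by positivity)]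
      have h1 : inner ℝ (W x) ((a x + x / 2) * W x) ≤ 0 := by
        have : inner ℝ (W x) ((a x + x / 2) * W x) = (a x + x / 2).re * ‖W x‖ ^ 2 := by
          rw [Complex.inner, Complex.sq_norm, Complex.normSq_apply]
          simp
          ring
        rw [this]
        have hre' : (a x + (x : ℂ) / 2).re = (a x).re + x / 2 := by
          rw [Complex.add_re]
          congr 1
          rw [show (x : ℂ) / 2 = ((x / 2 : ℝ) : ℂ) by push_cast; ring, Complex.ofReal_re]
        have h3 := hre x hxl
        have : (a x).re + x / 2 ≤ 0 := by
          by_contra hcon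
          push Not at hcon
          nlinarith [mul_pos hx.1 hcon]
        rw [hre']
        exact mul_nonpos_of_nonpos_of_nonneg this (by positivity)
      have h2 : inner ℝ (W x) ((Real.exp (x ^ 2 / 4) : ℂ) * b x) ≤ ‖W x‖ * B := by
        refine (real_inner_le_norm _ _).trans ?_
        gcongr
        rw [norm_mul, Complex.norm_real, Real.norm_eq_abs, abs_of_pos (Real.exp_pos _)]
        calc _ ≤ Real.exp (x ^ 2 / 4) * (B * Real.exp (-(x ^ 2 / 4))) := by
              gcongr; exact hb x hxl
          _ = B := by rw [mul_left_comm, ← Real.exp_add]; simp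
      rw [inner_add_right]
      nlinarith [mul_le_mul_of_nonneg_left hWN hB]
    have hd : DifferentiableOn ℝ N (Set.Icc 0 t) := fun x hx =>
      (hNd x (by rw [abs_of_nonneg hx.1]; exact hx.2.trans_lt ht)).differentiableAt.differentiableWithinAt
    have h := Convex.image_sub_le_mul_sub_of_deriv_le (convex_Icc 0 t) hd.continuousOn
      (hd.mono interior_subset) hbound 0 ⟨le_rfl, ht0⟩ t ⟨ht0, le_rfl⟩ ht0
    have hN0 : N 0 = η := by
      simp only [hN, hW, h0]
      simp [Real.sqrt_sq hη.le]
    have hWN : ‖W t‖ ≤ N t := Real.le_sqrt_of_sq_le (by nlinarith [sq_nonneg η])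
    rw [hN0] at h
    linarith
  have hWt : ‖W t‖ ≤ B * t := le_of_forall_pos_le_add fun η hη => by linarith [key η hη]
  have : ‖G t‖ = Real.exp (-(t ^ 2 / 4)) * ‖W t‖ := by
    simp only [hW]
    rw [norm_mul, Complex.norm_real, Real.norm_eq_abs, abs_of_pos (Real.exp_pos _), ← mul_assoc,
      ← Real.exp_add]
    simp
  rw [this, mul_comm (B * t)]
  gcongr

/-- Solutions of `G' = a G + b`, `G 0 = 0`, with `t Re a(t) ≤ -t²/2` and a forcing term of
Gaussian size are of Gaussian size. -/
theorem norm_le_of_linear_ode {G a b : ℝ → ℂ} {ℓ B : ℝ} (hB : 0 ≤ B)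
    (hG : ∀ t, |t| < ℓ → HasDerivAt G (a t * G t + b t) t)
    (hre : ∀ t, |t| < ℓ → t * (a t).re ≤ -(t ^ 2 / 2))
    (hb : ∀ t, |t| < ℓ → ‖b t‖ ≤ B * Real.exp (-(t ^ 2 / 4)))
    (h0 : G 0 = 0) {t : ℝ} (ht : |t| < ℓ) :
    ‖G t‖ ≤ B * |t| * Real.exp (-(t ^ 2 / 4)) := by
  rcases le_total 0 t with h | h
  · rw [abs_of_nonneg h] at ht ⊢
    exact norm_le_of_linear_ode_nonneg hB hG hre hb h0 h ht
  · rw [abs_of_nonpos h] at ht ⊢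
    have key := norm_le_of_linear_ode_nonneg (G := fun t => G (-t)) (a := fun t => -a (-t))
      (b := fun t => -b (-t)) (ℓ := ℓ) hB ?_ ?_ ?_ (by simpa using h0) (t := -t) (by linarith) ht
    · simpa using key
    · intro x hx
      have h1 := (hG (-x) (by simpa using hx)).scomp x (hasDerivAt_neg x)
      convert! h1 using 1
      simp
    · intro x hx
      have := hre (-x) (by simpa using hx)
      simp at this ⊢
      linarith
    · intro x hx
      have := hb (-x) (by simpa using hx)
      simpa using this

/-- A function all of whose derivatives up to order `m` vanish at `0` is small near `0`
together with its derivatives. -/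
theorem exists_forall_iteratedDeriv_le {S : ℝ → ℂ} {m : ℕ} {δ₀ : ℝ} (hδ₀ : 0 < δ₀)
    (hS : ∀ u, |u| < δ₀ → ContDiffAt ℝ m S u)
    (h0 : ∀ j ≤ m, iteratedDeriv j S 0 = 0) {ε : ℝ} (hε : 0 < ε) :
    ∃ δ > 0, δ < δ₀ ∧ ∀ u, |u| ≤ δ → ∀ j ≤ m, ‖iteratedDeriv j S u‖ ≤ ε * |u| ^ (m - j) := by
  have hcont : ContinuousAt (iteratedDeriv m S) 0 := by
    exact (contDiffAt_iteratedDeriv (hS 0 (by simpa using hδ₀)) (k := 0) (j := m) (by simp)).continuousAt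
  rw [Metric.continuousAt_iff] at hcont
  obtain ⟨δ, hδ, hcont⟩ := hcont ε hε
  set δ₁ := min (δ / 2) (δ₀ / 2) with hδ₁
  have hδ₁0 : 0 < δ₁ := by positivity
  have hδ₁₀ : δ₁ < δ₀ := (min_le_right _ _).trans_lt (by linarith)
  refine ⟨δ₁, hδ₁0, hδ₁₀, ?_⟩
  -- Descent from the top derivative, which is at most ε by continuity. Each mean value estimate on
  -- the segment from 0 to u gains a factor |u|.
  have key : ∀ k ≤ m, ∀ u, |u| ≤ δ₁ → ‖iteratedDeriv (m - k) S u‖ ≤ ε * |u| ^ k := by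
    intro k
    induction k with
    | zero =>
      intro _ u hu
      have h1 : dist u 0 < δ := by
        rw [Real.dist_eq, sub_zero]
        exact (hu.trans (min_le_left _ _)).trans_lt (by linarith)
      have h2 := (hcont h1).le
      rw [h0 m le_rfl, dist_zero_right] at h2
      simpa using h2
    | succ k ih =>
      intro hk u hu
      have hd : ∀ x ∈ Set.uIcc 0 u, HasDerivWithinAt (iteratedDeriv (m - (k + 1)) S)
          (iteratedDeriv (m - k) S x) (Set.uIcc 0 u) x := by
        intro x hx
        have hxu : |x| ≤ |u| := by
          have := Set.abs_sub_left_of_mem_uIcc hx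
          simpa using this
        have hxs : ContDiffAt ℝ m S x := hS x ((hxu.trans hu).trans_lt hδ₁₀)
        have hdiff : DifferentiableAt ℝ (iteratedDeriv (m - (k + 1)) S) x := by
          exact (contDiffAt_iteratedDeriv hxs (k := 1) (j := m - (k + 1)) (by omega)).differentiableAt
            one_ne_zero
        have h3 : m - k = (m - (k + 1)) + 1 := by omega
        rw [h3, iteratedDeriv_succ]
        exact hdiff.hasDerivAt.hasDerivWithinAt
      have hbd : ∀ x ∈ Set.uIcc 0 u, ‖iteratedDeriv (m - k) S x‖ ≤ ε * |u| ^ k := by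
        intro x hx
        have hxu : |x| ≤ |u| := by
          have := Set.abs_sub_left_of_mem_uIcc hx
          simpa using this
        refine (ih (by omega) x (hxu.trans hu)).trans ?_
        gcongr
      have h4 := (convex_uIcc 0 u).norm_image_sub_le_of_norm_hasDerivWithin_le hd hbd
        Set.left_mem_uIcc Set.right_mem_uIcc
      rw [h0 _ (by omega), sub_zero, sub_zero, Real.norm_eq_abs] at h4
      rw [pow_succ, ← mul_assoc]
      exact h4
  intro u hu j hj
  have := key (m - j) (by omega) u hu
  rwa [show m - (m - j) = j by omega] at this

/-- Derivatives of powers of a function bounded by one. -/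
theorem exists_norm_iteratedDeriv_pow_le {f : ℝ → ℂ} {s : ℕ} {M : ℝ} (hM : 1 ≤ M)
    (hf : ContDiff ℝ s f) (hf1 : ∀ t, ‖f t‖ ≤ 1)
    (hb : ∀ j ≤ s, ∀ t, ‖iteratedDeriv j f t‖ ≤ M) (j : ℕ) (hj : j ≤ s) :
    ∃ C : ℝ, 0 ≤ C ∧ ∀ (n : ℕ) (t : ℝ),
      ‖iteratedDeriv j (fun t => f t ^ n) t‖ ≤ C * (n : ℝ) ^ j * ‖f t‖ ^ (n - j) := by
  induction j using Nat.strong_induction_on with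
  | _ j ih =>
    rcases j with _ | j
    · exact ⟨1, zero_le_one, fun n t => by simp⟩
    · choose! C hC0 hC using fun i (hi : i < j + 1) => ih i hi (by omega)
      refine ⟨∑ i ∈ Finset.range (j + 1), (j.choose i : ℝ) * C i * M, ?_, ?_⟩
      · refine Finset.sum_nonneg fun i hi => ?_
        have := hC0 i (Finset.mem_range.1 hi)
        positivity
      intro n t
      rcases n with _ | n
      · simp [iteratedDeriv_const]
      -- Leibniz applied to (n+1) f^n f' reduces the order by one. Each differentiation costs one
      -- factor n and one power of f.
      have hder : deriv (fun t => f t ^ (n + 1)) = fun t => ((n : ℂ) + 1) * ((fun t => f t ^ n) * deriv f) t := by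
        ext x
        have hx : HasDerivAt f (deriv f x) x :=
          ((hf.differentiable (by exact_mod_cast (by omega : s ≠ 0))) x).hasDerivAt
        have := hx.pow (n + 1)
        simp only [Nat.add_sub_cancel] at this
        rw [show (fun t => f t ^ (n + 1)) = f ^ (n + 1) from rfl, this.deriv]
        simp
        ring
      rw [iteratedDeriv_succ', hder, iteratedDeriv_const_mul_field]
      have hfs : ContDiff ℝ ((j + 1 : ℕ)) f := hf.of_le (by exact_mod_cast hj)
      have hfj : ContDiff ℝ j (fun t => f t ^ n) :=
        (hfs.of_le (by exact_mod_cast Nat.le_succ j)).pow n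
      have hdf : ContDiff ℝ j (deriv f) := by
        have : ContDiff ℝ ((j : WithTop ℕ∞) + 1) f := by exact_mod_cast hfs
        exact (contDiff_succ_iff_deriv.1 this).2.2
      rw [iteratedDeriv_mul hfj.contDiffAt hdf.contDiffAt, norm_mul, Finset.sum_mul, Finset.sum_mul]
      have hn1 : ‖((n : ℂ) + 1)‖ = (n : ℝ) + 1 := by
        rw [show ((n : ℂ) + 1) = ((n + 1 : ℕ) : ℂ) by push_cast; ring, Complex.norm_natCast]
        push_cast; ring
      rw [hn1]
      calc ((n : ℝ) + 1) * ‖_‖ ≤ ((n : ℝ) + 1) * ∑ i ∈ Finset.range (j + 1), (j.choose i : ℝ) * C i * M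
            * (((n + 1 : ℕ) : ℝ) ^ j * ‖f t‖ ^ (n + 1 - (j + 1))) := by
            gcongr
            refine (norm_sum_le _ _).trans (Finset.sum_le_sum fun i hi => ?_)
            have hi' := Finset.mem_range.1 hi
            rw [norm_mul, norm_mul, Complex.norm_natCast, ← iteratedDeriv_succ']
            have h1 := hC i hi' n t
            have h2 := hb (j - i + 1) (by omega) t
            have h3 : C i * (n : ℝ) ^ i * ‖f t‖ ^ (n - i) ≤
                C i * (((n + 1 : ℕ) : ℝ) ^ j * ‖f t‖ ^ (n + 1 - (j + 1))) := by
              rw [mul_assoc]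
              have h5 : ‖f t‖ ^ (n - i) ≤ ‖f t‖ ^ (n + 1 - (j + 1)) :=
                pow_le_pow_of_le_one (norm_nonneg _) (hf1 t) (by omega)
              have h6 : (n : ℝ) ^ i ≤ ((n + 1 : ℕ) : ℝ) ^ j := by
                calc (n : ℝ) ^ i ≤ ((n + 1 : ℕ) : ℝ) ^ i := by gcongr; omega
                  _ ≤ _ := pow_le_pow_right₀ (by simp) (by omega)
              have := hC0 i hi'
              gcongr
            calc _ ≤ (j.choose i : ℝ) * (C i * (((n + 1 : ℕ) : ℝ) ^ j * ‖f t‖ ^ (n + 1 - (j + 1)))) * M := by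
                  have h7 := h1.trans h3
                  have h8 : 0 ≤ C i * (((n + 1 : ℕ) : ℝ) ^ j * ‖f t‖ ^ (n + 1 - (j + 1))) :=
                    (norm_nonneg _).trans h7
                  gcongr
              _ = _ := by ring
        _ = _ := by
            rw [Finset.mul_sum]
            refine Finset.sum_congr rfl fun i _ => ?_
            push_cast
            ring

end FisherCLT

namespace FisherCLT

/-! ### The coefficients of the exponential of a polynomial -/

open Polynomial in
/-- The coefficient of `z ^ k` in `exp (∑_{i < K} x_i z ^ (i + 1))`. -/
noncomputable def expCoeff (x : ℕ → ℂ[X]) (K k : ℕ) : ℂ[X] :=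
  ∑ r ∈ (Fintype.piFinset fun _ : Fin K => Finset.range (k + 1)).filter
    (fun r => ∑ i : Fin K, ((i : ℕ) + 1) * r i = k),
    ∏ i : Fin K, C ((r i).factorial : ℂ)⁻¹ * x i ^ r i

theorem mem_weighted_iff {K k : ℕ} {r : Fin K → ℕ} :
    r ∈ (Fintype.piFinset fun _ : Fin K => Finset.range (k + 1)).filter
      (fun r => ∑ i : Fin K, ((i : ℕ) + 1) * r i = k) ↔ ∑ i : Fin K, ((i : ℕ) + 1) * r i = k := by
  rw [Finset.mem_filter, Fintype.mem_piFinset, and_iff_right_iff_imp]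
  intro h i
  have h1 := Finset.single_le_sum (f := fun i : Fin K => ((i : ℕ) + 1) * r i)
    (fun _ _ => Nat.zero_le _) (Finset.mem_univ i)
  rw [h] at h1
  rw [Finset.mem_range]
  nlinarith

/-- The added variable has weight K + 1 > k, so its exponent vanishes in every solution. Thus a
single K serves for all coefficients of order at most K. -/
theorem expCoeff_succ_of_le (x : ℕ → Polynomial ℂ) {K k : ℕ} (h : k ≤ K) :
    expCoeff x (K + 1) k = expCoeff x K k := by
  symm
  unfold expCoeff
  refine Finset.sum_bij (fun r _ => Fin.snoc r 0) ?_ ?_ ?_ ?_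
  · intro r hr
    rw [mem_weighted_iff] at hr ⊢
    simpa [Fin.sum_univ_castSucc] using hr
  · intro r _ r' _ h
    have := congrArg Fin.init h
    simpa using this
  · intro r hr
    rw [mem_weighted_iff, Fin.sum_univ_castSucc] at hr
    have hz : r (Fin.last K) = 0 := by
      by_contra h0
      have : 1 ≤ r (Fin.last K) := Nat.one_le_iff_ne_zero.2 h0
      simp only [Fin.val_last] at hr
      have h2 := Nat.mul_le_mul_left (K + 1) this
      omega
    refine ⟨Fin.init r, ?_, ?_⟩
    · rw [mem_weighted_iff]
      simpa [hz, Fin.init] using hr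
    · rw [← hz, Fin.snoc_init_self]
  · intro r _
    rw [Fin.prod_univ_castSucc]
    simp

theorem expCoeff_of_le (x : ℕ → Polynomial ℂ) {K k : ℕ} (h : k ≤ K) :
    expCoeff x K k = expCoeff x k k := by
  induction K, h using Nat.le_induction with
  | base => rfl
  | succ K hK ih => rw [expCoeff_succ_of_le x hK, ih]

/-- This is the coefficient of z^k in (exp h)' = h' exp h. Lowering r_i by one is a bijection from
the solutions of weight k with r_i ≥ 1 to those of weight k - 1 - i, and 1/r_i! absorbs the factor
r_i. -/
theorem derivative_expCoeff (x : ℕ → Polynomial ℂ) (K k : ℕ) :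
    (expCoeff x K k).derivative = ∑ i : Fin K,
      if (i : ℕ) + 1 ≤ k then (x i).derivative * expCoeff x K (k - 1 - i) else 0 := by
  have hder : ∀ r : Fin K → ℕ,
      (∏ i : Fin K, Polynomial.C ((r i).factorial : ℂ)⁻¹ * x i ^ r i).derivative =
      ∑ i : Fin K, if 1 ≤ r i then (x i).derivative *
        ∏ j : Fin K, Polynomial.C (((Function.update r i (r i - 1)) j).factorial : ℂ)⁻¹ *
          x j ^ (Function.update r i (r i - 1)) j else 0 := by
    intro r
    rw [Polynomial.derivative_prod_finset]
    refine Finset.sum_congr rfl fun i _ => ?_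
    rw [← Finset.mul_prod_erase _ _ (Finset.mem_univ i)]
    split_ifs with h
    · have h1 : ∏ j ∈ Finset.univ.erase i,
          Polynomial.C (((Function.update r i (r i - 1)) j).factorial : ℂ)⁻¹ *
            x j ^ (Function.update r i (r i - 1)) j =
          ∏ j ∈ Finset.univ.erase i, Polynomial.C ((r j).factorial : ℂ)⁻¹ * x j ^ r j := by
        refine Finset.prod_congr rfl fun j hj => ?_
        rw [Function.update_of_ne (Finset.ne_of_mem_erase hj)]
      rw [h1, Function.update_self]
      obtain ⟨m, hm⟩ : ∃ m, r i = m + 1 := ⟨r i - 1, by omega⟩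
      rw [hm, Polynomial.derivative_C_mul, Polynomial.derivative_pow_succ, Nat.add_sub_cancel]
      have h2 : Polynomial.C (((m + 1).factorial : ℂ)⁻¹) * Polynomial.C ((m : ℂ) + 1) =
          Polynomial.C ((m.factorial : ℂ)⁻¹) := by
        rw [← Polynomial.C_mul]
        congr 1
        rw [Nat.factorial_succ]
        have : ((m : ℂ) + 1) ≠ 0 := by exact_mod_cast Nat.succ_ne_zero m
        have : (m.factorial : ℂ) ≠ 0 := by exact_mod_cast Nat.factorial_ne_zero m
        push_cast
        field_simp
      rw [← h2]
      ring
    · have : r i = 0 := by omega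
      simp [this]
  conv_lhs => rw [expCoeff, Polynomial.derivative_sum, Finset.sum_congr rfl fun r _ => hder r,
    Finset.sum_comm]
  refine Finset.sum_congr rfl fun i _ => ?_
  rw [← Finset.sum_filter]
  split_ifs with hi
  · rw [expCoeff, Finset.mul_sum]
    refine Finset.sum_bij (fun r _ => Function.update r i (r i - 1)) ?_ ?_ ?_ ?_
    · intro r hr
      rw [Finset.mem_filter, mem_weighted_iff] at hr
      rw [mem_weighted_iff]
      have h1 := Finset.add_sum_erase Finset.univ (fun j : Fin K => ((j : ℕ) + 1) * r j) (Finset.mem_univ i)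
      have h2 := Finset.add_sum_erase Finset.univ (fun j : Fin K => ((j : ℕ) + 1) *
        (Function.update r i (r i - 1)) j) (Finset.mem_univ i)
      have h3 : ∑ j ∈ Finset.univ.erase i, ((j : ℕ) + 1) * (Function.update r i (r i - 1)) j =
          ∑ j ∈ Finset.univ.erase i, ((j : ℕ) + 1) * r j :=
        Finset.sum_congr rfl fun j hj => by rw [Function.update_of_ne (Finset.ne_of_mem_erase hj)]
      simp only [Function.update_self] at h2
      obtain ⟨m, hm⟩ : ∃ m, r i = m + 1 := ⟨r i - 1, by omega⟩
      rw [h3] at h2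
      rw [← h2]
      rw [hr.1] at h1
      rw [hm] at h1 ⊢
      simp only [Nat.add_sub_cancel]
      rw [mul_add] at h1
      omega
    · intro r hr r' hr' h
      rw [Finset.mem_filter] at hr hr'
      ext j
      by_cases hj : j = i
      · subst hj
        have := congrFun h j
        simp only [Function.update_self] at this
        omega
      · have := congrFun h j
        rwa [Function.update_of_ne hj, Function.update_of_ne hj] at this
    · intro r hr
      rw [mem_weighted_iff] at hr
      refine ⟨Function.update r i (r i + 1), ?_, ?_⟩
      · rw [Finset.mem_filter, mem_weighted_iff]
        refine ⟨?_, by simp⟩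
        have h1 := Finset.add_sum_erase Finset.univ (fun j : Fin K => ((j : ℕ) + 1) * r j) (Finset.mem_univ i)
        have h2 := Finset.add_sum_erase Finset.univ (fun j : Fin K => ((j : ℕ) + 1) *
          (Function.update r i (r i + 1)) j) (Finset.mem_univ i)
        have h3 : ∑ j ∈ Finset.univ.erase i, ((j : ℕ) + 1) * (Function.update r i (r i + 1)) j =
            ∑ j ∈ Finset.univ.erase i, ((j : ℕ) + 1) * r j :=
          Finset.sum_congr rfl fun j hj => by rw [Function.update_of_ne (Finset.ne_of_mem_erase hj)]
        simp only [Function.update_self] at h2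
        rw [h3, mul_add] at h2
        omega
      · simp
    · intro r _
      rfl
  · refine Finset.sum_eq_zero fun r hr => ?_
    rw [Finset.mem_filter, mem_weighted_iff] at hr
    exfalso
    have h1 := Finset.single_le_sum (f := fun i : Fin K => ((i : ℕ) + 1) * r i)
      (fun _ _ => Nat.zero_le _) (Finset.mem_univ i)
    simp only [hr.1] at h1
    nlinarith [hr.2]

/-- The failure of the truncated exponential series to satisfy the differential equation of the
exponential. -/
theorem sum_derivative_expCoeff (x : ℕ → Polynomial ℂ) (K : ℕ) (z : ℂ) :
    ∑ k ∈ Finset.range (K + 1), z ^ k • (expCoeff x K k).derivative =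
      (∑ i ∈ Finset.range K, z ^ (i + 1) • (x i).derivative) *
        (∑ k ∈ Finset.range (K + 1), z ^ k • expCoeff x K k) -
      ∑ i ∈ Finset.range K, ∑ m ∈ (Finset.range (K + 1)).filter (fun m => K < i + 1 + m),
        z ^ (i + 1 + m) • ((x i).derivative * expCoeff x K m) := by
  have h1 : ∀ k, (expCoeff x K k).derivative = ∑ i ∈ Finset.range K,
      if i + 1 ≤ k then (x i).derivative * expCoeff x K (k - 1 - i) else 0 := by
    intro k
    rw [derivative_expCoeff, Finset.sum_range]
  simp_rw [h1, Finset.smul_sum]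
  rw [Finset.sum_comm, Finset.sum_mul, ← Finset.sum_sub_distrib]
  refine Finset.sum_congr rfl fun i hi => ?_
  rw [Finset.mem_range] at hi
  rw [Finset.mul_sum]
  have h2 : ∑ m ∈ Finset.range (K + 1), (z ^ (i + 1) • (x i).derivative) * (z ^ m • expCoeff x K m) =
      ∑ m ∈ Finset.range (K + 1), z ^ (i + 1 + m) • ((x i).derivative * expCoeff x K m) := by
    refine Finset.sum_congr rfl fun m _ => ?_
    rw [smul_mul_smul_comm, ← pow_add]
  -- The product of the two truncated sums splits according to whether the power i + 1 + m of z
  -- exceeds K: the high powers form the defect, the low ones reproduce the derivatives.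
  rw [h2, eq_sub_iff_add_eq', ← Finset.sum_filter_add_sum_filter_not (Finset.range (K + 1))
    (fun m => K < i + 1 + m) (fun m => z ^ (i + 1 + m) • ((x i).derivative * expCoeff x K m))]
  congr 1
  simp_rw [smul_ite, smul_zero]
  rw [← Finset.sum_filter]
  refine Finset.sum_bij' (fun k _ => k - 1 - i) (fun m _ => i + 1 + m) ?_ ?_ ?_ ?_ ?_
  · intro k hk
    simp only [Finset.mem_filter, Finset.mem_range] at hk ⊢
    omega
  · intro m hm
    simp only [Finset.mem_filter, Finset.mem_range] at hm ⊢
    omega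
  · intro k hk
    simp only [Finset.mem_filter, Finset.mem_range] at hk ⊢
    omega
  · intro m hm
    simp only [Finset.mem_filter, Finset.mem_range] at hm ⊢
    omega
  · intro k hk
    simp only [Finset.mem_filter, Finset.mem_range] at hk
    rw [show i + 1 + (k - 1 - i) = k by omega]

/-! ### Polynomials times the Gaussian -/

/-- A polynomial times `exp (-t² / 2)`. -/
noncomputable def gaussPoly (P : Polynomial ℂ) (t : ℝ) : ℂ :=
  P.eval (t : ℂ) * (Real.exp (-(t ^ 2 / 2)) : ℂ)

theorem hasDerivAt_gaussPoly (P : Polynomial ℂ) (t : ℝ) :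
    HasDerivAt (gaussPoly P) (gaussPoly (P.derivative - Polynomial.X * P) t) t := by
  have h1 : HasDerivAt (fun t : ℝ => P.eval (t : ℂ)) (P.derivative.eval (t : ℂ)) t :=
    (P.hasDerivAt (t : ℂ)).comp_ofReal
  have h2 : HasDerivAt (fun t : ℝ => Real.exp (-(t ^ 2 / 2))) (Real.exp (-(t ^ 2 / 2)) * (-t)) t := by
    have := ((((hasDerivAt_id t).pow 2).div_const 2).neg).exp
    convert! this using 1
    simp
  have := h1.mul h2.ofReal_comp
  convert! this using 1
  simp only [gaussPoly, Polynomial.eval_sub, Polynomial.eval_mul, Polynomial.eval_X]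
  push_cast
  ring

theorem iteratedDeriv_gaussPoly (P : Polynomial ℂ) (j : ℕ) :
    iteratedDeriv j (gaussPoly P) =
      gaussPoly ((fun Q => Polynomial.derivative Q - Polynomial.X * Q)^[j] P) := by
  induction j with
  | zero => simp
  | succ j ih =>
    rw [iteratedDeriv_succ, ih, Function.iterate_succ_apply']
    exact funext fun t => (hasDerivAt_gaussPoly _ t).deriv

theorem contDiff_gaussPoly (P : Polynomial ℂ) {n : WithTop ℕ∞} : ContDiff ℝ n (gaussPoly P) := by
  unfold gaussPoly
  refine ContDiff.mul ?_ ?_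
  · have : ContDiff ℂ n (fun z : ℂ => P.eval z) := by
      simpa using Polynomial.contDiff_aeval (𝕜 := ℂ) P n
    exact (this.restrict_scalars ℝ).comp Complex.ofRealCLM.contDiff
  · have : ContDiff ℝ n (fun t : ℝ => Real.exp (-(t ^ 2 / 2))) := by fun_prop
    exact Complex.ofRealCLM.contDiff.comp this

theorem exists_one_add_abs_pow_mul_exp_le (m : ℕ) {c : ℝ} (hc : 0 < c) :
    ∃ C : ℝ, 0 ≤ C ∧ ∀ t : ℝ, (1 + |t|) ^ m * Real.exp (-(c * t ^ 2)) ≤ C := by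
  -- From y^m ≤ m! e^y at y = 1 + |t| and the maximum 1/(4c) of |t| - ct².
  refine ⟨m.factorial * Real.exp (1 + 1 / (4 * c)), by positivity, fun t => ?_⟩
  have h1 : (1 + |t|) ^ m ≤ m.factorial * Real.exp (1 + |t|) := by
    have := Real.pow_div_factorial_le_exp (1 + |t|) (by positivity) m
    rw [div_le_iff₀ (by positivity)] at this
    linarith
  calc _ ≤ m.factorial * Real.exp (1 + |t|) * Real.exp (-(c * t ^ 2)) := by gcongr
    _ = m.factorial * Real.exp (1 + |t| - c * t ^ 2) := by
        rw [mul_assoc, ← Real.exp_add, sub_eq_add_neg]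
    _ ≤ _ := by
        gcongr
        have : |t| - c * t ^ 2 ≤ 1 / (4 * c) := by
          rw [le_div_iff₀ (by positivity)]
          rw [← sq_abs t]
          nlinarith [sq_nonneg (2 * c * |t| - 1)]
        linarith

theorem exists_norm_eval_le (P : Polynomial ℂ) :
    ∃ C : ℝ, 0 ≤ C ∧ ∀ t : ℝ, ‖P.eval (t : ℂ)‖ ≤ C * (1 + |t|) ^ P.natDegree := by
  refine ⟨∑ i ∈ Finset.range (P.natDegree + 1), ‖P.coeff i‖, by positivity, fun t => ?_⟩
  rw [Polynomial.eval_eq_sum_range, Finset.sum_mul]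
  refine (norm_sum_le _ _).trans (Finset.sum_le_sum fun i hi => ?_)
  rw [norm_mul, norm_pow, Complex.norm_real, Real.norm_eq_abs]
  gcongr
  calc |t| ^ i ≤ (1 + |t|) ^ i := by gcongr; linarith
    _ ≤ _ := pow_le_pow_right₀ (by linarith [abs_nonneg t]) (by
      have := Finset.mem_range.1 hi; omega)

/-- Half of the exponent t²/2 absorbs the polynomial and the weight; the other half stays. -/
theorem exists_gaussPoly_bound (P : Polynomial ℂ) (m : ℕ) :
    ∃ C : ℝ, 0 ≤ C ∧ ∀ t : ℝ, (1 + |t|) ^ m * ‖gaussPoly P t‖ ≤ C * Real.exp (-(t ^ 2 / 4)) := by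
  obtain ⟨C₁, hC₁, h₁⟩ := exists_norm_eval_le P
  obtain ⟨C₂, hC₂, h₂⟩ := exists_one_add_abs_pow_mul_exp_le (m + P.natDegree)
    (c := 1 / 4) (by norm_num)
  refine ⟨C₁ * C₂, by positivity, fun t => ?_⟩
  unfold gaussPoly
  rw [norm_mul, Complex.norm_real, Real.norm_eq_abs, abs_of_pos (Real.exp_pos _)]
  have h3 : Real.exp (-(t ^ 2 / 2)) = Real.exp (-(1 / 4 * t ^ 2)) * Real.exp (-(t ^ 2 / 4)) := by
    rw [← Real.exp_add]; congr 1; ring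
  calc _ ≤ (1 + |t|) ^ m * (C₁ * (1 + |t|) ^ P.natDegree *
        (Real.exp (-(1 / 4 * t ^ 2)) * Real.exp (-(t ^ 2 / 4)))) := by
        rw [h3]; gcongr; exact h₁ t
    _ = C₁ * ((1 + |t|) ^ (m + P.natDegree) * Real.exp (-(1 / 4 * t ^ 2))) *
        Real.exp (-(t ^ 2 / 4)) := by rw [pow_add]; ring
    _ ≤ _ := by gcongr; exact h₂ t

/-- Derivatives of Gaussian polynomials, with a polynomial weight, are of Gaussian size. -/
theorem exists_iteratedDeriv_gaussPoly_bound (P : Polynomial ℂ) (m J : ℕ) :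
    ∃ C : ℝ, 0 ≤ C ∧ ∀ j ≤ J, ∀ t : ℝ,
      (1 + |t|) ^ m * ‖iteratedDeriv j (gaussPoly P) t‖ ≤ C * Real.exp (-(t ^ 2 / 4)) := by
  choose C hC h using fun j => exists_gaussPoly_bound
    ((fun Q => Polynomial.derivative Q - Polynomial.X * Q)^[j] P) m
  refine ⟨∑ j ∈ Finset.range (J + 1), C j, Finset.sum_nonneg fun j _ => hC j, fun j hj t => ?_⟩
  rw [iteratedDeriv_gaussPoly]
  refine (h j t).trans ?_
  gcongr
  exact Finset.single_le_sum (fun j _ => hC j) (Finset.mem_range.2 (by omega))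

end FisherCLT

namespace FisherCLT

/-! ### The Edgeworth polynomial on the Fourier side -/

/-- The bound of `norm_le_of_linear_ode` for the derivatives of the solution. -/
theorem norm_iteratedDeriv_le_of_linear_ode {G a b : ℝ → ℂ} {ℓ B M : ℝ} {m : ℕ} (hB : 0 ≤ B)
    (hM : 0 ≤ M)
    (hG : ∀ t, |t| < ℓ → HasDerivAt G (a t * G t + b t) t)
    (hre : ∀ t, |t| < ℓ → t * (a t).re ≤ -(t ^ 2 / 2))
    (hGc : ContDiff ℝ (m + 1 : ℕ) G)
    (hac : ∀ t, |t| < ℓ → ContDiffAt ℝ m a t)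
    (hbc : ∀ t, |t| < ℓ → ContDiffAt ℝ m b t)
    (ha : ∀ t, |t| < ℓ → ∀ i ≤ m, ‖iteratedDeriv i a t‖ ≤ M * (1 + |t|))
    (hb : ∀ t, |t| < ℓ → ∀ i ≤ m, ‖iteratedDeriv i b t‖ ≤ B * Real.exp (-(t ^ 2 / 4)))
    (h0 : G 0 = 0) (j : ℕ) (hj : j ≤ m + 1) (t : ℝ) (ht : |t| < ℓ) :
    ‖iteratedDeriv j G t‖ ≤
      (1 + 2 ^ m * M) ^ j * B * (1 + |t|) ^ (j + 1) * Real.exp (-(t ^ 2 / 4)) := by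
  induction j using Nat.strong_induction_on generalizing t with
  | _ j ih =>
    have htn := abs_nonneg t
    rcases j with _ | j
    · have h1 := norm_le_of_linear_ode hB hG hre (fun t ht => by simpa using hb t ht 0 (Nat.zero_le m))
        h0 ht
      simp only [iteratedDeriv_zero, pow_zero, one_mul, zero_add, pow_one]
      refine h1.trans ?_
      gcongr
      linarith
    · have hev : deriv G =ᶠ[nhds t] a * G + b := by
        have : ∀ᶠ x in nhds t, |x| < ℓ := (isOpen_lt continuous_abs continuous_const).mem_nhds ht
        filter_upwards [this] with x hx
        exact (hG x hx).deriv
      have haj : ContDiffAt ℝ j a t := (hac t ht).of_le (by exact_mod_cast (by omega : j ≤ m))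
      have hbj : ContDiffAt ℝ j b t := (hbc t ht).of_le (by exact_mod_cast (by omega : j ≤ m))
      have hGj : ContDiffAt ℝ j G t :=
        (hGc.of_le (by exact_mod_cast (by omega : j ≤ m + 1))).contDiffAt
      rw [iteratedDeriv_succ', hev.iteratedDeriv_eq,
        iteratedDeriv_add (f := a * G) (haj.mul hGj) hbj,
        iteratedDeriv_mul haj hGj]
      -- The Leibniz sum costs at most 2^m M times the bound for order j and the forcing at most
      -- that bound once, so passing to order j + 1 multiplies by D.
      set D := 1 + 2 ^ m * M with hD
      have hD1 : 1 ≤ D := by rw [hD]; linarith [show (0:ℝ) ≤ 2 ^ m * M by positivity]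
      have hsum : ‖∑ i ∈ Finset.range (j + 1), (j.choose i : ℂ) * iteratedDeriv i a t *
          iteratedDeriv (j - i) G t‖ ≤ 2 ^ m * M * (D ^ j * B * (1 + |t|) ^ (j + 2) *
            Real.exp (-(t ^ 2 / 4))) := by
        calc _ ≤ ∑ i ∈ Finset.range (j + 1), (j.choose i : ℝ) * (M * (D ^ j * B * (1 + |t|) ^ (j + 2) *
            Real.exp (-(t ^ 2 / 4)))) := by
              refine (norm_sum_le _ _).trans (Finset.sum_le_sum fun i hi => ?_)
              have hi' := Finset.mem_range.1 hi
              rw [norm_mul, norm_mul, Complex.norm_natCast, mul_assoc]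
              refine mul_le_mul_of_nonneg_left ?_ (by positivity)
              have h1 := ha t ht i (by omega)
              have h2 := ih (j - i) (by omega) (by omega) t ht
              calc _ ≤ (M * (1 + |t|)) * (D ^ (j - i) * B * (1 + |t|) ^ (j - i + 1) *
                    Real.exp (-(t ^ 2 / 4))) := by gcongr
                _ ≤ (M * (1 + |t|)) * (D ^ j * B * (1 + |t|) ^ (j + 1) *
                    Real.exp (-(t ^ 2 / 4))) := by
                    gcongr
                    · omega
                    · linarith
                    · omega
                _ = _ := by ring
          _ = (∑ i ∈ Finset.range (j + 1), (j.choose i : ℝ)) * (M * (D ^ j * B * (1 + |t|) ^ (j + 2) *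
            Real.exp (-(t ^ 2 / 4)))) := by rw [Finset.sum_mul]
          _ = 2 ^ j * (M * (D ^ j * B * (1 + |t|) ^ (j + 2) * Real.exp (-(t ^ 2 / 4)))) := by
              congr 1
              exact_mod_cast Nat.sum_range_choose j
          _ ≤ 2 ^ m * (M * (D ^ j * B * (1 + |t|) ^ (j + 2) * Real.exp (-(t ^ 2 / 4)))) := by
              gcongr
              · norm_num
              · omega
          _ = _ := by ring
      have hbt := hb t ht j (by omega)
      have hone : B * Real.exp (-(t ^ 2 / 4)) ≤ D ^ j * B * (1 + |t|) ^ (j + 2) *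
          Real.exp (-(t ^ 2 / 4)) := by
        have h1 : 1 ≤ D ^ j := one_le_pow₀ hD1
        have h2 : 1 ≤ (1 + |t|) ^ (j + 2) := one_le_pow₀ (by linarith)
        have h3 : 1 * B * 1 ≤ D ^ j * B * (1 + |t|) ^ (j + 2) := by gcongr
        rw [one_mul, mul_one] at h3
        gcongr
      calc _ ≤ 2 ^ m * M * (D ^ j * B * (1 + |t|) ^ (j + 2) * Real.exp (-(t ^ 2 / 4))) +
            D ^ j * B * (1 + |t|) ^ (j + 2) * Real.exp (-(t ^ 2 / 4)) :=
            (norm_add_le _ _).trans (add_le_add hsum (hbt.trans hone))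
        _ = _ := by rw [pow_succ D, hD]; ring

theorem gaussPoly_sum {ι : Type*} (I : Finset ι) (c : ι → ℂ) (Q : ι → Polynomial ℂ) :
    gaussPoly (∑ x ∈ I, c x • Q x) = fun t => ∑ x ∈ I, c x * gaussPoly (Q x) t := by
  ext t
  simp only [gaussPoly, Polynomial.eval_finsetSum, Polynomial.eval_smul, smul_eq_mul]
  rw [Finset.sum_mul]
  simp_rw [mul_assoc]

/-- The point is uniformity in z. It serves with D = 0 for `edgePoly` and with D = K + 1 for
`edgeDefect`. -/
theorem exists_iteratedDeriv_gaussPoly_sum_bound {ι : Type*} (I : Finset ι) (d : ι → ℕ) (D : ℕ)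
    (hd : ∀ x ∈ I, D ≤ d x) (Q : ι → Polynomial ℂ) (m J : ℕ) :
    ∃ C : ℝ, 0 ≤ C ∧ ∀ z : ℝ, 0 ≤ z → z ≤ 1 → ∀ j ≤ J, ∀ t : ℝ,
      (1 + |t|) ^ m * ‖iteratedDeriv j (gaussPoly (∑ x ∈ I, (z : ℂ) ^ d x • Q x)) t‖ ≤
        C * z ^ D * Real.exp (-(t ^ 2 / 4)) := by
  choose C hC h using fun x => exists_iteratedDeriv_gaussPoly_bound (Q x) m J
  refine ⟨∑ x ∈ I, C x, Finset.sum_nonneg fun x _ => hC x, fun z hz0 hz1 j hj t => ?_⟩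
  rw [gaussPoly_sum, iteratedDeriv_fun_sum fun i _ =>
    (contDiff_const.mul (contDiff_gaussPoly _)).contDiffAt]
  calc _ ≤ (1 + |t|) ^ m * ∑ x ∈ I, ‖iteratedDeriv j (fun t => (z : ℂ) ^ d x * gaussPoly (Q x) t) t‖ := by
        gcongr
        exact norm_sum_le _ _
    _ = ∑ x ∈ I, z ^ d x * ((1 + |t|) ^ m * ‖iteratedDeriv j (gaussPoly (Q x)) t‖) := by
        rw [Finset.mul_sum]
        refine Finset.sum_congr rfl fun x _ => ?_
        rw [iteratedDeriv_const_mul_field, norm_mul, norm_pow, Complex.norm_real,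
          Real.norm_eq_abs, abs_of_nonneg hz0]
        ring
    _ ≤ ∑ x ∈ I, z ^ D * (C x * Real.exp (-(t ^ 2 / 4))) := by
        refine Finset.sum_le_sum fun x hx => ?_
        have := h x j hj t
        have h2 : z ^ d x ≤ z ^ D := pow_le_pow_of_le_one hz0 hz1 (hd x hx)
        have h3 : 0 ≤ C x * Real.exp (-(t ^ 2 / 4)) := mul_nonneg (hC x) (Real.exp_pos _).le
        gcongr
    _ = _ := by
        rw [← Finset.mul_sum, ← Finset.sum_mul]
        ring

/-- The term `γ_{i+3} (it)^{i+3} / (i+3)!` of the expansion of the logarithm of a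
characteristic function. -/
noncomputable def cumPoly (γ : ℕ → ℝ) (i : ℕ) : Polynomial ℂ :=
  Polynomial.C ((γ (i + 3) : ℂ) / ((i + 3).factorial : ℂ) * Complex.I ^ (i + 3)) *
    Polynomial.X ^ (i + 3)

/-- The polynomial factor of the Fourier transform of the Edgeworth approximation of order `K`. -/
noncomputable def edgePoly (γ : ℕ → ℝ) (K : ℕ) (z : ℝ) : Polynomial ℂ :=
  ∑ k ∈ Finset.range (K + 1), (z : ℂ) ^ k • expCoeff (cumPoly γ) K k

/-- The defect of `gaussPoly (edgePoly γ K z)` in the differential equation. -/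
noncomputable def edgeDefect (γ : ℕ → ℝ) (K : ℕ) (z : ℝ) : Polynomial ℂ :=
  ∑ p ∈ (Finset.range K ×ˢ Finset.range (K + 1)).filter (fun p => K < p.1 + 1 + p.2),
    (z : ℂ) ^ (p.1 + 1 + p.2) • ((cumPoly γ p.1).derivative * expCoeff (cumPoly γ) K p.2)

/-- Up to a defect of order z^(K+1), the truncated series solves the equation of the full
exponential. This makes it comparable with f(zt)^n through differential equations, without estimates
of exponentials of remainders. -/
theorem derivative_edgePoly (γ : ℕ → ℝ) (K : ℕ) (z : ℝ) :
    (edgePoly γ K z).derivative =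
      (∑ i ∈ Finset.range K, (z : ℂ) ^ (i + 1) • (cumPoly γ i).derivative) * edgePoly γ K z -
        edgeDefect γ K z := by
  have := sum_derivative_expCoeff (cumPoly γ) K z
  simp only [edgePoly, Polynomial.derivative_sum, Polynomial.derivative_smul]
  rw [this, edgeDefect]
  congr 1
  rw [Finset.sum_filter, Finset.sum_product]
  simp_rw [← Finset.sum_filter]

theorem exists_edgePoly_bound (γ : ℕ → ℝ) (K m J : ℕ) :
    ∃ C : ℝ, 0 ≤ C ∧ ∀ z : ℝ, 0 ≤ z → z ≤ 1 → ∀ j ≤ J, ∀ t : ℝ,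
      (1 + |t|) ^ m * ‖iteratedDeriv j (gaussPoly (edgePoly γ K z)) t‖ ≤
        C * Real.exp (-(t ^ 2 / 4)) := by
  obtain ⟨C, hC, h⟩ := exists_iteratedDeriv_gaussPoly_sum_bound (Finset.range (K + 1)) id 0
    (fun _ _ => Nat.zero_le _) (fun k => expCoeff (cumPoly γ) K k) m J
  exact ⟨C, hC, fun z h0 h1 j hj t => by simpa [edgePoly] using h z h0 h1 j hj t⟩

theorem exists_edgeDefect_bound (γ : ℕ → ℝ) (K m J : ℕ) :
    ∃ C : ℝ, 0 ≤ C ∧ ∀ z : ℝ, 0 ≤ z → z ≤ 1 → ∀ j ≤ J, ∀ t : ℝ,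
      (1 + |t|) ^ m * ‖iteratedDeriv j (gaussPoly (edgeDefect γ K z)) t‖ ≤
        C * z ^ (K + 1) * Real.exp (-(t ^ 2 / 4)) := by
  obtain ⟨C, hC, h⟩ := exists_iteratedDeriv_gaussPoly_sum_bound
    ((Finset.range K ×ˢ Finset.range (K + 1)).filter (fun p => K < p.1 + 1 + p.2))
    (fun p => p.1 + 1 + p.2) (K + 1) (fun p hp => (Finset.mem_filter.1 hp).2)
    (fun p => (cumPoly γ p.1).derivative * expCoeff (cumPoly γ) K p.2) m J
  exact ⟨C, hC, h⟩

/-- The Taylor polynomial of the logarithmic derivative of a characteristic function. -/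
noncomputable def logDerivPoly (γ : ℕ → ℝ) (K : ℕ) : Polynomial ℂ :=
  -Polynomial.X + ∑ i ∈ Finset.range K, (cumPoly γ i).derivative

theorem derivative_cumPoly (γ : ℕ → ℝ) (i : ℕ) : (cumPoly γ i).derivative =
    Polynomial.C ((γ (i + 3) : ℂ) / ((i + 2).factorial : ℂ) * Complex.I ^ (i + 3)) *
    Polynomial.X ^ (i + 2) := by
  rw [cumPoly, Polynomial.derivative_C_mul, Polynomial.derivative_X_pow, ← mul_assoc,
    ← Polynomial.C_mul]
  congr 2
  have h1 : ((i + 2).factorial : ℂ) ≠ 0 := by exact_mod_cast Nat.factorial_ne_zero _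
  have h2 : ((i : ℂ) + 3) ≠ 0 := by exact_mod_cast Nat.succ_ne_zero (i + 2)
  rw [show (i + 3).factorial = (i + 3) * (i + 2).factorial from Nat.factorial_succ (i + 2)]
  push_cast
  field_simp

/-- Scaling: u^(i+2) at u = zt, divided by z, becomes z^(i+1) t^(i+2), which is the weight of
`cumPoly γ i` in the Edgeworth series. -/
theorem eval_logDerivPoly_mul (γ : ℕ → ℝ) (K : ℕ) {z : ℝ} (hz : z ≠ 0) (t : ℝ) :
    (z : ℂ)⁻¹ * (logDerivPoly γ K).eval ((z * t : ℝ) : ℂ) =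
      -t + (∑ i ∈ Finset.range K, (z : ℂ) ^ (i + 1) • (cumPoly γ i).derivative).eval (t : ℂ) := by
  have hz' : (z : ℂ) ≠ 0 := by exact_mod_cast hz
  simp only [logDerivPoly, derivative_cumPoly, Polynomial.eval_add, Polynomial.eval_neg,
    Polynomial.eval_X, Polynomial.eval_finsetSum, Polynomial.eval_mul, Polynomial.eval_C,
    Polynomial.eval_pow, Polynomial.eval_smul, smul_eq_mul]
  rw [mul_add, Finset.mul_sum]
  congr 1
  · push_cast; field_simp
  · refine Finset.sum_congr rfl fun i _ => ?_
    push_cast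
    field_simp
    ring

end FisherCLT

namespace FisherCLT

/-! ### The logarithmic derivative of a characteristic function -/

theorem iteratedDeriv_eval (Q : Polynomial ℂ) (j : ℕ) :
    iteratedDeriv j (fun u : ℝ => Q.eval (u : ℂ)) =
      fun u : ℝ => (Polynomial.derivative^[j] Q).eval (u : ℂ) := by
  induction j with
  | zero => simp
  | succ j ih =>
    rw [iteratedDeriv_succ, ih, Function.iterate_succ_apply']
    exact funext fun u => ((Polynomial.hasDerivAt _ (u : ℂ)).comp_ofReal).deriv

theorem iteratedDeriv_eval_zero (Q : Polynomial ℂ) (j : ℕ) :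
    iteratedDeriv j (fun u : ℝ => Q.eval (u : ℂ)) 0 = (j.factorial : ℂ) * Q.coeff j := by
  rw [iteratedDeriv_eval]
  simp only [Complex.ofReal_zero]
  rw [← Polynomial.coeff_zero_eq_eval_zero, Polynomial.coeff_iterate_derivative]
  simp [Nat.descFactorial_self]

theorem coeff_logDerivPoly_zero (γ : ℕ → ℝ) (K : ℕ) : (logDerivPoly γ K).coeff 0 = 0 := by
  simp [logDerivPoly, derivative_cumPoly]

theorem coeff_logDerivPoly_one (γ : ℕ → ℝ) (K : ℕ) : (logDerivPoly γ K).coeff 1 = -1 := by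
  simp only [logDerivPoly, derivative_cumPoly, Polynomial.finsetSum_coeff, Polynomial.coeff_add,
    Polynomial.coeff_neg, Polynomial.coeff_X, Polynomial.coeff_C_mul, Polynomial.coeff_X_pow]
  simp

theorem coeff_logDerivPoly_add_two (γ : ℕ → ℝ) {K i : ℕ} (hi : i < K) :
    (logDerivPoly γ K).coeff (i + 2) =
      (γ (i + 3) : ℂ) / ((i + 2).factorial : ℂ) * Complex.I ^ (i + 3) := by
  simp only [logDerivPoly, derivative_cumPoly, Polynomial.finsetSum_coeff, Polynomial.coeff_add,
    Polynomial.coeff_neg, Polynomial.coeff_X, Polynomial.coeff_C_mul, Polynomial.coeff_X_pow]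
  rw [Finset.sum_eq_single i]
  · simp
  · intro b _ hb
    rw [if_neg (by omega), mul_zero]
  · intro h
    exact absurd (Finset.mem_range.2 hi) h

/-! ### Cumulants as Taylor coefficients of the logarithmic derivative. -/

section CharFun

variable {μ : Measure ℝ} [IsProbabilityMeasure μ] {s : ℕ}

theorem memLp_id_of_le (hμ : MemLp id s μ) {j : ℕ} (hj : j ≤ s) : MemLp id j μ :=
  hμ.mono_exponent (by exact_mod_cast hj)

theorem norm_iteratedDeriv_charFun_le (hμ : MemLp id s μ) :
    ∃ M : ℝ, 1 ≤ M ∧ ∀ j ≤ s, ∀ t, ‖iteratedDeriv j (charFun μ) t‖ ≤ M := by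
  refine ⟨1 + ∑ j ∈ Finset.range (s + 1), ∫ x, |x| ^ j ∂μ, ?_, ?_⟩
  · have : 0 ≤ ∑ j ∈ Finset.range (s + 1), ∫ x, |x| ^ j ∂μ :=
      Finset.sum_nonneg fun j _ => integral_nonneg fun x => by positivity
    linarith
  · intro j hj t
    rw [iteratedDeriv_charFun (memLp_id_of_le hμ hj), norm_mul, norm_pow, Complex.norm_I, one_pow,
      one_mul]
    have h1 : ‖∫ x : ℝ, (x : ℂ) ^ j * Complex.exp (t * x * Complex.I) ∂μ‖ ≤ ∫ x, |x| ^ j ∂μ := by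
      refine (norm_integral_le_integral_norm _).trans (le_of_eq ?_)
      refine integral_congr_ae (Filter.Eventually.of_forall fun x => ?_)
      simp only
      rw [norm_mul, norm_pow, Complex.norm_real, Real.norm_eq_abs, ← Complex.ofReal_mul,
        Complex.norm_exp_ofReal_mul_I, mul_one]
    have h2 := Finset.single_le_sum (f := fun j => ∫ x, |x| ^ j ∂μ) (s := Finset.range (s + 1))
      (fun j _ => integral_nonneg fun x => by positivity) (Finset.mem_range.2 (by omega : j < s + 1))
    linarith

/-- The logarithmic derivative of the characteristic function. -/
noncomputable def logDerivCF (μ : Measure ℝ) (u : ℝ) : ℂ := deriv (charFun μ) u / charFun μ u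

theorem exists_re_charFun_pos (μ : Measure ℝ) [IsProbabilityMeasure μ] :
    ∃ δ > 0, ∀ u, |u| < δ → 0 < (charFun μ u).re := by
  have hc : Continuous fun u => (charFun μ u).re := Complex.continuous_re.comp continuous_charFun
  have h0 : 0 < (charFun μ 0).re := by simp
  obtain ⟨δ, hδ, h⟩ := Metric.mem_nhds_iff.1 ((hc.continuousAt (x := 0)).eventually (lt_mem_nhds h0))
  exact ⟨δ, hδ, fun u hu => h (by simpa using hu)⟩

theorem contDiffAt_logDerivCF {m : ℕ} (hμ : MemLp id (m + 1 : ℕ) μ) {u : ℝ}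
    (hu : charFun μ u ≠ 0) : ContDiffAt ℝ m (logDerivCF μ) u := by
  have hf : ContDiff ℝ (m + 1 : ℕ) (charFun μ) := contDiff_charFun hμ
  have hd : ContDiff ℝ m (deriv (charFun μ)) := by
    have : ContDiff ℝ ((m : WithTop ℕ∞) + 1) (charFun μ) := by exact_mod_cast hf
    exact (contDiff_succ_iff_deriv.1 this).2.2
  have hf' : ContDiff ℝ m (charFun μ) := hf.of_le (by exact_mod_cast Nat.le_succ m)
  have := hd.contDiffAt.mul (hf'.contDiffAt.inv (x := u) hu)
  exact this.congr_of_eventuallyEq (Eventually.of_forall fun x => div_eq_mul_inv _ _)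

/-- Near 0 the characteristic function lies in the right half-plane, where the principal logarithm
is differentiable. -/
theorem deriv_log_charFun_eventuallyEq (hμ : MemLp id (1 : ℕ) μ) :
    deriv (fun t : ℝ => Complex.log (charFun μ t)) =ᶠ[nhds 0] logDerivCF μ := by
  obtain ⟨δ, hδ, h⟩ := exists_re_charFun_pos μ
  have : ∀ᶠ u in nhds (0 : ℝ), |u| < δ := by
    have := Metric.ball_mem_nhds (0 : ℝ) hδ
    filter_upwards [this] with u hu
    simpa using hu
  have hf : ContDiff ℝ (1 : ℕ) (charFun μ) := contDiff_charFun hμ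
  filter_upwards [this] with u hu
  have hd : HasDerivAt (charFun μ) (deriv (charFun μ) u) u :=
    (hf.differentiable (by simp) u).hasDerivAt
  exact (hd.clog_real (Or.inl (h u hu))).deriv

theorem iteratedDeriv_conj (f : ℝ → ℂ) (j : ℕ) (x : ℝ) :
    iteratedDeriv j (fun t => (starRingEnd ℂ) (f t)) x = (starRingEnd ℂ) (iteratedDeriv j f x) := by
  induction j generalizing x with
  | zero => simp
  | succ j ih =>
    rw [iteratedDeriv_succ, iteratedDeriv_succ, funext ih]
    exact deriv.star

/-- The real part in `cumulant` discards nothing: near 0 the logarithm ψ satisfies ψ(-t) = conj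
ψ(t), which forces i^(-r) ψ^(r)(0) to be real. -/
theorem iteratedDeriv_log_charFun_zero (r : ℕ) :
    iteratedDeriv r (fun t : ℝ => Complex.log (charFun μ t)) 0 =
      Complex.I ^ r * (cumulant μ r : ℂ) := by
  set ψ : ℝ → ℂ := fun t : ℝ => Complex.log (charFun μ t) with hψ
  have hev : (fun t => ψ (-t)) =ᶠ[nhds 0] fun t => (starRingEnd ℂ) (ψ t) := by
    obtain ⟨δ, hδ, h⟩ := exists_re_charFun_pos μ
    filter_upwards [Metric.ball_mem_nhds (0 : ℝ) hδ] with u hu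
    have hu' := h u (by simpa using hu)
    simp only [hψ]
    rw [charFun_neg, Complex.log_conj]
    intro harg
    have := Complex.arg_eq_pi_iff.1 harg
    linarith [this.1]
  have h1 := hev.iteratedDeriv_eq r
  rw [iteratedDeriv_comp_neg, iteratedDeriv_conj, neg_zero] at h1
  set w := iteratedDeriv r ψ 0 with hw
  have hreal : (starRingEnd ℂ) ((Complex.I ^ r)⁻¹ * w) = (Complex.I ^ r)⁻¹ * w := by
    rw [map_mul, ← h1, map_inv₀, map_pow, Complex.conj_I, neg_pow]
    have h2 : (Complex.I : ℂ) ^ r ≠ 0 := pow_ne_zero _ Complex.I_ne_zero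
    have h3 : ((-1 : ℂ) ^ r) ≠ 0 := pow_ne_zero _ (by norm_num)
    rw [Complex.real_smul]
    push_cast
    field_simp
  have h4 := Complex.conj_eq_iff_re.1 hreal
  have h2 : (Complex.I : ℂ) ^ r ≠ 0 := pow_ne_zero _ Complex.I_ne_zero
  rw [cumulant, h4]
  field_simp

theorem iteratedDeriv_logDerivCF_zero (j : ℕ) (hμ : MemLp id (1 : ℕ) μ) :
    iteratedDeriv j (logDerivCF μ) 0 = Complex.I ^ (j + 1) * (cumulant μ (j + 1) : ℂ) := by
  rw [← iteratedDeriv_log_charFun_zero (j + 1), iteratedDeriv_succ',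
    (deriv_log_charFun_eventuallyEq hμ).iteratedDeriv_eq]

theorem deriv_charFun_zero (hμ : MemLp id (1 : ℕ) μ) (hmean : ∫ x, x ∂μ = 0) :
    deriv (charFun μ) 0 = 0 := by
  rw [← iteratedDeriv_one, iteratedDeriv_charFun_zero hμ]
  have : ∫ x, x ^ 1 ∂μ = 0 := by simpa using hmean
  rw [this]
  simp

theorem logDerivCF_zero (hμ : MemLp id (1 : ℕ) μ) (hmean : ∫ x, x ∂μ = 0) :
    logDerivCF μ 0 = 0 := by
  rw [logDerivCF, deriv_charFun_zero hμ hmean, zero_div]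

theorem deriv_logDerivCF_zero (hμ : MemLp id (2 : ℕ) μ) (hmean : ∫ x, x ∂μ = 0)
    (hvar : ∫ x, x ^ 2 ∂μ = 1) : deriv (logDerivCF μ) 0 = -1 := by
  have hμ1 : MemLp id (1 : ℕ) μ := memLp_id_of_le hμ (by norm_num)
  have hf : ContDiff ℝ (2 : ℕ) (charFun μ) := contDiff_charFun hμ
  have hf1 : HasDerivAt (charFun μ) (deriv (charFun μ) 0) 0 :=
    (hf.differentiable (by simp) 0).hasDerivAt
  have h2 : ContDiff ℝ ((1 : WithTop ℕ∞) + 1) (charFun μ) := by exact_mod_cast hf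
  have hf2 : HasDerivAt (deriv (charFun μ)) (deriv (deriv (charFun μ)) 0) 0 :=
    ((contDiff_succ_iff_deriv.1 h2).2.2.differentiable one_ne_zero 0).hasDerivAt
  have h3 := hf2.div hf1 (by simp)
  have h4 : deriv (deriv (charFun μ)) 0 = -1 := by
    rw [← iteratedDeriv_one (f := charFun μ), ← iteratedDeriv_succ, iteratedDeriv_charFun_zero hμ]
    simp only [hvar]
    simp
  rw [show logDerivCF μ = deriv (charFun μ) / charFun μ from rfl, h3.deriv, h4,
    deriv_charFun_zero hμ1 hmean]
  simp

/-- The difference of the logarithmic derivative of the characteristic function and its Taylor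
polynomial. -/
noncomputable def logDerivRem (μ : Measure ℝ) (K : ℕ) (u : ℝ) : ℂ :=
  logDerivCF μ u - (logDerivPoly (cumulant μ) K).eval (u : ℂ)

theorem contDiff_eval_ofReal (Q : Polynomial ℂ) {n : WithTop ℕ∞} :
    ContDiff ℝ n (fun u : ℝ => Q.eval (u : ℂ)) := by
  have : ContDiff ℂ n (fun z : ℂ => Q.eval z) := by
    simpa using Polynomial.contDiff_aeval (𝕜 := ℂ) Q n
  exact (this.restrict_scalars ℝ).comp Complex.ofRealCLM.contDiff

theorem contDiffAt_logDerivRem {m : ℕ} (hμ : MemLp id (m + 1 : ℕ) μ) (K : ℕ) {u : ℝ}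
    (hu : charFun μ u ≠ 0) : ContDiffAt ℝ m (logDerivRem μ K) u :=
  (contDiffAt_logDerivCF hμ hu).sub (contDiff_eval_ofReal _).contDiffAt

/-- `logDerivPoly` has the Taylor coefficients of f'/f: 0 and -1 by the normalization of mean and
variance, then the cumulants. K + 2 moments allow the orders up to K + 1. -/
theorem iteratedDeriv_logDerivRem_zero {K : ℕ} (hμ : MemLp id (K + 2 : ℕ) μ)
    (hmean : ∫ x, x ∂μ = 0) (hvar : ∫ x, x ^ 2 ∂μ = 1) {j : ℕ} (hj : j ≤ K + 1) :
    iteratedDeriv j (logDerivRem μ K) 0 = 0 := by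
  have hμ1 : MemLp id (1 : ℕ) μ := memLp_id_of_le hμ (by omega)
  have hμ2 : MemLp id (2 : ℕ) μ := memLp_id_of_le hμ (by omega)
  have hne : charFun μ 0 ≠ 0 := by simp
  rw [show logDerivRem μ K = logDerivCF μ - fun u : ℝ => (logDerivPoly (cumulant μ) K).eval (u : ℂ)
    from rfl, iteratedDeriv_sub ((contDiffAt_logDerivCF (m := K + 1) hμ hne).of_le
      (by exact_mod_cast hj)) (contDiff_eval_ofReal _).contDiffAt, iteratedDeriv_eval_zero, sub_eq_zero]
  rcases j with _ | _ | i
  · simp [coeff_logDerivPoly_zero, logDerivCF_zero hμ1 hmean]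
  · simp [coeff_logDerivPoly_one, deriv_logDerivCF_zero hμ2 hmean hvar]
  · rw [iteratedDeriv_logDerivCF_zero _ hμ1, coeff_logDerivPoly_add_two _ (by omega)]
    have : ((i + 1 + 1).factorial : ℂ) ≠ 0 := by exact_mod_cast Nat.factorial_ne_zero _
    field_simp

end CharFun

end FisherCLT

namespace FisherCLT

/-! ### Approximation of the characteristic function near zero -/

theorem eval_zero_expCoeff {x : ℕ → Polynomial ℂ} (hx : ∀ i, (x i).eval 0 = 0) (K k : ℕ) :
    (expCoeff x K k).eval 0 = if k = 0 then 1 else 0 := by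
  rw [expCoeff, Polynomial.eval_finsetSum]
  split_ifs with hk
  · subst hk
    rw [Finset.sum_eq_single 0]
    · simp
    · intro r hr hne
      exfalso
      refine hne ?_
      rw [mem_weighted_iff, Finset.sum_eq_zero_iff] at hr
      ext i
      have := hr i (Finset.mem_univ i)
      simpa using this
    · intro h
      exact absurd (mem_weighted_iff.2 (by simp)) h
  · refine Finset.sum_eq_zero fun r hr => ?_
    rw [mem_weighted_iff] at hr
    obtain ⟨i, _, hi⟩ : ∃ i ∈ (Finset.univ : Finset (Fin K)), ((i : ℕ) + 1) * r i ≠ 0 := by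
      refine Finset.exists_ne_zero_of_sum_ne_zero (f := fun i : Fin K => ((i : ℕ) + 1) * r i) ?_
      rw [hr]
      exact hk
    have hri : r i ≠ 0 := fun h => hi (by rw [h, mul_zero])
    rw [Polynomial.eval_prod]
    refine Finset.prod_eq_zero (Finset.mem_univ i) ?_
    simp [hx, hri]

/-- This provides the initial condition of the differential equation for `cfDiff`. -/
theorem eval_zero_edgePoly (γ : ℕ → ℝ) (K : ℕ) (z : ℝ) : (edgePoly γ K z).eval 0 = 1 := by
  have hx : ∀ i, (cumPoly γ i).eval 0 = 0 := fun i => by simp [cumPoly]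
  simp only [edgePoly, Polynomial.eval_finsetSum, Polynomial.eval_smul, eval_zero_expCoeff hx]
  rw [Finset.sum_eq_single 0]
  · simp
  · intro b _ hb
    simp [hb]
  · simp

/-- The characteristic function of the normalized sum of `n` independent copies minus the Fourier
transform of its Edgeworth approximation. -/
noncomputable def cfDiff (μ : Measure ℝ) (K n : ℕ) (t : ℝ) : ℂ :=
  charFun μ ((√(n : ℝ))⁻¹ * t) ^ n - gaussPoly (edgePoly (cumulant μ) K (√(n : ℝ))⁻¹) t

variable {μ : Measure ℝ} [IsProbabilityMeasure μ]

theorem contDiff_cfDiff {K : ℕ} (hμ : MemLp id (K + 2 : ℕ) μ) (n : ℕ) :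
    ContDiff ℝ (K + 2 : ℕ) (cfDiff μ K n) := by
  have hf : ContDiff ℝ (K + 2 : ℕ) (charFun μ) := contDiff_charFun hμ
  exact ((hf.comp (contDiff_const.mul contDiff_id)).pow n).sub (contDiff_gaussPoly _)

theorem cfDiff_zero (K n : ℕ) : cfDiff μ K n 0 = 0 := by
  have := eval_zero_edgePoly (cumulant μ) K (√(n : ℝ))⁻¹
  simp [cfDiff, gaussPoly, this]

/-- L(0) = 0 and L'(0) = -1 give L(u) = -u + o(u). The constant 1/2 is what yields t Re a(t) ≤ -t²/2
for the scaled coefficient a. -/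
theorem exists_logDerivCF_bounds {K : ℕ} (hμ : MemLp id (K + 2 : ℕ) μ)
    (hmean : ∫ x, x ∂μ = 0) (hvar : ∫ x, x ^ 2 ∂μ = 1) :
    ∃ δ > 0, ∃ M ≥ 0, ∀ u, |u| < δ → charFun μ u ≠ 0 ∧ ‖logDerivCF μ u + u‖ ≤ |u| / 2 ∧
      ∀ i ≤ K + 1, ‖iteratedDeriv i (logDerivCF μ) u‖ ≤ M := by
  have hμ1 : MemLp id (1 : ℕ) μ := memLp_id_of_le hμ (by omega)
  have hμ2 : MemLp id (2 : ℕ) μ := memLp_id_of_le hμ (by omega)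
  have hne : charFun μ 0 ≠ 0 := by simp
  have hc : ContDiffAt ℝ (K + 1 : ℕ) (logDerivCF μ) 0 := contDiffAt_logDerivCF hμ hne
  have e1 : ∀ᶠ u in nhds (0 : ℝ), charFun μ u ≠ 0 :=
    continuous_charFun.continuousAt.eventually_ne hne
  have e2 : ∀ᶠ u in nhds (0 : ℝ), ‖logDerivCF μ u + u‖ ≤ |u| / 2 := by
    have hd : HasDerivAt (logDerivCF μ) (-1) 0 := by
      rw [← deriv_logDerivCF_zero hμ2 hmean hvar]
      exact (hc.differentiableAt (by simp)).hasDerivAt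
    have := (hasDerivAt_iff_isLittleO.1 hd).def (c := 1 / 2) (by norm_num)
    filter_upwards [this] with u hu
    rw [logDerivCF_zero hμ1 hmean] at hu
    simp at hu
    linarith
  have e3 : ∀ᶠ u in nhds (0 : ℝ), ∀ i ∈ Finset.range (K + 2),
      ‖iteratedDeriv i (logDerivCF μ) u‖ < ‖iteratedDeriv i (logDerivCF μ) 0‖ + 1 := by
    refine (Finset.eventually_all _).2 fun i hi => ?_
    have hci : ContinuousAt (iteratedDeriv i (logDerivCF μ)) 0 :=
      (contDiffAt_iteratedDeriv hc (k := 0) (j := i)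
        (by have := Finset.mem_range.1 hi; omega)).continuousAt
    exact hci.norm.eventually (gt_mem_nhds (by linarith))
  obtain ⟨δ, hδ, h⟩ := Metric.mem_nhds_iff.1 ((e1.and e2).and e3)
  refine ⟨δ, hδ, ∑ i ∈ Finset.range (K + 2), (‖iteratedDeriv i (logDerivCF μ) 0‖ + 1),
    by positivity, fun u hu => ?_⟩
  obtain ⟨⟨h1, h2⟩, h3⟩ := h (show u ∈ Metric.ball 0 δ by simpa using hu)
  refine ⟨h1, h2, fun i hi => ?_⟩
  have hi' : i ∈ Finset.range (K + 2) := Finset.mem_range.2 (by omega)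
  refine (h3 i hi').le.trans ?_
  exact Finset.single_le_sum (f := fun i => ‖iteratedDeriv i (logDerivCF μ) 0‖ + 1)
    (fun i _ => by positivity) hi'

/-- Since n z² = 1, the derivative of f(zt)^n is z⁻¹ L(zt) f(zt)^n. Subtracting the equation of the
Edgeworth transform leaves the Taylor remainder of L times that transform, plus the defect. -/
theorem hasDerivAt_cfDiff {K n : ℕ} (hμ : MemLp id (K + 2 : ℕ) μ) (hn : 1 ≤ n) {t : ℝ}
    (hne : charFun μ ((√(n : ℝ))⁻¹ * t) ≠ 0) :
    HasDerivAt (cfDiff μ K n)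
      ((((√(n : ℝ))⁻¹ : ℝ) : ℂ)⁻¹ * logDerivCF μ ((√(n : ℝ))⁻¹ * t) * cfDiff μ K n t +
        (((((√(n : ℝ))⁻¹ : ℝ) : ℂ)⁻¹ * logDerivRem μ K ((√(n : ℝ))⁻¹ * t)) *
          gaussPoly (edgePoly (cumulant μ) K (√(n : ℝ))⁻¹) t +
        gaussPoly (edgeDefect (cumulant μ) K (√(n : ℝ))⁻¹) t)) t := by
  set z : ℝ := (√(n : ℝ))⁻¹ with hz
  have hn0 : (0 : ℝ) < n := by exact_mod_cast hn
  have hz0 : z ≠ 0 := by positivity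
  have hz0' : (z : ℂ) ≠ 0 := by exact_mod_cast hz0
  have hnz : (n : ℝ) * z ^ 2 = 1 := by
    rw [hz, inv_pow, Real.sq_sqrt hn0.le]
    field_simp
  have hnz' : (n : ℂ) * (z : ℂ) ^ 2 = 1 := by exact_mod_cast hnz
  have hf : ContDiff ℝ (K + 2 : ℕ) (charFun μ) := contDiff_charFun hμ
  have hfd : HasDerivAt (charFun μ) (deriv (charFun μ) (z * t)) (z * t) :=
    (hf.differentiable (by simp) _).hasDerivAt
  have h1 : HasDerivAt (fun t => charFun μ (z * t)) (z • deriv (charFun μ) (z * t)) t := by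
    have := hfd.scomp t ((hasDerivAt_id t).const_mul z)
    simpa using! this
  have h2 := (h1.pow n).sub (hasDerivAt_gaussPoly (edgePoly (cumulant μ) K z) t)
  convert! h2 using 1
  have hF : (n : ℂ) * charFun μ (z * t) ^ (n - 1) * z • deriv (charFun μ) (z * t) =
      (z : ℂ)⁻¹ * logDerivCF μ (z * t) * charFun μ (z * t) ^ n := by
    rw [logDerivCF]
    obtain ⟨m, rfl⟩ : ∃ m, n = m + 1 := ⟨n - 1, by omega⟩
    simp only [Nat.add_sub_cancel, pow_succ, Complex.real_smul]
    have : (z : ℂ)⁻¹ = ((m + 1 : ℕ) : ℂ) * z := by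
      rw [inv_eq_iff_eq_inv, eq_comm, inv_eq_iff_eq_inv]
      field_simp
      linear_combination hnz'
    rw [this]
    field_simp
  rw [hF]
  have hS : (z : ℂ)⁻¹ * logDerivRem μ K (z * t) = (z : ℂ)⁻¹ * logDerivCF μ (z * t) -
      (-t + (∑ i ∈ Finset.range K, (z : ℂ) ^ (i + 1) •
        (cumPoly (cumulant μ) i).derivative).eval (t : ℂ)) := by
    rw [← eval_logDerivPoly_mul _ _ hz0, logDerivRem]
    ring
  rw [hS, derivative_edgePoly]
  simp only [cfDiff, gaussPoly, Polynomial.eval_sub, Polynomial.eval_mul, Polynomial.eval_X, ← hz]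
  ring

theorem mul_div_two_mul_add_one_le {Q ε : ℝ} (hQ : 0 ≤ Q) (hε : 0 ≤ ε) :
    Q * (ε / (2 * (Q + 1))) ≤ ε / 2 := by
  rw [← mul_div_assoc, div_le_div_iff₀ (by positivity) (by norm_num)]
  nlinarith

set_option maxHeartbeats 800000 in
/-- The Edgeworth approximation of the characteristic function of a normalized sum on the range
`|t| < δ √n`. -/
theorem exists_cfDiff_bound_inner {K : ℕ} (hμ : MemLp id (K + 2 : ℕ) μ)
    (hmean : ∫ x, x ∂μ = 0) (hvar : ∫ x, x ^ 2 ∂μ = 1) {ε : ℝ} (hε : 0 < ε) :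
    ∃ δ > 0, ∀ᶠ n : ℕ in atTop, ∀ t : ℝ, |t| < δ * √(n : ℝ) → ∀ j ≤ K + 2,
      (1 + |t|) ^ 4 * ‖iteratedDeriv j (cfDiff μ K n) t‖ ≤ ε * (√(n : ℝ))⁻¹ ^ K := by
  obtain ⟨δ₁, hδ₁, M, hM, hL⟩ := exists_logDerivCF_bounds hμ hmean hvar
  obtain ⟨Cu, hCu, hu⟩ := exists_edgePoly_bound (cumulant μ) K (K + 1) (K + 1)
  obtain ⟨Ce, hCe, he⟩ := exists_edgeDefect_bound (cumulant μ) K 0 (K + 1)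
  obtain ⟨C₃, hC₃, h₃⟩ := exists_one_add_abs_pow_mul_exp_le (K + 7) (c := 1 / 4) (by norm_num)
  set D : ℝ := 1 + 2 ^ (K + 1) * (M + 2) with hD
  have hD1 : 1 ≤ D := by rw [hD]; linarith [show (0:ℝ) ≤ 2 ^ (K + 1) * (M + 2) by positivity]
  set Q : ℝ := D ^ (K + 2) * C₃ * (2 ^ (K + 1) * Cu) with hQ
  set Q' : ℝ := D ^ (K + 2) * C₃ * Ce with hQ'
  have hQ0 : 0 ≤ Q := by positivity
  have hQ'0 : 0 ≤ Q' := by positivity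
  -- One half of ε goes to the Taylor remainder, made small by the choice of δ. The other half goes
  -- to the defect, which has an additional factor z and is small for large n.
  set ε₁ : ℝ := ε / (2 * (Q + 1)) with hε₁
  have hε₁0 : 0 < ε₁ := by positivity
  obtain ⟨δ, hδ, hδ₁', hS⟩ := exists_forall_iteratedDeriv_le (S := logDerivRem μ K) (m := K + 1) hδ₁
    (fun u hu => contDiffAt_logDerivRem hμ K (hL u hu).1)
    (fun j hj => iteratedDeriv_logDerivRem_zero hμ hmean hvar hj) hε₁0
  refine ⟨δ, hδ, ?_⟩
  have hz_tendsto : Tendsto (fun n : ℕ => (√(n : ℝ))⁻¹) atTop (nhds 0) :=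
    (Real.tendsto_sqrt_atTop.comp tendsto_natCast_atTop_atTop).inv_tendsto_atTop
  filter_upwards [eventually_ge_atTop 1,
    hz_tendsto.eventually (gt_mem_nhds (show (0 : ℝ) < min 1 (ε / (2 * (Q' + 1))) by positivity))]
    with n hn hzn t ht j hj
  have hzl1 := (lt_min_iff.1 hzn).1.le
  have hzl2 := (lt_min_iff.1 hzn).2.le
  clear hzn
  have hn0 : (0 : ℝ) < n := by exact_mod_cast hn
  have hsq : 0 < √(n : ℝ) := Real.sqrt_pos.2 hn0
  have hder := fun (t : ℝ) h => hasDerivAt_cfDiff (μ := μ) (K := K) (t := t) hμ hn h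
  set z : ℝ := (√(n : ℝ))⁻¹ with hz
  have hz0 : 0 < z := by positivity
  have hin : ∀ {t : ℝ}, |t| < δ * √(n : ℝ) → |z * t| < δ := by
    intro t ht
    rw [abs_mul, abs_of_pos hz0, hz, inv_mul_lt_iff₀ hsq]
    linarith
  have hin' : ∀ {t : ℝ}, |t| < δ * √(n : ℝ) → |z * t| < δ₁ := fun h => (hin h).trans hδ₁'
  set a : ℝ → ℂ := fun t => (z : ℂ)⁻¹ * logDerivCF μ (z * t) with ha
  set ρ : ℝ → ℂ := fun t => (z : ℂ)⁻¹ * logDerivRem μ K (z * t) with hρ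
  set u : ℝ → ℂ := gaussPoly (edgePoly (cumulant μ) K z) with hudef
  set e : ℝ → ℂ := gaussPoly (edgeDefect (cumulant μ) K z) with hedef
  set B : ℝ := (2 ^ (K + 1) * Cu * ε₁ + Ce * z) * z ^ K with hB
  have hB0 : 0 ≤ B := by positivity
  have hscale : ∀ t : ℝ, ContDiff ℝ (K + 1 : ℕ) (fun t : ℝ => z * t) := fun _ =>
    contDiff_const.mul contDiff_id
  have hnormz : ‖(z : ℂ)⁻¹‖ = z⁻¹ := by
    rw [norm_inv, Complex.norm_real, Real.norm_eq_abs, abs_of_pos hz0]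
  have hac : ∀ t, |t| < δ * √(n : ℝ) → ContDiffAt ℝ (K + 1 : ℕ) a t := fun t ht =>
    contDiffAt_const.mul ((contDiffAt_logDerivCF hμ (hL _ (hin' ht)).1).comp t
      (hscale t).contDiffAt)
  have hρc : ∀ t, |t| < δ * √(n : ℝ) → ContDiffAt ℝ (K + 1 : ℕ) ρ t := fun t ht =>
    contDiffAt_const.mul ((contDiffAt_logDerivRem hμ K (hL _ (hin' ht)).1).comp t
      (hscale t).contDiffAt)
  have huc : ∀ t, ContDiffAt ℝ (K + 1 : ℕ) u t := fun t => (contDiff_gaussPoly _).contDiffAt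
  have hec : ∀ t, ContDiffAt ℝ (K + 1 : ℕ) e t := fun t => (contDiff_gaussPoly _).contDiffAt
  -- z⁻¹ z^i |zt|^(K+1-i) = z^K |t|^(K+1-i): every derivative of ρ has the same power of z.
  have hρb : ∀ t, |t| < δ * √(n : ℝ) → ∀ i ≤ K + 1,
      ‖iteratedDeriv i ρ t‖ ≤ ε₁ * z ^ K * (1 + |t|) ^ (K + 1) := by
    intro t ht i hi
    have h1 := hS (z * t) (hin ht).le i hi
    rw [hρ, iteratedDeriv_const_mul_field, iteratedDeriv_comp_mul_left_real, norm_mul, hnormz,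
      norm_smul, Real.norm_eq_abs, abs_of_nonneg (pow_nonneg hz0.le _)]
    calc _ ≤ z⁻¹ * (z ^ i * (ε₁ * |z * t| ^ (K + 1 - i))) := by gcongr
      _ = ε₁ * (z⁻¹ * (z ^ i * z ^ (K + 1 - i))) * |t| ^ (K + 1 - i) := by
          rw [abs_mul, abs_of_pos hz0, mul_pow]; ring
      _ = ε₁ * z ^ K * |t| ^ (K + 1 - i) := by
          rw [← pow_add, show i + (K + 1 - i) = K + 1 by omega, pow_succ']
          field_simp
      _ ≤ ε₁ * z ^ K * (1 + |t|) ^ (K + 1) := by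
          gcongr
          calc |t| ^ (K + 1 - i) ≤ (1 + |t|) ^ (K + 1 - i) := by gcongr; linarith
            _ ≤ _ := pow_le_pow_right₀ (by linarith [abs_nonneg t]) (by omega)
  have hbb : ∀ t, |t| < δ * √(n : ℝ) → ∀ i ≤ K + 1,
      ‖iteratedDeriv i (ρ * u + e) t‖ ≤ B * Real.exp (-(t ^ 2 / 4)) := by
    intro t ht i hi
    have hle : ((i : ℕ) : WithTop ℕ∞) ≤ ((K + 1 : ℕ) : WithTop ℕ∞) := by exact_mod_cast hi
    have hρi := (hρc t ht).of_le hle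
    have hui := (huc t).of_le hle
    have hei := (hec t).of_le hle
    rw [iteratedDeriv_add (f := ρ * u) (hρi.mul hui) hei, iteratedDeriv_mul hρi hui]
    have h1 : ‖∑ l ∈ Finset.range (i + 1), (i.choose l : ℂ) * iteratedDeriv l ρ t *
        iteratedDeriv (i - l) u t‖ ≤ 2 ^ (K + 1) * (ε₁ * z ^ K * (Cu * Real.exp (-(t ^ 2 / 4)))) := by
      calc _ ≤ ∑ l ∈ Finset.range (i + 1), (i.choose l : ℝ) *
            (ε₁ * z ^ K * (Cu * Real.exp (-(t ^ 2 / 4)))) := by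
            refine (norm_sum_le _ _).trans (Finset.sum_le_sum fun l hl => ?_)
            have hl' := Finset.mem_range.1 hl
            rw [norm_mul, norm_mul, Complex.norm_natCast, mul_assoc]
            refine mul_le_mul_of_nonneg_left ?_ (by positivity)
            calc _ ≤ ε₁ * z ^ K * (1 + |t|) ^ (K + 1) * ‖iteratedDeriv (i - l) u t‖ := by
                  gcongr
                  exact hρb t ht l (by omega)
              _ = ε₁ * z ^ K * ((1 + |t|) ^ (K + 1) * ‖iteratedDeriv (i - l) u t‖) := by ring
              _ ≤ _ := by
                  exact mul_le_mul_of_nonneg_left (hu z hz0.le hzl1 (i - l) (by omega) t)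
                    (by positivity)
        _ = 2 ^ i * (ε₁ * z ^ K * (Cu * Real.exp (-(t ^ 2 / 4)))) := by
            rw [← Finset.sum_mul]
            congr 1
            exact_mod_cast Nat.sum_range_choose i
        _ ≤ _ := by
            gcongr
            norm_num
    have h2 : ‖iteratedDeriv i e t‖ ≤ Ce * z ^ (K + 1) * Real.exp (-(t ^ 2 / 4)) := by
      simpa using he z hz0.le hzl1 i hi t
    calc _ ≤ 2 ^ (K + 1) * (ε₁ * z ^ K * (Cu * Real.exp (-(t ^ 2 / 4)))) +
          Ce * z ^ (K + 1) * Real.exp (-(t ^ 2 / 4)) := (norm_add_le _ _).trans (add_le_add h1 h2)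
      _ = _ := by rw [hB, pow_succ]; ring
  -- The factor z⁻¹ is harmless: for i = 0 it is cancelled by |L(u)| ≤ 2|u|, for i ≥ 1 by the chain
  -- rule.
  have hab : ∀ t, |t| < δ * √(n : ℝ) → ∀ i ≤ K + 1, ‖iteratedDeriv i a t‖ ≤ (M + 2) * (1 + |t|) := by
    intro t ht i hi
    obtain ⟨-, hl1, hl2⟩ := hL _ (hin' ht)
    have htn := abs_nonneg t
    rw [ha, iteratedDeriv_const_mul_field, iteratedDeriv_comp_mul_left_real, norm_mul, hnormz,
      norm_smul, Real.norm_eq_abs, abs_of_nonneg (pow_nonneg hz0.le _)]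
    rcases i with _ | i
    · have h1 : ‖logDerivCF μ (z * t)‖ ≤ 2 * (z * |t|) := by
        have h3 := norm_sub_norm_le (logDerivCF μ (z * t)) (-((z * t : ℝ) : ℂ))
        rw [norm_neg, Complex.norm_real, Real.norm_eq_abs, sub_neg_eq_add] at h3
        have h2 : |z * t| = z * |t| := by rw [abs_mul, abs_of_pos hz0]
        rw [h2] at hl1 h3
        have : 0 ≤ z * |t| := by positivity
        linarith
      simp only [pow_zero, one_mul, iteratedDeriv_zero]
      calc _ ≤ z⁻¹ * (2 * (z * |t|)) := by gcongr
        _ = 2 * |t| := by field_simp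
        _ ≤ _ := by nlinarith [mul_nonneg hM htn]
    · calc _ ≤ z⁻¹ * (z ^ (i + 1) * M) := by gcongr; exact hl2 _ hi
        _ = z ^ i * M := by rw [pow_succ']; field_simp
        _ ≤ 1 * M := by gcongr; exact pow_le_one₀ hz0.le hzl1
        _ ≤ _ := by nlinarith [mul_nonneg hM htn]
  have key := norm_iteratedDeriv_le_of_linear_ode (G := cfDiff μ K n) (a := a) (b := ρ * u + e)
    (ℓ := δ * √(n : ℝ)) (B := B) (M := M + 2) (m := K + 1) hB0 (by positivity)
    (fun t ht => hder t (hL _ (hin' ht)).1) ?_ (contDiff_cfDiff hμ n) hac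
    (fun t ht => ((hρc t ht).mul (huc t)).add (hec t)) hab hbb (cfDiff_zero K n) j hj t ht
  · have htn := abs_nonneg t
    calc _ ≤ (1 + |t|) ^ 4 * (D ^ j * B * (1 + |t|) ^ (j + 1) * Real.exp (-(t ^ 2 / 4))) := by
          gcongr
      _ ≤ (1 + |t|) ^ 4 * (D ^ (K + 2) * B * (1 + |t|) ^ (K + 3) * Real.exp (-(t ^ 2 / 4))) := by
          have h1 : D ^ j ≤ D ^ (K + 2) := pow_le_pow_right₀ hD1 hj
          have h2 : (1 + |t|) ^ (j + 1) ≤ (1 + |t|) ^ (K + 3) :=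
            pow_le_pow_right₀ (by linarith) (by omega)
          gcongr
      _ = D ^ (K + 2) * B * ((1 + |t|) ^ (K + 7) * Real.exp (-(1 / 4 * t ^ 2))) := by
          rw [show K + 7 = 4 + (K + 3) by omega, pow_add, show -(1 / 4 * t ^ 2) = -(t ^ 2 / 4) by ring]
          ring
      _ ≤ D ^ (K + 2) * B * C₃ := by gcongr; exact h₃ t
      _ = (Q * ε₁ + Q' * z) * z ^ K := by rw [hB, hQ, hQ']; ring
      _ ≤ ε * z ^ K := by
          gcongr
          have h1 : Q * ε₁ ≤ ε / 2 := mul_div_two_mul_add_one_le hQ0 hε.le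
          have h2 : Q' * z ≤ ε / 2 :=
            (mul_le_mul_of_nonneg_left hzl2 hQ'0).trans (mul_div_two_mul_add_one_le hQ'0 hε.le)
          linarith
  · intro t ht
    obtain ⟨-, hl1, -⟩ := hL _ (hin' ht)
    have h1 : (a t).re = z⁻¹ * (logDerivCF μ (z * t)).re := by
      simp only [ha]
      rw [← Complex.ofReal_inv, Complex.re_ofReal_mul]
    have h2 : |(logDerivCF μ (z * t)).re + z * t| ≤ |z * t| / 2 := by
      have h3 := (Complex.abs_re_le_norm (logDerivCF μ (z * t) + ((z * t : ℝ) : ℂ))).trans hl1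
      rwa [Complex.add_re, Complex.ofReal_re] at h3
    rw [h1]
    set w := (logDerivCF μ (z * t)).re with hw
    -- The deviation of w from -zt is at most |zt|/2, so it spends half of the main term -t².
    have h4 : t * (z⁻¹ * w) = z⁻¹ ^ 2 * ((z * t) * (w + z * t)) - t ^ 2 := by
      field_simp
      ring
    have h5 : (z * t) * (w + z * t) ≤ (z * t) ^ 2 / 2 := by
      calc _ ≤ |(z * t) * (w + z * t)| := le_abs_self _
        _ = |z * t| * |w + z * t| := abs_mul _ _
        _ ≤ |z * t| * (|z * t| / 2) := by gcongr
        _ = (z * t) ^ 2 / 2 := by rw [← sq_abs (z * t)]; ring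
    rw [h4]
    calc _ ≤ z⁻¹ ^ 2 * ((z * t) ^ 2 / 2) - t ^ 2 := by gcongr
      _ = _ := by field_simp; ring

end FisherCLT

namespace FisherCLT

/-! ### Approximation of the characteristic function on the line -/

variable {μ : Measure ℝ}

theorem norm_charFun_abs (u : ℝ) : ‖charFun μ |u|‖ = ‖charFun μ u‖ := by
  rcases abs_choice u with h | h
  · rw [h]
  · rw [h, charFun_neg, RCLike.norm_conj]

theorem tendsto_norm_charFun_of_decay {m : ℕ} (hm : m ≠ 0) {C : ℝ}
    (hdecay : ∀ t, |t| * ‖charFun μ t‖ ^ m ≤ C) :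
    Tendsto (fun t => ‖charFun μ t‖) atTop (nhds 0) := by
  have h1 : Tendsto (fun t => ‖charFun μ t‖ ^ m) atTop (nhds 0) := by
    refine squeeze_zero' (Eventually.of_forall fun t => by positivity) ?_
      (tendsto_const_nhds.div_atTop tendsto_id (a := C))
    filter_upwards [eventually_gt_atTop 0] with t ht
    rw [id, le_div_iff₀ ht, mul_comm]
    simpa [abs_of_pos ht] using hdecay t
  have h2 : Tendsto (fun t => (‖charFun μ t‖ ^ m) ^ ((m : ℝ)⁻¹)) atTop (nhds (0 ^ ((m : ℝ)⁻¹))) :=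
    h1.rpow_const (Or.inr (by positivity))
  rw [Real.zero_rpow (by positivity)] at h2
  refine h2.congr fun t => Real.pow_rpow_inv_natCast (norm_nonneg _) hm

variable [IsProbabilityMeasure μ]

theorem re_charFun_eq_integral_cos (ν : Measure ℝ) [IsProbabilityMeasure ν] (t : ℝ) :
    (charFun ν t).re = ∫ x, Real.cos (t * x) ∂ν := by
  rw [charFun_apply_real]
  have hint : Integrable (fun x : ℝ => Complex.exp (t * x * Complex.I)) ν := by
    refine (integrable_const (1 : ℝ)).mono' (by fun_prop) (Eventually.of_forall fun x => ?_)
    rw [← Complex.ofReal_mul, Complex.norm_exp_ofReal_mul_I]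
  have := integral_re hint
  simp only [RCLike.re_eq_complex_re] at this
  rw [← this]
  refine integral_congr_ae (Eventually.of_forall fun x => ?_)
  simp only
  rw [← Complex.ofReal_mul, Complex.exp_ofReal_mul_I_re]

/-- The inequality 1 - cos 2θ ≤ 4(1 - cos θ), integrated. -/
theorem one_sub_re_charFun_two_mul_le (ν : Measure ℝ) [IsProbabilityMeasure ν] (t : ℝ) :
    1 - (charFun ν (2 * t)).re ≤ 4 * (1 - (charFun ν t).re) := by
  rw [re_charFun_eq_integral_cos, re_charFun_eq_integral_cos]
  have hi : ∀ c : ℝ, Integrable (fun x => Real.cos (c * x)) ν := fun c =>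
    (integrable_const (1 : ℝ)).mono' (by fun_prop)
      (Eventually.of_forall fun x => by rw [Real.norm_eq_abs]; exact Real.abs_cos_le_one _)
  have h1 : ∀ c : ℝ, 1 - ∫ x, Real.cos (c * x) ∂ν = ∫ x, (1 - Real.cos (c * x)) ∂ν := fun c => by
    rw [integral_sub (integrable_const _) (hi c)]
    simp
  rw [h1, h1, ← integral_const_mul]
  refine integral_mono ((integrable_const _).sub (hi _)) (((integrable_const _).sub (hi _)).const_mul 4)
    fun x => ?_
  simp only
  rw [mul_assoc, Real.cos_two_mul]
  nlinarith [sq_nonneg (Real.cos (t * x) - 1)]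

/-- The preceding inequality for the symmetrized law, whose characteristic function is |f|². -/
theorem one_sub_norm_charFun_sq_two_mul_le (t : ℝ) :
    1 - ‖charFun μ (2 * t)‖ ^ 2 ≤ 4 * (1 - ‖charFun μ t‖ ^ 2) := by
  have hp : IsProbabilityMeasure (μ.map (fun x => (-1 : ℝ) * x)) :=
    Measure.isProbabilityMeasure_map (by fun_prop)
  have h : ∀ t : ℝ, (charFun (μ.conv (μ.map (fun x => (-1 : ℝ) * x))) t).re = ‖charFun μ t‖ ^ 2 := by
    intro t
    rw [charFun_conv, charFun_map_mul, neg_one_mul, charFun_neg, Complex.mul_conj,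
      Complex.ofReal_re, Complex.normSq_eq_norm_sq]
  have := one_sub_re_charFun_two_mul_le (μ.conv (μ.map (fun x => (-1 : ℝ) * x))) t
  rwa [h, h] at this

/-- If |f(u)| = 1, the doubling inequality propagates this to |f(2^k u)| = 1 for all k, against the
decay at infinity. -/
theorem norm_charFun_lt_one (hlim : Tendsto (fun t => ‖charFun μ t‖) atTop (nhds 0)) {u : ℝ}
    (hu : 0 < u) : ‖charFun μ u‖ < 1 := by
  by_contra hcon
  have h1 : ‖charFun μ u‖ = 1 := le_antisymm (norm_charFun_le_one u) (not_lt.1 hcon)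
  have h2 : ∀ k : ℕ, ‖charFun μ (2 ^ k * u)‖ = 1 := by
    intro k
    induction k with
    | zero => simpa using h1
    | succ k ih =>
      have h3 := one_sub_norm_charFun_sq_two_mul_le (μ := μ) (2 ^ k * u)
      rw [ih] at h3
      rw [pow_succ', mul_assoc]
      have h4 := norm_charFun_le_one (μ := μ) (2 * (2 ^ k * u))
      have h5 := norm_nonneg (charFun μ (2 * (2 ^ k * u)))
      nlinarith
  have h3 : Tendsto (fun k : ℕ => (2 : ℝ) ^ k * u) atTop atTop :=
    (tendsto_pow_atTop_atTop_of_one_lt one_lt_two).atTop_mul_const hu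
  have h4 := hlim.comp h3
  have h5 : (fun k : ℕ => ‖charFun μ (2 ^ k * u)‖) = fun _ => (1 : ℝ) := funext h2
  have h6 : Tendsto (fun _ : ℕ => (1 : ℝ)) atTop (nhds 0) := by
    rw [← h5]; exact h4
  exact one_ne_zero (tendsto_nhds_unique tendsto_const_nhds h6)

theorem exists_norm_charFun_le_of_tendsto
    (hlim : Tendsto (fun t => ‖charFun μ t‖) atTop (nhds 0)) {δ : ℝ} (hδ : 0 < δ) :
    ∃ η : ℝ, 0 ≤ η ∧ η < 1 ∧ ∀ u, δ ≤ |u| → ‖charFun μ u‖ ≤ η := by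
  obtain ⟨R, hR⟩ := Filter.eventually_atTop.1 (hlim.eventually (gt_mem_nhds (by norm_num : (0 : ℝ) < 1 / 2)))
  have hc : Continuous fun u => ‖charFun μ u‖ := continuous_charFun.norm
  set R' := max R δ with hR'
  obtain ⟨x, hx, hmax⟩ := isCompact_Icc.exists_isMaxOn (s := Set.Icc δ R')
    ⟨δ, le_rfl, le_max_right _ _⟩ hc.continuousOn
  have hx1 : ‖charFun μ x‖ < 1 := norm_charFun_lt_one hlim (hδ.trans_le hx.1)
  refine ⟨max (1 / 2) ‖charFun μ x‖, by positivity, max_lt (by norm_num) hx1, fun u hu => ?_⟩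
  rw [← norm_charFun_abs]
  rcases le_total |u| R' with h | h
  · exact (hmax ⟨hu, h⟩).trans (le_max_right _ _)
  · exact (hR _ ((le_max_left _ _).trans h)).le.trans (le_max_left _ _)

theorem eventually_mul_pow_le (A : ℝ) (k l : ℕ) {q ε : ℝ} (hq0 : 0 ≤ q) (hq1 : q < 1) (hε : 0 < ε) :
    ∀ᶠ n : ℕ in atTop, A * (n : ℝ) ^ k * q ^ (n - l) ≤ ε := by
  have h1 : Tendsto (fun n : ℕ => ((n : ℝ)) ^ k * q ^ n) atTop (nhds 0) :=
    tendsto_pow_const_mul_const_pow_of_lt_one k hq0 hq1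
  have h2 : Tendsto (fun n : ℕ => |A| * 2 ^ k * ((n : ℝ) ^ k * q ^ n)) atTop (nhds 0) := by
    simpa using h1.const_mul (|A| * 2 ^ k)
  have h3 := (h2.comp (tendsto_sub_atTop_nat l)).eventually (gt_mem_nhds hε)
  filter_upwards [h3, eventually_ge_atTop (2 * l), eventually_ge_atTop 1] with n hn hl hn1
  refine le_trans ?_ hn.le
  simp only [Function.comp_apply]
  have h4 : (n : ℝ) ≤ 2 * ((n - l : ℕ) : ℝ) := by
    exact_mod_cast (by omega : n ≤ 2 * (n - l))
  calc _ ≤ |A| * (2 * ((n - l : ℕ) : ℝ)) ^ k * q ^ (n - l) := by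
        gcongr
        exact le_abs_self A
    _ = _ := by rw [mul_pow]; ring

/-- No cancellation is used here; both terms are exponentially small. Of the n factors |f|, at most
K + 2 are lost to differentiation, 4m pay for the weight (1+|u|)^4 through the decay hypothesis, and
the rest give a power of η < 1. -/
theorem cfDiff_bound_outer {K m : ℕ} (hμ : MemLp id (K + 2 : ℕ) μ) (hm : m ≠ 0) {C : ℝ}
    (hdecay : ∀ t, |t| * ‖charFun μ t‖ ^ m ≤ C) {δ ε : ℝ} (hδ : 0 < δ) (hε : 0 < ε) :
    ∀ᶠ n : ℕ in atTop, ∀ t : ℝ, δ * √(n : ℝ) ≤ |t| → ∀ j ≤ K + 2,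
      (1 + |t|) ^ 4 * ‖iteratedDeriv j (cfDiff μ K n) t‖ ≤ ε * (√(n : ℝ))⁻¹ ^ K := by
  obtain ⟨η, hη0, hη1, hη⟩ := exists_norm_charFun_le_of_tendsto
    (tendsto_norm_charFun_of_decay hm hdecay) hδ
  obtain ⟨M, hM, hMb⟩ := norm_iteratedDeriv_charFun_le hμ
  have hf : ContDiff ℝ (K + 2 : ℕ) (charFun μ) := contDiff_charFun hμ
  choose! A hA0 hA using fun j (hj : j ≤ K + 2) =>
    exists_norm_iteratedDeriv_pow_le hM hf norm_charFun_le_one hMb j hj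
  set A' : ℝ := ∑ j ∈ Finset.range (K + 3), A j with hA'
  have hA'le : ∀ j ≤ K + 2, A j ≤ A' := fun j hj =>
    Finset.single_le_sum (f := A) (fun i hi => hA0 i (by have := Finset.mem_range.1 hi; omega))
      (Finset.mem_range.2 (by omega))
  have hA'0 : 0 ≤ A' := (hA0 0 (by omega)).trans (hA'le 0 (by omega))
  obtain ⟨Cu, hCu, hu⟩ := exists_edgePoly_bound (cumulant μ) K 4 (K + 2)
  have hC0 : 0 ≤ C := le_trans (by positivity) (hdecay 0)
  have hq1 : Real.exp (-(δ ^ 2 / 4)) < 1 := by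
    rw [← Real.exp_zero]
    exact Real.exp_lt_exp.2 (by linarith [pow_pos hδ 2])
  filter_upwards [eventually_ge_atTop 1, eventually_ge_atTop (K + 2 + 4 * m),
    eventually_mul_pow_le (A' * (1 + C) ^ 4) (K + 4 + K) (K + 2 + 4 * m) hη0 hη1 (half_pos hε),
    eventually_mul_pow_le Cu K 0 (Real.exp_pos _).le hq1 (half_pos hε)]
    with n hn hn2 hA1 hE1 t ht j hj
  have hn1 : (1 : ℝ) ≤ n := by exact_mod_cast hn
  have hn0 : (0 : ℝ) < n := by linarith
  have hsq : 0 < √(n : ℝ) := Real.sqrt_pos.2 hn0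
  have hsq1 : 1 ≤ √(n : ℝ) := Real.one_le_sqrt.2 hn1
  have hsqn : √(n : ℝ) ^ 2 = n := Real.sq_sqrt hn0.le
  set z : ℝ := (√(n : ℝ))⁻¹ with hz
  have hz0 : 0 < z := by positivity
  have hz1 : z ≤ 1 := inv_le_one_of_one_le₀ hsq1
  -- This inserts the required factor z^K at the cost of n^K, which the exponential smallness
  -- absorbs.
  have hzK : (1 : ℝ) ≤ n ^ K * z ^ K := by
    rw [← mul_pow]
    refine one_le_pow₀ ?_
    have : (n : ℝ) * z = √(n : ℝ) := by rw [hz, ← div_eq_mul_inv, div_eq_iff hsq.ne', ← sq, hsqn]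
    rw [this]
    exact hsq1
  set u := z * t with hudef
  have hut : |t| = √(n : ℝ) * |u| := by
    rw [hudef, abs_mul, abs_of_pos hz0, hz]; field_simp
  have hδu : δ ≤ |u| := by
    rw [hut] at ht
    exact le_of_mul_le_mul_left (by linarith) hsq
  have hsplit : iteratedDeriv j (cfDiff μ K n) t =
      iteratedDeriv j (fun t => charFun μ (z * t) ^ n) t -
        iteratedDeriv j (gaussPoly (edgePoly (cumulant μ) K z)) t := by
    rw [show cfDiff μ K n = (fun t => charFun μ (z * t) ^ n) -
      gaussPoly (edgePoly (cumulant μ) K z) from rfl]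
    refine iteratedDeriv_sub ?_ (contDiff_gaussPoly _).contDiffAt
    exact (((hf.of_le (by exact_mod_cast hj)).comp (contDiff_const.mul contDiff_id)).pow n).contDiffAt
  have hF : (1 + |t|) ^ 4 * ‖iteratedDeriv j (fun t => charFun μ (z * t) ^ n) t‖ ≤ ε / 2 * z ^ K := by
    rw [iteratedDeriv_comp_mul_left_real j (fun t => charFun μ t ^ n) z]
    simp only
    rw [norm_smul, Real.norm_eq_abs, abs_of_nonneg (pow_nonneg hz0.le _), ← hudef]
    have h1 := hA j hj n u
    have hw0 := norm_nonneg (charFun μ u)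
    have hw1 := norm_charFun_le_one (μ := μ) u
    have hwη := hη u hδu
    have hdec := hdecay u
    set w := ‖charFun μ u‖ with hw
    have h2 : (1 + |t|) ^ 4 ≤ (n : ℝ) ^ 2 * (1 + |u|) ^ 4 := by
      have : 1 + |t| ≤ √(n : ℝ) * (1 + |u|) := by rw [hut]; linarith
      calc (1 + |t|) ^ 4 ≤ (√(n : ℝ) * (1 + |u|)) ^ 4 := by gcongr
        _ = (√(n : ℝ) ^ 2) ^ 2 * (1 + |u|) ^ 4 := by ring
        _ = _ := by rw [hsqn]
    have h3 : (1 + |u|) ^ 4 * w ^ (4 * m) ≤ (1 + C) ^ 4 := by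
      rw [mul_comm 4 m, pow_mul, ← mul_pow]
      gcongr
      have : w ^ m ≤ 1 := pow_le_one₀ hw0 hw1
      nlinarith
    have h4 : w ^ (n - j) ≤ w ^ (4 * m) * η ^ (n - (K + 2 + 4 * m)) := by
      calc w ^ (n - j) ≤ w ^ (4 * m + (n - (K + 2 + 4 * m))) :=
            pow_le_pow_of_le_one hw0 hw1 (by omega)
        _ = w ^ (4 * m) * w ^ (n - (K + 2 + 4 * m)) := pow_add _ _ _
        _ ≤ _ := by gcongr
    have h5 : (n : ℝ) ^ j ≤ (n : ℝ) ^ (K + 2) := pow_le_pow_right₀ hn1 hj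
    have h6 : z ^ j ≤ 1 := pow_le_one₀ hz0.le hz1
    have hAj := hA'le j hj
    have hAj0 := hA0 j hj
    calc _ ≤ ((n : ℝ) ^ 2 * (1 + |u|) ^ 4) * (1 * (A' * (n : ℝ) ^ (K + 2) *
          (w ^ (4 * m) * η ^ (n - (K + 2 + 4 * m))))) := by
          have h7 : A j * (n : ℝ) ^ j * w ^ (n - j) ≤ A' * (n : ℝ) ^ (K + 2) *
            (w ^ (4 * m) * η ^ (n - (K + 2 + 4 * m))) := by gcongr
          exact mul_le_mul h2 (mul_le_mul h6 (h1.trans h7) (norm_nonneg _) zero_le_one)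
            (by positivity) (by positivity)
      _ = A' * ((1 + |u|) ^ 4 * w ^ (4 * m)) * (n : ℝ) ^ (K + 4) * η ^ (n - (K + 2 + 4 * m)) * 1 := by
          ring
      _ ≤ A' * (1 + C) ^ 4 * (n : ℝ) ^ (K + 4) * η ^ (n - (K + 2 + 4 * m)) * (n ^ K * z ^ K) := by
          gcongr
      _ = (A' * (1 + C) ^ 4 * (n : ℝ) ^ (K + 4 + K) * η ^ (n - (K + 2 + 4 * m))) * z ^ K := by
          rw [pow_add _ (K + 4) K]; ring
      _ ≤ _ := by gcongr
  have hU : (1 + |t|) ^ 4 * ‖iteratedDeriv j (gaussPoly (edgePoly (cumulant μ) K z)) t‖ ≤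
      ε / 2 * z ^ K := by
    refine (hu z hz0.le hz1 j hj t).trans ?_
    have h1 : Real.exp (-(t ^ 2 / 4)) ≤ Real.exp (-(δ ^ 2 / 4)) ^ (n - 0) := by
      rw [← Real.exp_nat_mul]
      refine Real.exp_le_exp.2 ?_
      have : δ ^ 2 * n ≤ t ^ 2 := by
        rw [← sq_abs t, ← hsqn, ← mul_pow]
        gcongr
      rw [Nat.sub_zero]
      linarith
    calc _ ≤ Cu * Real.exp (-(δ ^ 2 / 4)) ^ (n - 0) * 1 := by rw [mul_one]; gcongr
      _ ≤ Cu * Real.exp (-(δ ^ 2 / 4)) ^ (n - 0) * (n ^ K * z ^ K) := by gcongr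
      _ = (Cu * n ^ K * Real.exp (-(δ ^ 2 / 4)) ^ (n - 0)) * z ^ K := by ring
      _ ≤ _ := by gcongr
  rw [hsplit]
  calc _ ≤ (1 + |t|) ^ 4 * (‖iteratedDeriv j (fun t => charFun μ (z * t) ^ n) t‖ +
        ‖iteratedDeriv j (gaussPoly (edgePoly (cumulant μ) K z)) t‖) := by
        gcongr
        exact norm_sub_le _ _
    _ ≤ _ := by linarith

/-- The Edgeworth approximation of the characteristic function of a normalized sum and of its
derivatives. -/
theorem cfDiff_bound {K m : ℕ} (hμ : MemLp id (K + 2 : ℕ) μ) (hmean : ∫ x, x ∂μ = 0)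
    (hvar : ∫ x, x ^ 2 ∂μ = 1) (hm : m ≠ 0) {C : ℝ}
    (hdecay : ∀ t, |t| * ‖charFun μ t‖ ^ m ≤ C) {ε : ℝ} (hε : 0 < ε) :
    ∀ᶠ n : ℕ in atTop, ∀ t : ℝ, ∀ j ≤ K + 2,
      (1 + |t|) ^ 4 * ‖iteratedDeriv j (cfDiff μ K n) t‖ ≤ ε * (√(n : ℝ))⁻¹ ^ K := by
  obtain ⟨δ, hδ, hin⟩ := exists_cfDiff_bound_inner hμ hmean hvar hε
  filter_upwards [hin, cfDiff_bound_outer hμ hm hdecay hδ hε] with n h1 h2 t j hj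
  rcases lt_or_ge |t| (δ * √(n : ℝ)) with h | h
  · exact h1 t h j hj
  · exact h2 t h j hj

end FisherCLT

namespace FisherCLT

/-! ### The inverse Fourier transform -/

open FourierTransform

/-- The function `x ↦ (2π)⁻¹ ∫ e^{-itx} g(t) dt`. -/
noncomputable def invFT (g : ℝ → ℂ) (x : ℝ) : ℂ :=
  ((2 * Real.pi)⁻¹ : ℝ) * 𝓕 g (x / (2 * Real.pi))

theorem invFT_eq_integral (g : ℝ → ℂ) (x : ℝ) :
    invFT g x = ((2 * Real.pi)⁻¹ : ℝ) * ∫ t : ℝ, Complex.exp (-(t * x * Complex.I)) * g t := by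
  rw [invFT, Real.fourier_real_eq_integral_exp_smul]
  congr 2
  ext t
  rw [smul_eq_mul]
  congr 2
  have : (Real.pi : ℂ) ≠ 0 := by exact_mod_cast Real.pi_ne_zero
  push_cast
  field_simp

theorem invFT_add {g h : ℝ → ℂ} (hg : Integrable g) (hh : Integrable h) (x : ℝ) :
    invFT (g + h) x = invFT g x + invFT h x := by
  rw [invFT_eq_integral, invFT_eq_integral, invFT_eq_integral, ← mul_add, ← integral_add]
  · congr 2
    ext t
    simp [mul_add]
  all_goals
    refine Integrable.bdd_mul (c := 1) ?_ (by fun_prop) (Eventually.of_forall fun t => ?_)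
    · assumption
    · rw [show -((t : ℂ) * x * Complex.I) = ((-(t * x) : ℝ) : ℂ) * Complex.I by push_cast; ring,
        Complex.norm_exp_ofReal_mul_I]

theorem norm_invFT_le {g : ℝ → ℂ} (x : ℝ) :
    ‖invFT g x‖ ≤ (2 * Real.pi)⁻¹ * ∫ t, ‖g t‖ := by
  rw [invFT, norm_mul, Complex.norm_real, Real.norm_eq_abs, abs_of_pos (by positivity)]
  gcongr
  exact VectorFourier.norm_fourierIntegral_le_integral_norm _ _ _ _ _

theorem hasDerivAt_invFT {g : ℝ → ℂ} (hg : Integrable g)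
    (hg' : Integrable (fun t : ℝ => (t : ℂ) * g t)) (x : ℝ) :
    HasDerivAt (invFT g) (invFT (fun t : ℝ => -(Complex.I * t) * g t) x) x := by
  have h1 := Real.hasDerivAt_fourier hg (by simpa using hg') (x / (2 * Real.pi))
  have h2 : HasDerivAt (fun x : ℝ => x / (2 * Real.pi)) (1 / (2 * Real.pi)) x :=
    (hasDerivAt_id x).div_const _
  have h3 := (h1.scomp x h2).const_mul (((2 * Real.pi)⁻¹ : ℝ) : ℂ)
  convert! h3 using 1
  rw [invFT]
  congr 1
  rw [Real.fourier_real_eq_integral_exp_smul, Real.fourier_real_eq_integral_exp_smul, ← integral_smul]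
  congr 1
  ext t
  have : (Real.pi : ℂ) ≠ 0 := by exact_mod_cast Real.pi_ne_zero
  simp only [smul_eq_mul, Complex.real_smul]
  push_cast
  field_simp

theorem pow_mul_invFT {g : ℝ → ℂ} {s : ℕ} (hg : ContDiff ℝ s g)
    (hgi : ∀ j ≤ s, Integrable (iteratedDeriv j g)) {j : ℕ} (hj : j ≤ s) (x : ℝ) :
    (Complex.I * x) ^ j * invFT g x = invFT (iteratedDeriv j g) x := by
  have h1 := Real.fourier_iteratedDeriv (N := s) (n := j) (f := g) (by exact_mod_cast hg)
    (fun n hn => hgi n (by exact_mod_cast hn)) (by exact_mod_cast hj)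
  rw [invFT, invFT, h1]
  simp only [smul_eq_mul]
  have : (Real.pi : ℂ) ≠ 0 := by exact_mod_cast Real.pi_ne_zero
  have h2 : (2 * Real.pi * Complex.I * ((x / (2 * Real.pi) : ℝ) : ℂ)) = Complex.I * x := by
    push_cast
    field_simp
  rw [h2]
  ring

theorem integrable_one_add_abs_inv_sq : Integrable (fun t : ℝ => ((1 + |t|) ^ 2)⁻¹) := by
  refine integrable_inv_one_add_sq.mono' (by fun_prop) (Eventually.of_forall fun t => ?_)
  rw [Real.norm_eq_abs, abs_of_pos (by positivity)]
  gcongr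
  rw [← sq_abs t]
  nlinarith [abs_nonneg t]

theorem integrable_of_one_add_abs_sq_mul_le {g : ℝ → ℂ} (hg : AEStronglyMeasurable g) {B : ℝ}
    (h : ∀ t, (1 + |t|) ^ 2 * ‖g t‖ ≤ B) :
    Integrable g ∧ ∫ t, ‖g t‖ ≤ B * ∫ t : ℝ, ((1 + |t|) ^ 2)⁻¹ := by
  have hb : ∀ t, ‖g t‖ ≤ B * ((1 + |t|) ^ 2)⁻¹ := fun t => by
    rw [← div_eq_mul_inv, le_div_iff₀ (by positivity), mul_comm]
    exact h t
  have hi := integrable_one_add_abs_inv_sq.const_mul B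
  have hgi : Integrable g := hi.mono' hg (Eventually.of_forall hb)
  exact ⟨hgi, by rw [← integral_const_mul]; exact integral_mono hgi.norm hi hb⟩

theorem one_add_pow_le_two_pow_mul {a : ℝ} (ha : 0 ≤ a) (s : ℕ) :
    (1 + a) ^ s ≤ 2 ^ s * (1 + a ^ s) := by
  rcases le_total a 1 with h | h
  · calc (1 + a) ^ s ≤ 2 ^ s := by gcongr; linarith
      _ ≤ _ := le_mul_of_one_le_right (by positivity) (by linarith [pow_nonneg ha s])
  · calc (1 + a) ^ s ≤ (2 * a) ^ s := by gcongr; linarith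
      _ = 2 ^ s * a ^ s := mul_pow _ _ _
      _ ≤ _ := by gcongr; linarith

/-- The weight (1+|t|)² makes the derivatives integrable with norm of order B. The bound for g
itself handles bounded x, and the derivative of order s produces the factor |x|^s. -/
theorem exists_invFT_bound (s : ℕ) : ∃ C : ℝ, 0 ≤ C ∧ ∀ (g : ℝ → ℂ) (B : ℝ), ContDiff ℝ s g →
    (∀ t, ∀ j ≤ s, (1 + |t|) ^ 2 * ‖iteratedDeriv j g t‖ ≤ B) →
    ∀ x, (1 + |x|) ^ s * ‖invFT g x‖ ≤ C * B := by
  set A := (2 * Real.pi)⁻¹ * ∫ t : ℝ, ((1 + |t|) ^ 2)⁻¹ with hA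
  have hA0 : 0 ≤ A := mul_nonneg (by positivity) (integral_nonneg fun t => by positivity)
  refine ⟨2 ^ s * (2 * A), by positivity, fun g B hg hB x => ?_⟩
  have hmeas : ∀ j ≤ s, AEStronglyMeasurable (iteratedDeriv j g) := fun j hj =>
    (hg.continuous_iteratedDeriv j (by exact_mod_cast hj)).aestronglyMeasurable
  have hint := fun j hj => integrable_of_one_add_abs_sq_mul_le (hmeas j hj) (fun t => hB t j hj)
  have hbd : ∀ j ≤ s, ‖invFT (iteratedDeriv j g) x‖ ≤ A * B := fun j hj => by
    refine (norm_invFT_le x).trans ?_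
    calc _ ≤ (2 * Real.pi)⁻¹ * (B * ∫ t : ℝ, ((1 + |t|) ^ 2)⁻¹) := by gcongr; exact (hint j hj).2
      _ = _ := by rw [hA]; ring
  have h0 : ‖invFT g x‖ ≤ A * B := by simpa using hbd 0 (Nat.zero_le s)
  have hs : |x| ^ s * ‖invFT g x‖ ≤ A * B := by
    have := hbd s le_rfl
    rw [← pow_mul_invFT hg (fun j hj => (hint j hj).1) le_rfl, norm_mul, norm_pow, norm_mul,
      Complex.norm_I, one_mul, Complex.norm_real, Real.norm_eq_abs] at this
    exact this
  calc _ ≤ 2 ^ s * (1 + |x| ^ s) * ‖invFT g x‖ := by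
        gcongr
        exact one_add_pow_le_two_pow_mul (abs_nonneg x) s
    _ = 2 ^ s * (‖invFT g x‖ + |x| ^ s * ‖invFT g x‖) := by ring
    _ ≤ 2 ^ s * (A * B + A * B) := by gcongr
    _ = _ := by ring

theorem exists_norm_iteratedDeriv_eval_le (Q : Polynomial ℂ) (hQ : Q.natDegree ≤ 2) (J : ℕ) :
    ∃ C : ℝ, 0 ≤ C ∧ ∀ j ≤ J, ∀ t : ℝ,
      ‖iteratedDeriv j (fun u : ℝ => Q.eval (u : ℂ)) t‖ ≤ C * (1 + |t|) ^ 2 := by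
  choose C hC h using fun j : ℕ => exists_norm_eval_le (Polynomial.derivative^[j] Q)
  refine ⟨∑ j ∈ Finset.range (J + 1), C j, Finset.sum_nonneg fun j _ => hC j, fun j hj t => ?_⟩
  rw [iteratedDeriv_eval]
  refine (h j t).trans ?_
  have h1 : C j ≤ ∑ j ∈ Finset.range (J + 1), C j :=
    Finset.single_le_sum (fun j _ => hC j) (Finset.mem_range.2 (by omega))
  have h2 : (1 + |t|) ^ (Polynomial.derivative^[j] Q).natDegree ≤ (1 + |t|) ^ 2 :=
    pow_le_pow_right₀ (by linarith [abs_nonneg t])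
      ((Polynomial.natDegree_iterate_derivative Q j).trans (by omega))
  have := hC j
  have hs0 : 0 ≤ ∑ j ∈ Finset.range (J + 1), C j := Finset.sum_nonneg fun j _ => hC j
  gcongr

/-- Bounds of the function `invFT g` and its first two derivatives by the derivatives of `g`. -/
theorem exists_invFT_deriv_bound (s : ℕ) : ∃ C : ℝ, 0 ≤ C ∧ ∀ (g : ℝ → ℂ) (B : ℝ), ContDiff ℝ s g →
    (∀ t, ∀ j ≤ s, (1 + |t|) ^ 4 * ‖iteratedDeriv j g t‖ ≤ B) →
    ∃ d₁ d₂ : ℝ → ℂ, (∀ x, HasDerivAt (invFT g) (d₁ x) x) ∧ (∀ x, HasDerivAt d₁ (d₂ x) x) ∧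
      ∀ x, (1 + |x|) ^ s * ‖invFT g x‖ ≤ C * B ∧ (1 + |x|) ^ s * ‖d₁ x‖ ≤ C * B ∧
        (1 + |x|) ^ s * ‖d₂ x‖ ≤ C * B := by
  obtain ⟨C₀, hC₀, h₀⟩ := exists_invFT_bound s
  -- k derivatives of the inverse transform multiply g by (-it)^k. Of the weight (1+|t|)^4, two
  -- powers pay for k ≤ 2 and two for integrability.
  set q : ℕ → Polynomial ℂ := fun k => (-(Polynomial.C Complex.I * Polynomial.X)) ^ k with hq
  have hqd : ∀ k ≤ 2, (q k).natDegree ≤ 2 := fun k hk => by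
    refine Polynomial.natDegree_pow_le.trans ?_
    have h1 : (-(Polynomial.C Complex.I * Polynomial.X)).natDegree ≤ 1 := by
      rw [Polynomial.natDegree_neg]
      exact (Polynomial.natDegree_C_mul_le _ _).trans Polynomial.natDegree_X_le
    nlinarith
  choose! Cq hCq hqb using fun k (hk : k ≤ 2) => exists_norm_iteratedDeriv_eval_le (q k) (hqd k hk) s
  set C₁ := Cq 0 + Cq 1 + Cq 2 with hC₁
  have hCq0 := hCq 0 (by norm_num)
  have hCq1 := hCq 1 (by norm_num)
  have hCq2 := hCq 2 (by norm_num)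
  have hCq' : ∀ k ≤ 2, Cq k ≤ C₁ := by
    intro k hk
    interval_cases k <;> linarith
  refine ⟨C₀ * (2 ^ s * C₁), by positivity, fun g B hg hB => ?_⟩
  have hB0 : 0 ≤ B := le_trans (by positivity) (hB 0 0 (Nat.zero_le s))
  have key : ∀ k ≤ 2, ContDiff ℝ s (fun t : ℝ => (q k).eval (t : ℂ) * g t) ∧
      ∀ t, ∀ j ≤ s, (1 + |t|) ^ 2 * ‖iteratedDeriv j (fun t : ℝ => (q k).eval (t : ℂ) * g t) t‖ ≤
        2 ^ s * C₁ * B := by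
    intro k hk
    refine ⟨(contDiff_eval_ofReal _).mul hg, fun t j hj => ?_⟩
    have hgj : ContDiffAt ℝ j g t := (hg.of_le (by exact_mod_cast hj)).contDiffAt
    rw [show (fun t : ℝ => (q k).eval (t : ℂ) * g t) = (fun t : ℝ => (q k).eval (t : ℂ)) * g from rfl,
      iteratedDeriv_mul (contDiff_eval_ofReal _).contDiffAt hgj]
    calc _ ≤ (1 + |t|) ^ 2 * ∑ i ∈ Finset.range (j + 1), ‖(j.choose i : ℂ) *
          iteratedDeriv i (fun t : ℝ => (q k).eval (t : ℂ)) t * iteratedDeriv (j - i) g t‖ := by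
          gcongr
          exact norm_sum_le _ _
      _ = ∑ i ∈ Finset.range (j + 1), (1 + |t|) ^ 2 * ‖(j.choose i : ℂ) *
          iteratedDeriv i (fun t : ℝ => (q k).eval (t : ℂ)) t * iteratedDeriv (j - i) g t‖ :=
          Finset.mul_sum _ _ _
      _ ≤ ∑ i ∈ Finset.range (j + 1), (j.choose i : ℝ) * (C₁ * B) := by
          refine Finset.sum_le_sum fun i hi => ?_
          have hi' := Finset.mem_range.1 hi
          rw [norm_mul, norm_mul, Complex.norm_natCast]
          have h1 := hqb k hk i (by omega) t
          have h2 := hB t (j - i) (by omega)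
          have h3 : ‖iteratedDeriv i (fun t : ℝ => (q k).eval (t : ℂ)) t‖ ≤ C₁ * (1 + |t|) ^ 2 :=
            h1.trans (by gcongr; exact hCq' k hk)
          calc _ = (j.choose i : ℝ) * ((1 + |t|) ^ 2 *
                (‖iteratedDeriv i (fun t : ℝ => (q k).eval (t : ℂ)) t‖ * ‖iteratedDeriv (j - i) g t‖)) := by
                ring
            _ ≤ (j.choose i : ℝ) * ((1 + |t|) ^ 2 * (C₁ * (1 + |t|) ^ 2 * ‖iteratedDeriv (j - i) g t‖)) := by
                gcongr
            _ = (j.choose i : ℝ) * (C₁ * ((1 + |t|) ^ 4 * ‖iteratedDeriv (j - i) g t‖)) := by ring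
            _ ≤ _ := by gcongr
      _ = 2 ^ j * (C₁ * B) := by
          rw [← Finset.sum_mul]
          congr 1
          exact_mod_cast Nat.sum_range_choose j
      _ ≤ 2 ^ s * (C₁ * B) := by
          gcongr
          norm_num
      _ = _ := by ring
  have hint : ∀ k ≤ 2, Integrable (fun t : ℝ => (q k).eval (t : ℂ) * g t) := fun k hk =>
    (integrable_of_one_add_abs_sq_mul_le (key k hk).1.continuous.aestronglyMeasurable
      (fun t => by simpa using (key k hk).2 t 0 (Nat.zero_le s))).1
  have hstep : ∀ k ≤ 1, ∀ x, HasDerivAt (invFT (fun t : ℝ => (q k).eval (t : ℂ) * g t))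
      (invFT (fun t : ℝ => (q (k + 1)).eval (t : ℂ) * g t) x) x := by
    intro k hk x
    have h1 : (fun t : ℝ => (q (k + 1)).eval (t : ℂ) * g t) =
        fun t : ℝ => -(Complex.I * t) * ((q k).eval (t : ℂ) * g t) := by
      ext t
      simp only [hq, pow_succ, Polynomial.eval_mul, Polynomial.eval_neg, Polynomial.eval_C,
        Polynomial.eval_X]
      ring
    have h2 := hint (k + 1) (by omega)
    rw [h1] at h2 ⊢
    refine hasDerivAt_invFT (hint k (by omega)) ?_ x
    convert! h2.const_mul Complex.I using 1
    ext t
    linear_combination ((t : ℂ) * ((q k).eval (t : ℂ) * g t)) * Complex.I_sq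
  have hq0 : (fun t : ℝ => (q 0).eval (t : ℂ) * g t) = g := by
    ext t
    simp [hq]
  refine ⟨invFT (fun t : ℝ => (q 1).eval (t : ℂ) * g t),
    invFT (fun t : ℝ => (q 2).eval (t : ℂ) * g t), ?_, hstep 1 le_rfl, fun x => ?_⟩
  · have := hstep 0 (by norm_num)
    rwa [hq0] at this
  · have hx := fun k (hk : k ≤ 2) => h₀ _ _ (key k hk).1 (key k hk).2 x
    have hx0 := hx 0 (by norm_num)
    rw [hq0] at hx0
    refine ⟨hx0.trans_eq (by ring), (hx 1 (by norm_num)).trans_eq (by ring),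
      (hx 2 le_rfl).trans_eq (by ring)⟩

end FisherCLT

namespace FisherCLT

/-! ### The inverse Fourier transform of the Edgeworth polynomial -/

theorem gaussianPDFReal_zero_one (x : ℝ) :
    gaussianPDFReal 0 1 x = (√(2 * Real.pi))⁻¹ * Real.exp (-(x ^ 2 / 2)) := by
  simp [gaussianPDFReal, neg_div]

theorem hasDerivAt_gaussianPDFReal (x : ℝ) :
    HasDerivAt (gaussianPDFReal 0 1) (-x * gaussianPDFReal 0 1 x) x := by
  have h2 : HasDerivAt (fun t : ℝ => Real.exp (-(t ^ 2 / 2))) (Real.exp (-(x ^ 2 / 2)) * (-x)) x := by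
    have := ((((hasDerivAt_id x).pow 2).div_const 2).neg).exp
    convert! this using 1
    simp
  have h := h2.const_mul (√(2 * Real.pi))⁻¹
  rw [show gaussianPDFReal 0 1 = fun x => (√(2 * Real.pi))⁻¹ * Real.exp (-(x ^ 2 / 2)) from
    funext gaussianPDFReal_zero_one]
  convert! h using 1
  ring

theorem hasDerivAt_gaussianPDFReal_mul_eval (Q : Polynomial ℝ) (x : ℝ) :
    HasDerivAt (fun x => gaussianPDFReal 0 1 x * Q.eval x)
      (gaussianPDFReal 0 1 x * (Q.derivative - Polynomial.X * Q).eval x) x := by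
  convert! (hasDerivAt_gaussianPDFReal x).mul (Q.hasDerivAt x) using 1
  simp only [Polynomial.eval_sub, Polynomial.eval_mul, Polynomial.eval_X]
  ring

theorem integrable_gaussPoly (P : Polynomial ℂ) : Integrable (gaussPoly P) := by
  obtain ⟨C, hC, h⟩ := exists_gaussPoly_bound P 2
  refine (integrable_of_one_add_abs_sq_mul_le (B := C)
    (contDiff_gaussPoly (n := 0) P).continuous.aestronglyMeasurable fun t => (h t).trans ?_).1
  exact mul_le_of_le_one_right hC (Real.exp_le_one_iff.2 (by positivity |> neg_nonpos.2))

theorem invFT_const_mul (c : ℂ) (g : ℝ → ℂ) (x : ℝ) :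
    invFT (fun t => c * g t) x = c * invFT g x := by
  rw [invFT_eq_integral, invFT_eq_integral, mul_left_comm, ← integral_const_mul c]
  congr 1
  refine integral_congr_ae (Eventually.of_forall fun t => ?_)
  ring

theorem invFT_sum {ι : Type*} (s : Finset ι) (g : ι → ℝ → ℂ) (hg : ∀ i ∈ s, Integrable (g i))
    (x : ℝ) : invFT (fun t => ∑ i ∈ s, g i t) x = ∑ i ∈ s, invFT (g i) x := by
  classical
  induction s using Finset.induction_on with
  | empty => simp [invFT_eq_integral]
  | insert a s ha ih =>
    rw [Finset.sum_insert ha, ← ih fun i hi => hg i (Finset.mem_insert_of_mem hi),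
      ← invFT_add (hg a (Finset.mem_insert_self a s))
        (integrable_finsetSum _ fun i hi => hg i (Finset.mem_insert_of_mem hi))]
    congr 1
    ext t
    simp [Finset.sum_insert ha]

theorem invFT_gaussPoly_one (x : ℝ) : invFT (gaussPoly 1) x = (gaussianPDFReal 0 1 x : ℂ) := by
  rw [invFT_eq_integral]
  have h := fourierIntegral_gaussian (b := 1 / 2) (by norm_num) (-(x : ℂ))
  have h1 : (fun t : ℝ => Complex.exp (-(t * x * Complex.I)) * gaussPoly 1 t) =
      fun t : ℝ => Complex.exp (Complex.I * -(x : ℂ) * t) * Complex.exp (-(1 / 2) * (t : ℂ) ^ 2) := by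
    ext t
    simp only [gaussPoly, Polynomial.eval_one, one_mul]
    push_cast
    congr 2
    · ring
    · ring
  rw [h1, h, gaussianPDFReal_zero_one]
  have h2 : ((Real.pi : ℂ) / (1 / 2)) ^ (1 / 2 : ℂ) = (√(2 * Real.pi) : ℝ) := by
    rw [Real.sqrt_eq_rpow, Complex.ofReal_cpow (by positivity)]
    congr 1
    · push_cast; ring
    · norm_num
  have h3 : (2 * Real.pi)⁻¹ * √(2 * Real.pi) = (√(2 * Real.pi))⁻¹ := by
    have : √(2 * Real.pi) ≠ 0 := (Real.sqrt_pos.2 (by positivity)).ne'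
    nth_rewrite 1 [← Real.mul_self_sqrt (show 0 ≤ 2 * Real.pi by positivity)]
    field_simp
  rw [h2, ← mul_assoc, ← Complex.ofReal_mul, h3]
  push_cast
  congr 2
  ring

/-- Multiplication by -it corresponds to d/dx, and (φ H_m)' = -φ H_{m+1} because H_{m+1} = x H_m -
H_m'. -/
theorem invFT_gaussPoly_hermite (m : ℕ) (x : ℝ) :
    invFT (gaussPoly ((Polynomial.C Complex.I * Polynomial.X) ^ m)) x =
      ((gaussianPDFReal 0 1 x * Polynomial.aeval x (Polynomial.hermite m) : ℝ) : ℂ) := by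
  induction m generalizing x with
  | zero => simpa using invFT_gaussPoly_one x
  | succ m ih =>
    set H : ℕ → Polynomial ℝ := fun m => (Polynomial.hermite m).map (algebraMap ℤ ℝ) with hH
    have hHe : ∀ m x, Polynomial.aeval x (Polynomial.hermite m) = (H m).eval x := fun m x => by
      rw [hH, Polynomial.aeval_def, Polynomial.eval_map]
    have hHs : H (m + 1) = Polynomial.X * H m - (H m).derivative := by
      simp [hH, Polynomial.hermite_succ, Polynomial.derivative_map]
    have hf : invFT (gaussPoly ((Polynomial.C Complex.I * Polynomial.X) ^ m)) =
        fun x => ((gaussianPDFReal 0 1 x * (H m).eval x : ℝ) : ℂ) := by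
      ext x
      rw [ih, hHe]
    have hX : ∀ t : ℝ, (t : ℂ) * gaussPoly ((Polynomial.C Complex.I * Polynomial.X) ^ m) t =
        gaussPoly (Polynomial.X * (Polynomial.C Complex.I * Polynomial.X) ^ m) t := fun t => by
      simp only [gaussPoly, Polynomial.eval_mul, Polynomial.eval_X]
      ring
    have h1 := hasDerivAt_invFT (integrable_gaussPoly ((Polynomial.C Complex.I * Polynomial.X) ^ m))
      (by simp_rw [hX]; exact integrable_gaussPoly _) x
    rw [hf] at h1
    have h2 := (hasDerivAt_gaussianPDFReal_mul_eval (H m) x).ofReal_comp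
    have h3 := h1.unique h2
    have h4 : (fun t : ℝ => -(Complex.I * t) * gaussPoly ((Polynomial.C Complex.I * Polynomial.X) ^ m) t)
        = fun t : ℝ => (-1 : ℂ) * gaussPoly ((Polynomial.C Complex.I * Polynomial.X) ^ (m + 1)) t := by
      ext t
      simp only [gaussPoly, Polynomial.eval_mul, Polynomial.eval_pow, Polynomial.eval_C,
        Polynomial.eval_X]
      ring
    rw [h4, invFT_const_mul] at h3
    rw [hHe, hHs, show Polynomial.X * H m - (H m).derivative =
      -((H m).derivative - Polynomial.X * H m) by ring, Polynomial.eval_neg, mul_neg,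
      Complex.ofReal_neg, ← h3]
    ring

/-- The polynomial `q_k / φ`. -/
noncomputable def edgeworthPoly (γ : ℕ → ℝ) (k : ℕ) : Polynomial ℝ :=
  ∑ r ∈ weightedSolutions k,
    Polynomial.C (∏ i : Fin k,
      (γ ((i : ℕ) + 3) / (((i : ℕ) + 3).factorial : ℝ)) ^ r i / ((r i).factorial : ℝ)) *
    (Polynomial.hermite (k + 2 * ∑ i, r i)).map (algebraMap ℤ ℝ)

theorem edgeworthFun_eq (γ : ℕ → ℝ) (k : ℕ) (x : ℝ) :
    edgeworthFun γ k x = gaussianPDFReal 0 1 x * (edgeworthPoly γ k).eval x := by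
  rw [edgeworthFun, edgeworthPoly, Polynomial.eval_finsetSum]
  congr 1
  refine Finset.sum_congr rfl fun r _ => ?_
  rw [Polynomial.eval_mul, Polynomial.eval_C, Polynomial.eval_map, Polynomial.aeval_def, mul_comm]

/-- Each product of powers of `cumPoly` is a number times (it)^d with d = ∑ (i+3) r_i = k + 2 ∑ r_i,
and inverts to φ H_d. -/
theorem invFT_gaussPoly_expCoeff (γ : ℕ → ℝ) (k : ℕ) (x : ℝ) :
    invFT (gaussPoly (expCoeff (cumPoly γ) k k)) x = (edgeworthFun γ k x : ℂ) := by
  have h1 : ∀ r ∈ weightedSolutions k, (∏ i : Fin k, Polynomial.C ((r i).factorial : ℂ)⁻¹ *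
      cumPoly γ i ^ r i) = ((∏ i : Fin k, (γ ((i : ℕ) + 3) / (((i : ℕ) + 3).factorial : ℝ)) ^ r i /
        ((r i).factorial : ℝ) : ℝ) : ℂ) •
        (Polynomial.C Complex.I * Polynomial.X) ^ (k + 2 * ∑ i, r i) := by
    intro r hr
    have hk : k + 2 * ∑ i, r i = ∑ i : Fin k, ((i : ℕ) + 3) * r i := by
      have := (Finset.mem_filter.1 hr).2
      nth_rewrite 1 [← this]
      rw [Finset.mul_sum, ← Finset.sum_add_distrib]
      exact Finset.sum_congr rfl fun i _ => by ring
    rw [hk, ← Finset.prod_pow_eq_pow_sum, Polynomial.smul_eq_C_mul, Complex.ofReal_prod, map_prod,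
      ← Finset.prod_mul_distrib]
    refine Finset.prod_congr rfl fun i _ => ?_
    rw [cumPoly]
    push_cast
    simp only [div_eq_mul_inv, Polynomial.C_mul, Polynomial.C_pow, mul_pow, pow_mul]
    ring
  have h2 : gaussPoly (expCoeff (cumPoly γ) k k) = fun t => ∑ r ∈ weightedSolutions k,
      ((∏ i : Fin k, (γ ((i : ℕ) + 3) / (((i : ℕ) + 3).factorial : ℝ)) ^ r i /
        ((r i).factorial : ℝ) : ℝ) : ℂ) *
        gaussPoly ((Polynomial.C Complex.I * Polynomial.X) ^ (k + 2 * ∑ i, r i)) t := by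
    ext t
    rw [expCoeff, show (Fintype.piFinset fun _ : Fin k => Finset.range (k + 1)).filter
      (fun r => ∑ i : Fin k, ((i : ℕ) + 1) * r i = k) = weightedSolutions k from rfl,
      Finset.sum_congr rfl h1, gaussPoly, Polynomial.eval_finsetSum, Finset.sum_mul]
    refine Finset.sum_congr rfl fun r _ => ?_
    rw [Polynomial.eval_smul, smul_eq_mul, gaussPoly, mul_assoc]
  rw [h2, invFT_sum _ _ fun r _ => (integrable_gaussPoly _).const_mul _, edgeworthFun,
    Finset.mul_sum, Complex.ofReal_sum]
  refine Finset.sum_congr rfl fun r _ => ?_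
  rw [invFT_const_mul, invFT_gaussPoly_hermite, ← Complex.ofReal_mul]
  congr 1
  ring

/-- The polynomial `1 + ∑_{k ≤ K} z^k q_k / φ`. -/
noncomputable def edgeworthSum (γ : ℕ → ℝ) (K : ℕ) (z : ℝ) : Polynomial ℝ :=
  ∑ k ∈ Finset.range (K + 1), Polynomial.C (z ^ k) * edgeworthPoly γ k

theorem invFT_gaussPoly_edgePoly (γ : ℕ → ℝ) (K : ℕ) (z x : ℝ) :
    invFT (gaussPoly (edgePoly γ K z)) x =
      ((gaussianPDFReal 0 1 x * (edgeworthSum γ K z).eval x : ℝ) : ℂ) := by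
  have h2 : gaussPoly (edgePoly γ K z) = fun t => ∑ k ∈ Finset.range (K + 1),
      (z : ℂ) ^ k * gaussPoly (expCoeff (cumPoly γ) K k) t := by
    ext t
    rw [edgePoly, gaussPoly, Polynomial.eval_finsetSum, Finset.sum_mul]
    refine Finset.sum_congr rfl fun r _ => ?_
    rw [Polynomial.eval_smul, smul_eq_mul, gaussPoly, mul_assoc]
  rw [h2, invFT_sum _ _ fun r _ => (integrable_gaussPoly _).const_mul _, edgeworthSum,
    Polynomial.eval_finsetSum, Finset.mul_sum, Complex.ofReal_sum]
  refine Finset.sum_congr rfl fun k hk => ?_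
  have hk' := Finset.mem_range.1 hk
  rw [invFT_const_mul, expCoeff_of_le _ (by omega : k ≤ K), invFT_gaussPoly_expCoeff,
    edgeworthFun_eq, Polynomial.eval_mul, Polynomial.eval_C]
  push_cast
  ring

theorem edgeworthPoly_zero (γ : ℕ → ℝ) : edgeworthPoly γ 0 = 1 := by
  simp [edgeworthPoly, weightedSolutions]

/-! ### Densities by Fourier inversion. -/

theorem conj_invFT_charFun (ν : Measure ℝ) (x : ℝ) :
    (starRingEnd ℂ) (invFT (charFun ν) x) = invFT (charFun ν) x := by
  rw [invFT_eq_integral, map_mul, Complex.conj_ofReal, ← integral_conj,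
    ← integral_neg_eq_self (fun t : ℝ => Complex.exp (-(t * x * Complex.I)) * charFun ν t)]
  congr 2
  ext t
  rw [map_mul, ← charFun_neg, ← Complex.exp_conj]
  simp

theorem charFun_withDensity {p : ℝ → ℝ} (hp : Measurable p) (hp0 : ∀ x, 0 ≤ p x) (t : ℝ) :
    charFun (volume.withDensity fun x => ENNReal.ofReal (p x)) t =
      ∫ x : ℝ, Complex.exp (t * x * Complex.I) * p x := by
  rw [charFun_apply_real]
  have := integral_withDensity_eq_integral_smul (μ := volume) (f := fun x => (p x).toNNReal)
    hp.real_toNNReal (fun x : ℝ => Complex.exp (t * x * Complex.I))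
  simp only [ENNReal.ofReal]
  rw [this]
  congr 1
  ext x
  rw [NNReal.smul_def, Real.coe_toNNReal _ (hp0 x), Complex.real_smul, mul_comm]

/-- A law with integrable characteristic function and integrable inverse transform has
a continuous density given by the inversion formula. -/
theorem density_of_integrable_charFun {ν : Measure ℝ} [IsProbabilityMeasure ν]
    (h1 : Integrable (charFun ν)) (h2 : Integrable (invFT (charFun ν)))
    (hc : Continuous (invFT (charFun ν))) :
    (∀ x, 0 ≤ (invFT (charFun ν) x).re) ∧
      (∀ x, (((invFT (charFun ν) x).re : ℝ) : ℂ) = invFT (charFun ν) x) ∧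
      ν = volume.withDensity fun x => ENNReal.ofReal (invFT (charFun ν) x).re := by
  set p : ℝ → ℝ := fun x => (invFT (charFun ν) x).re with hp
  have hre : ∀ x, ((p x : ℝ) : ℂ) = invFT (charFun ν) x := fun x =>
    Complex.conj_eq_iff_re.1 (conj_invFT_charFun ν x)
  have hpc : Continuous p := Complex.continuous_re.comp hc
  have hpi : Integrable p := h2.re
  have hFT : ∀ t : ℝ, ∫ x : ℝ, Complex.exp (t * x * Complex.I) * p x = charFun ν t := by
    intro t
    have hpi0 : (2 * Real.pi) ≠ 0 := by positivity
    have hF : ∀ v : ℝ, FourierTransform.fourier (charFun ν) v =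
        ((2 * Real.pi : ℝ) : ℂ) * invFT (charFun ν) (2 * Real.pi * v) := fun v => by
      rw [invFT, ← mul_assoc, ← Complex.ofReal_mul, mul_inv_cancel₀ hpi0, Complex.ofReal_one, one_mul,
        mul_div_cancel_left₀ _ hpi0]
    have hFi : Integrable (FourierTransform.fourier (charFun ν)) := by
      rw [show FourierTransform.fourier (charFun ν) = _ from funext hF]
      exact (h2.comp_mul_left' hpi0).const_mul _
    have hinv := congrFun (Continuous.fourierInv_fourier_eq (continuous_charFun (μ := ν)) h1 hFi) t
    rw [Real.fourierInv_eq_fourier_neg, Real.fourier_real_eq_integral_exp_smul] at hinv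
    rw [← hinv]
    have hsub := Measure.integral_comp_mul_left
      (fun x : ℝ => Complex.exp (t * x * Complex.I) * p x) (2 * Real.pi)
    rw [abs_of_pos (by positivity), Complex.real_smul, Complex.ofReal_inv,
      eq_inv_mul_iff_mul_eq₀ (by exact_mod_cast hpi0), ← integral_const_mul] at hsub
    rw [← hsub]
    refine integral_congr_ae (Eventually.of_forall fun v => ?_)
    simp only [hF, hre, smul_eq_mul]
    rw [mul_left_comm]
    congr 3
    push_cast
    ring
  -- The inverse transform p is real, but its sign is not yet known. The measures ν + p⁻ dx and p⁺
  -- dx have equal characteristic functions, hence coincide; so p⁻ ≤ p⁺ almost everywhere, and p⁻ =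
  -- 0 by continuity.
  set pp : ℝ → ℝ := fun x => max (p x) 0 with hpp
  set pm : ℝ → ℝ := fun x => max (-p x) 0 with hpm
  have hppc : Continuous pp := hpc.max continuous_const
  have hpmc : Continuous pm := hpc.neg.max continuous_const
  have hppi : Integrable pp := hpi.pos_part
  have hpmi : Integrable pm := hpi.neg_part
  have fin : ∀ {q : ℝ → ℝ}, Integrable q → IsFiniteMeasure (volume.withDensity fun x => ENNReal.ofReal (q x)) :=
    fun hq => isFiniteMeasure_withDensity_ofReal hq.2
  have := fin hppi
  have := fin hpmi
  have hexp : ∀ t : ℝ, ∀ {q : ℝ → ℝ}, Integrable q →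
      Integrable fun x : ℝ => Complex.exp (t * x * Complex.I) * q x := fun t q hq => by
    refine Integrable.bdd_mul (c := 1) hq.ofReal (by fun_prop) (Eventually.of_forall fun x => ?_)
    rw [← Complex.ofReal_mul, Complex.norm_exp_ofReal_mul_I]
  have heq : ν + volume.withDensity (fun x => ENNReal.ofReal (pm x)) =
      volume.withDensity fun x => ENNReal.ofReal (pp x) := by
    refine Measure.ext_of_charFun (funext fun t => ?_)
    rw [charFun_withDensity hppc.measurable fun x => le_max_right _ _, charFun_apply_real,
      integral_add_measure, ← charFun_apply_real, ← charFun_apply_real,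
      charFun_withDensity hpmc.measurable fun x => le_max_right _ _, ← hFT t,
      ← integral_add (hexp t hpi) (hexp t hpmi)]
    · congr 1
      ext x
      rw [← mul_add, ← Complex.ofReal_add]
      congr 2
      simp only [hpp, hpm]
      rcases le_total (p x) 0 with h | h
      · rw [max_eq_right h, max_eq_left (by linarith)]; ring
      · rw [max_eq_left h, max_eq_right (by linarith)]; ring
    all_goals
      refine (integrable_const (1 : ℝ)).mono' (by fun_prop) (Eventually.of_forall fun x => ?_)
      rw [← Complex.ofReal_mul, Complex.norm_exp_ofReal_mul_I]
  have hle : volume.withDensity (fun x => ENNReal.ofReal (pm x)) ≤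
      volume.withDensity fun x => ENNReal.ofReal (pp x) := by
    rw [← heq]
    exact Measure.le_add_left le_rfl
  have hae : (fun x => ENNReal.ofReal (pm x)) ≤ᵐ[volume] fun x => ENNReal.ofReal (pp x) := by
    refine ae_le_of_forall_setLIntegral_le_of_sigmaFinite (by fun_prop) fun s hs _ => ?_
    rw [← withDensity_apply _ hs, ← withDensity_apply _ hs]
    exact hle s
  have hpos : ∀ x, 0 ≤ p x := by
    have h3 : pm =ᵐ[volume] fun _ => 0 := by
      filter_upwards [hae] with x hx
      rw [ENNReal.ofReal_le_ofReal_iff (le_max_right _ _)] at hx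
      simp only [hpm] at hx ⊢
      rcases le_total (p x) 0 with h | h
      · rw [max_eq_right h] at hx
        exact le_antisymm hx (le_max_right _ _)
      · exact max_eq_right (by linarith)
    have h4 := (Continuous.ae_eq_iff_eq volume hpmc continuous_const).1 h3
    intro x
    have := congrFun h4 x
    simp only [hpm] at this
    have := le_max_left (-p x) 0
    linarith
  refine ⟨hpos, hre, ?_⟩
  have hpm0 : (fun x => ENNReal.ofReal (pm x)) = 0 := by
    ext x
    simp [hpm, hpos x]
  have hpp0 : pp = p := funext fun x => max_eq_left (hpos x)
  rw [hpm0, withDensity_zero, add_zero, hpp0] at heq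
  exact heq

end FisherCLT

namespace FisherCLT

/-! ### Approximation of the density -/

theorem norm_integral_exp_le (T : ℝ) {t : ℝ} (ht : t ≠ 0) :
    ‖∫ x in -T..T, Complex.exp (-(t * x * Complex.I))‖ ≤ 2 / |t| := by
  have hc : -(t * Complex.I) ≠ 0 := by simp [ht]
  have h := integral_exp_mul_complex (a := -T) (b := T) hc
  have h1 : (fun x : ℝ => Complex.exp (-(t * x * Complex.I))) =
      fun x : ℝ => Complex.exp (-(t * Complex.I) * x) := by
    ext x
    congr 1
    ring
  rw [h1, h, norm_div, norm_neg, norm_mul, Complex.norm_I, mul_one, Complex.norm_real,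
    Real.norm_eq_abs]
  gcongr
  have h2 : ∀ y : ℝ, ‖Complex.exp (-(t * Complex.I) * y)‖ = 1 := fun y => by
    rw [show -(t * Complex.I) * y = ((-(t * y) : ℝ) : ℂ) * Complex.I by push_cast; ring,
      Complex.norm_exp_ofReal_mul_I]
  calc _ ≤ ‖Complex.exp (-(t * Complex.I) * (T : ℝ))‖ + ‖Complex.exp (-(t * Complex.I) * ((-T : ℝ) : ℂ))‖ :=
        norm_sub_le _ _
    _ = 2 := by rw [h2, h2]; norm_num

theorem intervalIntegral_invFT {g : ℝ → ℂ} (hg : Integrable g) {T : ℝ} (hT : 0 ≤ T) :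
    ∫ x in -T..T, invFT g x = ((2 * Real.pi)⁻¹ : ℝ) *
      ∫ t : ℝ, (∫ x in -T..T, Complex.exp (-(t * x * Complex.I))) * g t := by
  simp_rw [invFT_eq_integral]
  rw [intervalIntegral.integral_const_mul]
  congr 1
  simp_rw [intervalIntegral.integral_of_le (show -T ≤ T by linarith)]
  rw [integral_integral_swap]
  · congr 1
    ext t
    rw [integral_mul_const]
  · have h1 : Integrable (fun p : ℝ × ℝ => (1 : ℂ) * g p.2)
        ((volume.restrict (Set.Ioc (-T) T)).prod volume) :=
      (integrable_const (1 : ℂ)).mul_prod hg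
    simp only [one_mul] at h1
    refine Integrable.bdd_mul (c := 1) h1 (by fun_prop) (Eventually.of_forall fun p => ?_)
    rw [show -((p.2 : ℂ) * p.1 * Complex.I) = ((-(p.2 * p.1) : ℝ) : ℂ) * Complex.I by push_cast; ring,
      Complex.norm_exp_ofReal_mul_I]

/-- The partial integrals of `invFT h` are bounded if `h` vanishes at the origin. -/
theorem exists_intervalIntegral_invFT_bound : ∃ C : ℝ, 0 ≤ C ∧ ∀ (h h' : ℝ → ℂ) (B : ℝ),
    (∀ t, HasDerivAt h (h' t) t) → (∀ t, (1 + |t|) ^ 4 * ‖h t‖ ≤ B) → (∀ t, (1 + |t|) ^ 4 * ‖h' t‖ ≤ B) →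
    h 0 = 0 → ∀ T : ℝ, 0 ≤ T → ‖∫ x in -T..T, invFT h x‖ ≤ C * B := by
  have hA : 0 ≤ ∫ t : ℝ, ((1 + |t|) ^ 2)⁻¹ := integral_nonneg fun t => by positivity
  refine ⟨(2 * Real.pi)⁻¹ * (8 * ∫ t : ℝ, ((1 + |t|) ^ 2)⁻¹), by positivity,
    fun h h' B hd hb hb' h0 T hT => ?_⟩
  have hc : Continuous h := continuous_iff_continuousAt.2 fun t => (hd t).continuousAt
  have hB : 0 ≤ B := le_trans (by positivity) (hb 0)
  have hi : Integrable h := (integrable_of_one_add_abs_sq_mul_le hc.aestronglyMeasurable fun t =>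
    le_trans (by gcongr ?_ * _; exact pow_le_pow_right₀ (by linarith [abs_nonneg t]) (by norm_num))
      (hb t)).1
  -- As h(0) = 0, this cancels the singularity 2/|t| of the kernel, uniformly in T.
  have hlin : ∀ t, ‖h t‖ ≤ B * |t| := fun t => by
    have := Convex.norm_image_sub_le_of_norm_hasDerivWithin_le (f := h) (f' := h') (C := B)
      (s := Set.univ) (x := 0) (y := t) (fun x _ => (hd x).hasDerivWithinAt) (fun x _ => by
        refine le_trans ?_ (hb' x)
        exact le_mul_of_one_le_left (norm_nonneg _) (one_le_pow₀ (by linarith [abs_nonneg x])))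
      convex_univ (Set.mem_univ _) (Set.mem_univ _)
    simpa [h0] using this
  rw [intervalIntegral_invFT hi hT, norm_mul, Complex.norm_real, Real.norm_eq_abs,
    abs_of_pos (by positivity), mul_assoc]
  gcongr
  rw [mul_assoc, ← integral_mul_const, ← integral_const_mul]
  refine norm_integral_le_of_norm_le
    ((integrable_one_add_abs_inv_sq.mul_const B).const_mul 8) (Eventually.of_forall fun t => ?_)
  rcases eq_or_ne t 0 with rfl | ht
  · simp [h0, hB]
  have htp : 0 < |t| := abs_pos.2 ht
  rw [norm_mul]
  have h1 := norm_integral_exp_le T ht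
  have h2 : ‖h t‖ ≤ 4 * |t| * (((1 + |t|) ^ 2)⁻¹ * B) := by
    rw [← mul_assoc, ← div_eq_mul_inv, div_mul_eq_mul_div, le_div_iff₀ (by positivity)]
    rcases le_total |t| 1 with ht1 | ht1
    · calc ‖h t‖ * (1 + |t|) ^ 2 ≤ B * |t| * (1 + 1) ^ 2 := by gcongr; exact hlin t
        _ = _ := by ring
    · calc ‖h t‖ * (1 + |t|) ^ 2 ≤ ‖h t‖ * (1 + |t|) ^ 4 := by
            gcongr
            · linarith
            · norm_num
        _ ≤ B := by rw [mul_comm]; exact hb t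
        _ ≤ 4 * |t| * B := le_mul_of_one_le_left hB (by linarith)
  calc _ ≤ 2 / |t| * (4 * |t| * (((1 + |t|) ^ 2)⁻¹ * B)) := by gcongr
    _ = _ := by field_simp; ring

/-- The polynomials `cumPoly` start at degree 3, so the correction factor is 1 + O(t³) and leaves
the second derivative at 0 unchanged. -/
theorem X_sq_dvd_derivative_edgePoly (γ : ℕ → ℝ) (K : ℕ) (z : ℝ) :
    (Polynomial.X : Polynomial ℂ) ^ 2 ∣ (edgePoly γ K z).derivative := by
  have h : ∀ i, (Polynomial.X : Polynomial ℂ) ^ 2 ∣ (cumPoly γ i).derivative := fun i => by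
    rw [derivative_cumPoly]
    exact Dvd.dvd.mul_left (pow_dvd_pow _ (by omega)) _
  rw [derivative_edgePoly, edgeDefect]
  refine dvd_sub (Dvd.dvd.mul_right (Finset.dvd_sum fun i _ => ?_) _) (Finset.dvd_sum fun i _ => ?_)
  · rw [Polynomial.smul_eq_C_mul]
    exact (h i).mul_left _
  · rw [Polynomial.smul_eq_C_mul]
    exact ((h i.1).mul_right _).mul_left _

theorem iteratedDeriv_two_gaussPoly_edgePoly_zero (γ : ℕ → ℝ) (K : ℕ) (z : ℝ) :
    iteratedDeriv 2 (gaussPoly (edgePoly γ K z)) 0 = -1 := by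
  obtain ⟨Q, hQ⟩ := X_sq_dvd_derivative_edgePoly γ K z
  rw [iteratedDeriv_gaussPoly]
  simp only [Function.iterate_succ, Function.iterate_zero, Function.comp_apply, id, gaussPoly,
    hQ, Polynomial.derivative_sub, Polynomial.derivative_mul, Polynomial.derivative_pow]
  simp [eval_zero_edgePoly]

/-- Both transforms have second derivative -1 at 0. This is the vanishing that
`exists_intervalIntegral_invFT_bound` requires. -/
theorem iteratedDeriv_two_cfDiff_zero {μ ν : Measure ℝ} [IsProbabilityMeasure μ]
    [IsProbabilityMeasure ν] {K n : ℕ} (hν2 : MemLp id 2 ν) (hν : ∫ x, x ^ 2 ∂ν = 1)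
    (hchar : ∀ t, charFun ν t = charFun μ ((√(n : ℝ))⁻¹ * t) ^ n) :
    iteratedDeriv 2 (cfDiff μ K n) 0 = 0 := by
  have h1 : cfDiff μ K n = charFun ν - gaussPoly (edgePoly (cumulant μ) K (√(n : ℝ))⁻¹) := by
    ext t
    simp [cfDiff, hchar]
  have h2 : MemLp id (2 : ℕ) ν := by exact_mod_cast hν2
  rw [h1, iteratedDeriv_sub (contDiff_charFun h2).contDiffAt (contDiff_gaussPoly _).contDiffAt,
    iteratedDeriv_two_gaussPoly_edgePoly_zero, iteratedDeriv_charFun_zero h2, hν]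
  simp

theorem integrable_gaussianPDFReal_mul_eval (Q : Polynomial ℝ) :
    Integrable (fun x => gaussianPDFReal 0 1 x * Q.eval x) := by
  have h := ((integrable_gaussPoly (Q.map Complex.ofRealHom)).re).const_mul (√(2 * Real.pi))⁻¹
  refine h.congr (Eventually.of_forall fun x => ?_)
  simp only [gaussPoly, gaussianPDFReal_zero_one]
  rw [show Polynomial.eval (x : ℂ) (Polynomial.map Complex.ofRealHom Q) = ((Q.eval x : ℝ) : ℂ) from
    Polynomial.eval_map_apply Complex.ofRealHom x, ← Complex.ofReal_mul]
  rw [RCLike.re_eq_complex_re, Complex.ofReal_re]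
  ring

/-- The operator `Q ↦ Q' - x Q`, which corresponds to the derivative of `φ Q`. -/
noncomputable def gaussDeriv (Q : Polynomial ℝ) : Polynomial ℝ := Q.derivative - Polynomial.X * Q

/-- The Edgeworth approximation of the densities of normalized sums and of their derivatives. -/
theorem density_approx {μ : Measure ℝ} [IsProbabilityMeasure μ] {K m : ℕ}
    (hμ : MemLp id (K + 2 : ℕ) μ) (hmean : ∫ x, x ∂μ = 0)
    (hvar : ∫ x, x ^ 2 ∂μ = 1) (hm : m ≠ 0) {C : ℝ}
    (hdecay : ∀ t, |t| * ‖charFun μ t‖ ^ m ≤ C) {ε : ℝ} (hε : 0 < ε) :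
    ∀ᶠ n : ℕ in atTop, ∀ ν : Measure ℝ, IsProbabilityMeasure ν → MemLp id 2 ν → ∫ x, x ^ 2 ∂ν = 1 →
      (∀ t, charFun ν t = charFun μ ((√(n : ℝ))⁻¹ * t) ^ n) →
      ∃ p r r₁ r₂ : ℝ → ℝ, IsACDensity ν p ∧
        (∀ x, p x = gaussianPDFReal 0 1 x * (edgeworthSum (cumulant μ) K (√(n : ℝ))⁻¹).eval x + r x) ∧
        (∀ x, HasDerivAt r (r₁ x) x) ∧ (∀ x, HasDerivAt r₁ (r₂ x) x) ∧
        (∀ x, (1 + |x|) ^ (K + 2) * |r x| ≤ ε * (√(n : ℝ))⁻¹ ^ K) ∧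
        (∀ x, (1 + |x|) ^ (K + 2) * |r₁ x| ≤ ε * (√(n : ℝ))⁻¹ ^ K) ∧
        (∀ x, (1 + |x|) ^ (K + 2) * |r₂ x| ≤ ε * (√(n : ℝ))⁻¹ ^ K) ∧
        (1 ≤ K → ∀ T, 0 ≤ T → |∫ x in -T..T, x ^ 2 * r x| ≤ ε * (√(n : ℝ))⁻¹ ^ K) := by
  obtain ⟨C₁, hC₁, hb₁⟩ := exists_invFT_deriv_bound (K + 2)
  obtain ⟨C₂, hC₂, hb₂⟩ := exists_intervalIntegral_invFT_bound
  set D := C₁ + C₂ + 1 with hD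
  have hDpos : 0 < D := by positivity
  filter_upwards [cfDiff_bound hμ hmean hvar hm hdecay (ε := ε / D) (by positivity)] with n hn ν hνp hν2 hν1 hchar
  set z := (√(n : ℝ))⁻¹ with hz
  have hz0 : 0 ≤ z := by positivity
  set B := ε / D * z ^ K with hB
  have hB0 : 0 ≤ B := by positivity
  set G := cfDiff μ K n with hG
  have hGc : ContDiff ℝ (K + 2 : ℕ) G := contDiff_cfDiff hμ n
  obtain ⟨d₁, d₂, hd₁, hd₂, hbd⟩ := hb₁ G B hGc hn
  have hC₁B : C₁ * B ≤ ε * z ^ K := by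
    rw [hB, ← mul_assoc, ← mul_div_assoc, mul_comm C₁, mul_div_assoc]
    gcongr
    exact mul_le_of_le_one_right hε.le (div_le_one_of_le₀ (by linarith) hDpos.le)
  have hC₂B : C₂ * B ≤ ε * z ^ K := by
    rw [hB, ← mul_assoc, ← mul_div_assoc, mul_comm C₂, mul_div_assoc]
    gcongr
    exact mul_le_of_le_one_right hε.le (div_le_one_of_le₀ (by linarith) hDpos.le)
  set S := edgeworthSum (cumulant μ) K z with hS
  have hsum : charFun ν = G + gaussPoly (edgePoly (cumulant μ) K z) := by
    ext t
    rw [hchar, Pi.add_apply, hG, cfDiff, ← hz, sub_add_cancel]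
  have hwle : ∀ t : ℝ, ∀ j ≤ K + 2, (1 + |t|) ^ 2 * ‖iteratedDeriv j G t‖ ≤ B := fun t j hj => by
    refine le_trans ?_ (hn t j hj)
    gcongr ?_ * _
    exact pow_le_pow_right₀ (by linarith [abs_nonneg t]) (by norm_num)
  have hGij : ∀ j ≤ K + 2, Integrable (iteratedDeriv j G) := fun j hj =>
    (integrable_of_one_add_abs_sq_mul_le
      (hGc.continuous_iteratedDeriv j (by exact_mod_cast hj)).aestronglyMeasurable
      fun t => hwle t j hj).1
  have hGi : Integrable G := by simpa using hGij 0 (by omega)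
  have hFi : Integrable (charFun ν) := by
    rw [hsum]
    exact hGi.add (integrable_gaussPoly _)
  have hinv : ∀ x, invFT (charFun ν) x = invFT G x +
      ((gaussianPDFReal 0 1 x * S.eval x : ℝ) : ℂ) := fun x => by
    rw [hsum, invFT_add hGi (integrable_gaussPoly _), invFT_gaussPoly_edgePoly]
  have hGc' : Continuous (invFT G) := continuous_iff_continuousAt.2 fun x => (hd₁ x).continuousAt
  have hφc : Continuous (fun x => gaussianPDFReal 0 1 x * S.eval x) :=
    continuous_iff_continuousAt.2 fun x => (hasDerivAt_gaussianPDFReal_mul_eval S x).continuousAt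
  have hcont : Continuous (invFT (charFun ν)) := by
    rw [show invFT (charFun ν) = _ from funext hinv]
    exact hGc'.add (Complex.continuous_ofReal.comp hφc)
  have hint : Integrable (invFT (charFun ν)) := by
    rw [show invFT (charFun ν) = _ from funext hinv]
    refine Integrable.add ?_ (integrable_gaussianPDFReal_mul_eval S).ofReal
    refine (integrable_of_one_add_abs_sq_mul_le (B := C₁ * B) hGc'.aestronglyMeasurable fun x => ?_).1
    refine le_trans ?_ (hbd x).1
    gcongr ?_ * _
    exact pow_le_pow_right₀ (by linarith [abs_nonneg x]) (by omega)
  obtain ⟨hpos, hreal, hdens⟩ := density_of_integrable_charFun hFi hint hcont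
  have hr₁ : ∀ x, HasDerivAt (fun x => (invFT G x).re) (d₁ x).re x := fun x =>
    (Complex.reCLM.hasFDerivAt.comp_hasDerivAt x (hd₁ x))
  have hr₂ : ∀ x, HasDerivAt (fun x => (d₁ x).re) (d₂ x).re x := fun x =>
    (Complex.reCLM.hasFDerivAt.comp_hasDerivAt x (hd₂ x))
  have hpeq : ∀ x, (invFT (charFun ν) x).re = gaussianPDFReal 0 1 x * S.eval x + (invFT G x).re := by
    intro x
    rw [hinv, Complex.add_re, Complex.ofReal_re, add_comm]
  have habs : ∀ {w : ℂ} {x : ℝ}, (1 + |x|) ^ (K + 2) * ‖w‖ ≤ C₁ * B →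
      (1 + |x|) ^ (K + 2) * |w.re| ≤ ε * z ^ K := fun {w x} h => by
    refine le_trans ?_ (h.trans hC₁B)
    gcongr
    exact Complex.abs_re_le_norm w
  refine ⟨fun x => (invFT (charFun ν) x).re, fun x => (invFT G x).re, fun x => (d₁ x).re,
    fun x => (d₂ x).re, ⟨hpos, fun a b => ?_, hdens⟩, hpeq, hr₁, hr₂, fun x => habs (hbd x).1,
    fun x => habs (hbd x).2.1, fun x => habs (hbd x).2.2, fun hK T hT => ?_⟩
  · refine ContDiffOn.absolutelyContinuousOnInterval (ContDiff.contDiffOn ?_)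
    rw [show (fun x => (invFT (charFun ν) x).re) = _ from funext hpeq]
    have hd : ∀ x, HasDerivAt (fun x => gaussianPDFReal 0 1 x * S.eval x + (invFT G x).re)
        (gaussianPDFReal 0 1 x * (S.derivative - Polynomial.X * S).eval x + (d₁ x).re) x := fun x =>
      (hasDerivAt_gaussianPDFReal_mul_eval S x).add (hr₁ x)
    rw [contDiff_one_iff_deriv]
    refine ⟨fun x => (hd x).differentiableAt, ?_⟩
    rw [show deriv _ = _ from funext fun x => (hd x).deriv]
    exact (continuous_iff_continuousAt.2 fun x =>
      (hasDerivAt_gaussianPDFReal_mul_eval _ x).continuousAt).add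
      (continuous_iff_continuousAt.2 fun x => (hr₂ x).continuousAt)
  -- x² r is minus the real part of the inverse transform of G''. The derivative G''' must be
  -- controlled, which is where K ≥ 1 enters.
  · have hder : ∀ t, HasDerivAt (iteratedDeriv 2 G) (iteratedDeriv 3 G t) t := fun t => by
      have h := hGc.differentiable_iteratedDeriv 2 (by exact_mod_cast (by omega : 2 < K + 2)) t
      rw [show iteratedDeriv 3 G = deriv (iteratedDeriv 2 G) from iteratedDeriv_succ]
      exact h.hasDerivAt
    have hmain := hb₂ (iteratedDeriv 2 G) (iteratedDeriv 3 G) B hder (fun t => hn t 2 (by omega))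
      (fun t => hn t 3 (by omega)) (iteratedDeriv_two_cfDiff_zero hν2 hν1 hchar) T hT
    refine le_trans ?_ (hmain.trans hC₂B)
    have hx : (fun x : ℝ => invFT (iteratedDeriv 2 G) x) = fun x : ℝ => -((x ^ 2 : ℝ) : ℂ) * invFT G x := by
      ext x
      rw [← pow_mul_invFT hGc hGij (by omega : 2 ≤ K + 2), mul_pow, Complex.I_sq]
      push_cast
      ring
    have hre : ∫ x in -T..T, x ^ 2 * (invFT G x).re = -(∫ x in -T..T, invFT (iteratedDeriv 2 G) x).re := by
      rw [hx, ← Complex.reCLM_apply, ← ContinuousLinearMap.intervalIntegral_comp_comm,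
        ← intervalIntegral.integral_neg]
      · congr 1
        ext x
        rw [Complex.reCLM_apply, ← Complex.ofReal_neg, Complex.re_ofReal_mul]
        ring
      · exact Continuous.intervalIntegrable (by fun_prop) _ _
    rw [hre, abs_neg]
    exact Complex.abs_re_le_norm _

end FisherCLT

namespace FisherCLT

/-! ### Absolutely continuous densities and Fisher information -/

section Density

variable {ν : Measure ℝ} {p : ℝ → ℝ}

theorem IsACDensity.continuous (hp : IsACDensity ν p) : Continuous p := by
  rw [continuous_iff_continuousAt]
  intro x
  refine (hp.absCont (x - 1) (x + 1)).uniformContinuousOn.continuousOn.continuousAt ?_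
  rw [Set.uIcc_of_le (by linarith)]
  exact Icc_mem_nhds (by linarith) (by linarith)

/-- A zero of a nonnegative function is a minimum; if p is not differentiable there, `deriv` is 0 by
default. -/
theorem IsACDensity.deriv_eq_zero (hp : IsACDensity ν p) {x : ℝ} (hx : p x = 0) :
    deriv p x = 0 :=
  IsLocalMin.deriv_eq_zero (Eventually.of_forall fun y => hx.trans_le (hp.nonneg y))

theorem IsACDensity.integrable_mul_iff (hp : IsACDensity ν p) (g : ℝ → ℝ) :
    Integrable g ν ↔ Integrable (fun x => p x * g x) := by
  rw [hp.eq_withDensity]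
  have := integrable_withDensity_iff_integrable_smul (μ := volume)
    (f := fun x => (p x).toNNReal) hp.continuous.measurable.real_toNNReal (g := g)
  simp only [ENNReal.ofReal]
  rw [this]
  refine integrable_congr (Eventually.of_forall fun x => ?_)
  simp only [NNReal.smul_def, smul_eq_mul]
  rw [Real.coe_toNNReal _ (hp.nonneg x)]

theorem IsACDensity.integral_eq (hp : IsACDensity ν p) (g : ℝ → ℝ) :
    ∫ x, g x ∂ν = ∫ x, p x * g x := by
  rw [hp.eq_withDensity]
  have := integral_withDensity_eq_integral_smul (μ := volume)
    (f := fun x => (p x).toNNReal) hp.continuous.measurable.real_toNNReal g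
  simp only [ENNReal.ofReal]
  rw [this]
  refine integral_congr_ae (Eventually.of_forall fun x => ?_)
  simp only [NNReal.smul_def, smul_eq_mul]
  rw [Real.coe_toNNReal _ (hp.nonneg x)]

theorem IsACDensity.integrable [IsFiniteMeasure ν] (hp : IsACDensity ν p) : Integrable p := by
  simpa using (hp.integrable_mul_iff fun _ => 1).1 (integrable_const 1)

theorem IsACDensity.integral_eq_one [IsProbabilityMeasure ν] (hp : IsACDensity ν p) :
    ∫ x, p x = 1 := by
  simpa using (hp.integral_eq fun _ => 1).symm

theorem fisherInfo_eq (hp : IsACDensity ν p) :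
    fisherInfo ν = ∫⁻ x, ENNReal.ofReal (deriv p x ^ 2 / p x) := by
  refine le_antisymm (iInf₂_le p hp) (le_iInf₂ fun q hq => ?_)
  rw [hp.unique hq]

theorem deriv_gaussianPDFReal_div (x : ℝ) :
    deriv (gaussianPDFReal 0 1) x / gaussianPDFReal 0 1 x = -x := by
  rw [(hasDerivAt_gaussianPDFReal x).deriv,
    mul_div_cancel_right₀ _ (gaussianPDFReal_pos 0 1 x one_ne_zero).ne']

/-- The score of φ is -x. At zeros of p both integrands are 0, the left by the factor p and the
right by division by zero. -/
theorem relFisherInfo_eq (hp : IsACDensity ν p) :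
    relFisherInfo ν 0 1 = ∫⁻ x, ENNReal.ofReal ((deriv p x + x * p x) ^ 2 / p x) := by
  have h : ∀ q, IsACDensity ν q → ∫⁻ x, ENNReal.ofReal
      ((deriv q x / q x - deriv (gaussianPDFReal 0 1) x / gaussianPDFReal 0 1 x) ^ 2 * q x) =
      ∫⁻ x, ENNReal.ofReal ((deriv q x + x * q x) ^ 2 / q x) := fun q hq => by
    congr 1
    ext x
    rw [deriv_gaussianPDFReal_div, sub_neg_eq_add]
    rcases eq_or_ne (q x) 0 with h0 | h0
    · simp [h0]
    · congr 1
      field_simp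
  rw [← h p hp]
  refine le_antisymm (iInf₂_le p hp) (le_iInf₂ fun q hq => ?_)
  rw [hp.unique hq]

theorem exists_of_fisherInfo_lt_top (h : fisherInfo ν < ∞) :
    ∃ p, IsACDensity ν p ∧ ∫⁻ x, ENNReal.ofReal (deriv p x ^ 2 / p x) < ∞ := by
  rw [fisherInfo, iInf_lt_iff] at h
  obtain ⟨p, hp⟩ := h
  rw [iInf_lt_iff] at hp
  obtain ⟨h1, h2⟩ := hp
  exact ⟨p, h1, h2⟩

theorem IsACDensity.integrable_sq_div (hp : IsACDensity ν p)
    (h : ∫⁻ x, ENNReal.ofReal (deriv p x ^ 2 / p x) < ∞) :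
    Integrable (fun x => deriv p x ^ 2 / p x) := by
  have hm := hp.continuous.measurable
  have hm' := measurable_deriv p
  refine ⟨((hm'.pow_const 2).div hm).aestronglyMeasurable, ?_⟩
  rwa [hasFiniteIntegral_iff_ofReal (Eventually.of_forall fun x =>
    div_nonneg (sq_nonneg _) (hp.nonneg x))]

/-- The arithmetic-geometric inequality for p'²/p and p. It makes p' integrable, and therefore p
bounded. -/
theorem IsACDensity.abs_deriv_le (hp : IsACDensity ν p) (x : ℝ) :
    |deriv p x| ≤ deriv p x ^ 2 / p x + p x := by
  rcases (hp.nonneg x).eq_or_lt with h | h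
  · rw [hp.deriv_eq_zero h.symm]
    simp [hp.nonneg x]
  · rw [← sq_abs, div_add' _ _ _ h.ne', le_div_iff₀ h]
    nlinarith [sq_nonneg (|deriv p x| - p x), abs_nonneg (deriv p x), mul_nonneg (abs_nonneg (deriv p x)) h.le]

theorem IsACDensity.integrable_deriv [IsFiniteMeasure ν] (hp : IsACDensity ν p)
    (h : ∫⁻ x, ENNReal.ofReal (deriv p x ^ 2 / p x) < ∞) : Integrable (deriv p) :=
  ((hp.integrable_sq_div h).add hp.integrable).mono' (measurable_deriv p).aestronglyMeasurable
    (Eventually.of_forall fun x => hp.abs_deriv_le x)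

theorem abs_intervalIntegral_le_integral_abs {g : ℝ → ℝ} (hg : Integrable g) (a b : ℝ) :
    |∫ x in a..b, g x| ≤ ∫ x, |g x| := by
  refine (intervalIntegral.norm_integral_le_integral_norm_uIoc (f := g) (μ := volume)).trans ?_
  exact setIntegral_le_integral hg.norm (Eventually.of_forall fun x => norm_nonneg _)

theorem IsACDensity.exists_abs_le [IsFiniteMeasure ν] (hp : IsACDensity ν p)
    (h : ∫⁻ x, ENNReal.ofReal (deriv p x ^ 2 / p x) < ∞) : ∃ M, ∀ x, |p x| ≤ M := by
  refine ⟨|p 0| + ∫ x, |deriv p x|, fun x => ?_⟩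
  have h1 := (hp.absCont 0 x).integral_deriv_eq_sub
  have h2 := abs_intervalIntegral_le_integral_abs (hp.integrable_deriv h) 0 x
  rw [h1] at h2
  have := abs_sub_abs_le_abs_sub (p x) (p 0)
  linarith

/-- For a bounded function `w` with derivative `t v`, integration by parts. -/
theorem abs_mul_integral_le (hp : ∀ a b, AbsolutelyContinuousOnInterval p a b) (hpi : Integrable p)
    (hpi' : Integrable (deriv p)) {M : ℝ} (hM : ∀ x, |p x| ≤ M) {v w : ℝ → ℝ} {t : ℝ}
    (hw : ∀ x, HasDerivAt w (t * v x) x) (hv : Continuous v) (hv1 : ∀ x, |v x| ≤ 1)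
    (hw1 : ∀ x, |w x| ≤ 1) :
    |t| * |∫ x, v x * p x| ≤ 2 * M + ∫ x, |deriv p x| := by
  have hwc : ContDiff ℝ 1 w := by
    rw [contDiff_one_iff_deriv]
    refine ⟨fun x => (hw x).differentiableAt, ?_⟩
    rw [show deriv w = _ from funext fun x => (hw x).deriv]
    exact continuous_const.mul hv
  have hb : ∀ R : ℝ, |t * ∫ x in -R..R, v x * p x| ≤ 2 * M + ∫ x, |deriv p x| := fun R => by
    have h1 := (hp (-R) R).integral_mul_deriv_eq_deriv_mul
      (ContDiffOn.absolutelyContinuousOnInterval (hwc.contDiffOn (s := Set.uIcc (-R) R)))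
    have h2 : ∫ x in -R..R, p x * deriv w x = t * ∫ x in -R..R, v x * p x := by
      rw [← intervalIntegral.integral_const_mul]
      refine intervalIntegral.integral_congr fun x _ => ?_
      simp only [(hw x).deriv]
      ring
    rw [← h2, h1]
    have hwi : Integrable (fun x => deriv p x * w x) :=
      hpi'.mul_bdd (c := 1) hwc.continuous.aestronglyMeasurable (Eventually.of_forall hw1)
    have h3 : |∫ x in -R..R, deriv p x * w x| ≤ ∫ x, |deriv p x| := by
      refine (abs_intervalIntegral_le_integral_abs hwi _ _).trans ?_
      refine integral_mono hwi.abs hpi'.abs fun x => ?_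
      simp only [abs_mul]
      exact mul_le_of_le_one_right (abs_nonneg _) (hw1 x)
    have h4 : ∀ x, |p x * w x| ≤ M := fun x => by
      rw [abs_mul]
      exact (mul_le_of_le_one_right (abs_nonneg _) (hw1 x)).trans (hM x)
    calc _ ≤ |p R * w R| + |p (-R) * w (-R)| + |∫ x in -R..R, deriv p x * w x| :=
          (abs_sub _ _).trans (by gcongr; exact abs_sub _ _)
      _ ≤ M + M + ∫ x, |deriv p x| := by gcongr <;> [exact h4 _; exact h4 _]
      _ = _ := by ring
  have hvi : Integrable (fun x => v x * p x) :=
    hpi.bdd_mul (c := 1) hv.aestronglyMeasurable (Eventually.of_forall hv1)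
  have hlim := intervalIntegral_tendsto_integral hvi tendsto_neg_atTop_atBot tendsto_id
  have := ((hlim.const_mul t).abs)
  rw [abs_mul] at this
  exact le_of_tendsto this (Eventually.of_forall fun R => hb R)

/-- The characteristic function of a law with finite Fisher information decays. -/
theorem exists_abs_mul_norm_charFun_le [IsProbabilityMeasure ν] (h : fisherInfo ν < ∞) :
    ∃ C : ℝ, ∀ t, |t| * ‖charFun ν t‖ ≤ C := by
  obtain ⟨p, hp, hI⟩ := exists_of_fisherInfo_lt_top h
  obtain ⟨M, hM⟩ := hp.exists_abs_le hI
  refine ⟨2 * (2 * M + ∫ x, |deriv p x|), fun t => ?_⟩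
  -- Real and imaginary parts are integrated by parts separately, with the primitives sin(tx) and
  -- -cos(tx) of t cos(tx) and t sin(tx).
  have hcos := abs_mul_integral_le hp.absCont hp.integrable (hp.integrable_deriv hI) hM
    (v := fun x => Real.cos (t * x)) (w := fun x => Real.sin (t * x)) (t := t) (fun x => by
      have := (Real.hasDerivAt_sin (t * x)).comp x ((hasDerivAt_id x).const_mul t)
      convert! this using 1
      simp [mul_comm]) (by fun_prop) (fun x => Real.abs_cos_le_one _) (fun x => Real.abs_sin_le_one _)
  have hsin := abs_mul_integral_le hp.absCont hp.integrable (hp.integrable_deriv hI) hM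
    (v := fun x => Real.sin (t * x)) (w := fun x => -Real.cos (t * x)) (t := t) (fun x => by
      have := ((Real.hasDerivAt_cos (t * x)).comp x ((hasDerivAt_id x).const_mul t)).neg
      convert! this using 1
      simp [mul_comm]) (by fun_prop) (fun x => Real.abs_sin_le_one _)
      (fun x => by rw [abs_neg]; exact Real.abs_cos_le_one _)
  have hint : Integrable (fun x : ℝ => Complex.exp (t * x * Complex.I) * p x) := by
    refine Integrable.bdd_mul (c := 1) hp.integrable.ofReal (by fun_prop)
      (Eventually.of_forall fun x => ?_)
    rw [← Complex.ofReal_mul, Complex.norm_exp_ofReal_mul_I]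
  have hc : charFun ν t = ∫ x : ℝ, Complex.exp (t * x * Complex.I) * p x := by
    conv_lhs => rw [hp.eq_withDensity]
    exact charFun_withDensity hp.continuous.measurable hp.nonneg t
  have hre : (charFun ν t).re = ∫ x, Real.cos (t * x) * p x := by
    rw [hc, ← RCLike.re_eq_complex_re, ← integral_re hint]
    congr 1
    ext x
    rw [← Complex.ofReal_mul, RCLike.re_eq_complex_re, Complex.re_mul_ofReal,
      Complex.exp_ofReal_mul_I_re]
  have him : (charFun ν t).im = ∫ x, Real.sin (t * x) * p x := by
    rw [hc, ← RCLike.im_eq_complex_im, ← integral_im hint]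
    congr 1
    ext x
    rw [← Complex.ofReal_mul, RCLike.im_eq_complex_im, Complex.im_mul_ofReal,
      Complex.exp_ofReal_mul_I_im]
  calc |t| * ‖charFun ν t‖ ≤ |t| * (|(charFun ν t).re| + |(charFun ν t).im|) := by
        gcongr
        exact Complex.norm_le_abs_re_add_abs_im _
    _ = |t| * |∫ x, Real.cos (t * x) * p x| + |t| * |∫ x, Real.sin (t * x) * p x| := by
        rw [hre, him, mul_add]
    _ ≤ _ := by linarith

end Density

/-! ### Laws of the normalized sums. -/

section NormSum

variable {Ω : Type*} [MeasurableSpace Ω] {P : Measure Ω} {X : ℕ → Ω → ℝ}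

theorem aemeasurable_normSum (hident : ∀ i, IdentDistrib (X i) (X 0) P P) (n : ℕ) :
    AEMeasurable (normSum X n) P := by
  have h := fun i => (hident i).aemeasurable_fst
  exact (Finset.aemeasurable_fun_sum _ fun i _ => h i).div_const _

theorem charFun_map_normSum (hindep : iIndepFun X P) (hident : ∀ i, IdentDistrib (X i) (X 0) P P)
    (n : ℕ) (t : ℝ) :
    charFun (P.map (normSum X n)) t = charFun (P.map (X 0)) ((√(n : ℝ))⁻¹ * t) ^ n := by
  have h := fun i => (hident i).aemeasurable_fst
  have h1 : normSum X n = fun ω => (√(n : ℝ))⁻¹ * ∑ i ∈ Finset.range n, X i ω := by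
    ext ω
    rw [normSum, div_eq_inv_mul]
  rw [h1, charFun_map_mul_comp (Finset.aemeasurable_fun_sum _ fun i _ => h i),
    iIndepFun.charFun_map_fun_finsetSum_eq_prod (fun i _ => h i) (hindep.restrict _)]
  simp only [Finset.prod_apply]
  rw [Finset.prod_congr rfl fun i _ => by rw [(hident i).map_eq], Finset.prod_const,
    Finset.card_range]

theorem memLp_of_integrable_abs_pow {s : ℕ} (hs : 2 ≤ s) (hm : AEMeasurable (X 0) P)
    (hmoment : Integrable (fun ω => |X 0 ω| ^ s) P) :
    MemLp (X 0) s P := by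
  rw [← integrable_norm_rpow_iff hm.aestronglyMeasurable (by simp; omega) (by simp)]
  simpa using hmoment

theorem memLp_two_normSum [IsProbabilityMeasure P] (hindep : iIndepFun X P) (hident : ∀ i, IdentDistrib (X i) (X 0) P P)
    (h2 : MemLp (X 0) 2 P) (hmean : ∫ ω, X 0 ω ∂P = 0) (hvar : variance (X 0) P = 1) {n : ℕ}
    (hn : 1 ≤ n) :
    MemLp id 2 (P.map (normSum X n)) ∧ ∫ x, x ^ 2 ∂(P.map (normSum X n)) = 1 := by
  have hL : ∀ i, MemLp (X i) 2 P := fun i => (hident i).memLp_iff.2 h2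
  have hae := aemeasurable_normSum (P := P) hident n
  have hS : MemLp (∑ i ∈ Finset.range n, X i) 2 P := memLp_finsetSum' _ fun i _ => hL i
  have hfun : normSum X n = fun ω => (√(n : ℝ))⁻¹ * (∑ i ∈ Finset.range n, X i) ω := by
    ext ω
    rw [normSum, div_eq_inv_mul, Finset.sum_apply]
  constructor
  · rw [memLp_map_measure_iff aestronglyMeasurable_id hae, Function.id_comp, hfun]
    exact hS.const_mul _
  · rw [integral_map hae (by fun_prop), hfun]
    have hn' : (0 : ℝ) < n := by exact_mod_cast hn
    have hEX : ∫ ω, (∑ i ∈ Finset.range n, X i) ω ∂P = 0 := by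
      simp only [Finset.sum_apply]
      rw [integral_finsetSum _ fun i _ => (hL i).integrable one_le_two]
      exact Finset.sum_eq_zero fun i _ => by rw [(hident i).integral_eq, hmean]
    have hV : variance (∑ i ∈ Finset.range n, X i) P = n := by
      rw [IndepFun.variance_sum (fun i _ => hL i) fun i _ j _ hij => hindep.indepFun hij]
      rw [Finset.sum_congr rfl fun i _ => (hident i).variance_eq]
      simp [hvar]
    rw [variance_of_integral_eq_zero hS.aemeasurable hEX] at hV
    simp only [mul_pow]
    rw [integral_const_mul]
    rw [hV, inv_pow, Real.sq_sqrt hn'.le, inv_mul_cancel₀ hn'.ne']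

end NormSum

end FisherCLT

namespace FisherCLT

/-! ### Relative and absolute Fisher information -/

/-- A nonnegative function whose second derivative is bounded by `M` near `x` satisfies
`p' ^ 2 ≤ 4 M p` at `x`. -/
theorem sq_deriv_le_mul_of_nonneg {p p₁ p₂ : ℝ → ℝ} (h0 : ∀ x, 0 ≤ p x)
    (h1 : ∀ x, HasDerivAt p (p₁ x) x) (h2 : ∀ x, HasDerivAt p₁ (p₂ x) x) {x ℓ M : ℝ} (hM0 : 0 ≤ M)
    (hM : ∀ y, |y - x| ≤ ℓ → |p₂ y| ≤ M) (hx : |p₁ x| ≤ M * ℓ) :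
    p₁ x ^ 2 ≤ 4 * M * p x := by
  rcases hM0.eq_or_lt with rfl | hMp
  · have : p₁ x = 0 := by simpa using hx
    simp [this]
  -- The minimizer of p(x) + p₁(x) h + M h², an upper bound for p(x + h). The hypothesis on p₁(x)
  -- keeps it in the window, and p(x + h) ≥ 0 gives the claim.
  set h := -p₁ x / (2 * M) with hh
  have hhl : |h| ≤ ℓ := by
    rw [hh, abs_div, abs_neg, abs_of_pos (by positivity : 0 < 2 * M), div_le_iff₀ (by positivity)]
    nlinarith [abs_nonneg (p₁ x), mul_nonneg hM0 (abs_nonneg (p₁ x))]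
  have hsub : ∀ y ∈ segment ℝ x (x + h), |y - x| ≤ |h| := by
    intro y hy
    rw [segment_eq_image'] at hy
    obtain ⟨θ, hθ, rfl⟩ := hy
    simp only [smul_eq_mul, add_sub_cancel_left, abs_mul, abs_of_nonneg hθ.1]
    exact mul_le_of_le_one_left (abs_nonneg _) hθ.2
  have hd : ∀ y ∈ segment ℝ x (x + h), |p₁ y - p₁ x| ≤ M * |h| := by
    intro y hy
    have := Convex.norm_image_sub_le_of_norm_hasDerivWithin_le (f := p₁) (f' := p₂) (C := M)
      (s := segment ℝ x (x + h)) (fun y _ => (h2 y).hasDerivWithinAt)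
      (fun y hy => hM y ((hsub y hy).trans hhl)) (convex_segment _ _) (left_mem_segment ℝ x (x + h)) hy
    simp only [Real.norm_eq_abs] at this
    exact this.trans (mul_le_mul_of_nonneg_left (hsub y hy) hM0)
  have hp := Convex.norm_image_sub_le_of_norm_hasDerivWithin_le (f := fun y => p y - p₁ x * y)
    (f' := fun y => p₁ y - p₁ x * 1) (C := M * |h|) (s := segment ℝ x (x + h))
    (fun y _ => ((h1 y).sub ((hasDerivAt_id y).const_mul (p₁ x))).hasDerivWithinAt)
    (fun y hy => by simpa using hd y hy) (convex_segment _ _) (left_mem_segment ℝ x (x + h))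
    (right_mem_segment ℝ x (x + h))
  have hp' := (abs_le.1 (by simpa only [Real.norm_eq_abs] using hp)).2
  rw [add_sub_cancel_left, mul_assoc, abs_mul_abs_self] at hp'
  have h3 := h0 (x + h)
  have h4 : 0 ≤ p x + p₁ x * h + M * (h * h) := by linarith
  have h5 : p₁ x * h + M * (h * h) = -(p₁ x ^ 2 / (4 * M)) := by
    rw [hh]
    field_simp
    ring
  have h6 : p₁ x ^ 2 / (4 * M) ≤ p x := by linarith
  rw [div_le_iff₀ (by positivity)] at h6
  linarith

section Identity

variable {ν : Measure ℝ} {p : ℝ → ℝ}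

theorem IsACDensity.sq_add_div_eq (hp : IsACDensity ν p) (x : ℝ) :
    (deriv p x + x * p x) ^ 2 / p x = deriv p x ^ 2 / p x + 2 * (x * deriv p x) + p x * x ^ 2 := by
  rcases eq_or_ne (p x) 0 with h | h
  · simp [h, hp.deriv_eq_zero h]
  · field_simp
    ring

theorem IsACDensity.sq_div_le (hp : IsACDensity ν p) (x : ℝ) :
    deriv p x ^ 2 / p x ≤ 2 * ((deriv p x + x * p x) ^ 2 / p x) + 2 * (p x * x ^ 2) := by
  rcases (hp.nonneg x).eq_or_lt with h | h
  · simp [← h, hp.deriv_eq_zero h.symm]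
  · rw [← mul_div_assoc, div_add' _ _ _ h.ne']
    gcongr
    nlinarith [sq_nonneg (deriv p x + 2 * (x * p x))]

theorem IsACDensity.sq_add_div_le (hp : IsACDensity ν p) (x : ℝ) :
    (deriv p x + x * p x) ^ 2 / p x ≤ 2 * (deriv p x ^ 2 / p x) + 2 * (p x * x ^ 2) := by
  rcases (hp.nonneg x).eq_or_lt with h | h
  · simp [← h, hp.deriv_eq_zero h.symm]
  · rw [← mul_div_assoc, div_add' _ _ _ h.ne']
    gcongr
    nlinarith [sq_nonneg (deriv p x - (x * p x))]

theorem IsACDensity.abs_mul_deriv_le (hp : IsACDensity ν p) (x : ℝ) :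
    |x * deriv p x| ≤ deriv p x ^ 2 / p x + p x * x ^ 2 := by
  rcases (hp.nonneg x).eq_or_lt with h | h
  · simp [← h, hp.deriv_eq_zero h.symm]
  · rw [div_add' _ _ _ h.ne', le_div_iff₀ h]
    rcases abs_cases (x * deriv p x) with ⟨h1, -⟩ | ⟨h1, -⟩ <;> rw [h1]
    · nlinarith [sq_nonneg (deriv p x - x * p x), sq_nonneg (deriv p x), sq_nonneg (x * p x)]
    · nlinarith [sq_nonneg (deriv p x + x * p x), sq_nonneg (deriv p x), sq_nonneg (x * p x)]

/-- The relation `I(X) = I(X||Z) + 1` for a law with unit second moment. -/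
theorem fisherInfo_eq_relFisherInfo_add_one [IsProbabilityMeasure ν] (hp : IsACDensity ν p)
    (hν : ∫ x, x ^ 2 ∂ν = 1) {C : ℝ} (hC : ∀ x, (1 + |x|) ^ 2 * p x ≤ C)
    (hint : Integrable fun x => (deriv p x + x * p x) ^ 2 / p x) :
    fisherInfo ν < ∞ ∧ fisherInfo ν = relFisherInfo ν 0 1 + 1 := by
  have hm := hp.continuous.measurable
  have hm' := measurable_deriv p
  have hx2 : Integrable (fun x => p x * x ^ 2) := by
    refine (hp.integrable_mul_iff _).1 ?_
    by_contra h
    rw [integral_undef h] at hν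
    exact zero_ne_one hν
  have hI : Integrable (fun x => deriv p x ^ 2 / p x) := by
    refine ((hint.const_mul 2).add (hx2.const_mul 2)).mono'
      ((hm'.pow_const 2).div hm).aestronglyMeasurable (Eventually.of_forall fun x => ?_)
    rw [Real.norm_eq_abs, abs_of_nonneg (div_nonneg (sq_nonneg _) (hp.nonneg x))]
    exact hp.sq_div_le x
  have hxp : Integrable (fun x => x * deriv p x) :=
    (hI.add hx2).mono' (measurable_id.mul hm').aestronglyMeasurable
      (Eventually.of_forall hp.abs_mul_deriv_le)
  -- The pointwise decay of p makes the boundary terms R p(R) and R p(-R) vanish in the limit.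
  have hbound : ∀ x, |x * p x| ≤ C * |x|⁻¹ := by
    intro x
    rcases eq_or_ne x 0 with rfl | hx
    · simp
    have hx' : 0 < |x| := abs_pos.2 hx
    rw [abs_mul, abs_of_nonneg (hp.nonneg x), ← div_eq_mul_inv, le_div_iff₀ hx']
    refine le_trans ?_ (hC x)
    nlinarith [hp.nonneg x, mul_nonneg (hp.nonneg x) hx'.le]
  have hinv : Tendsto (fun x : ℝ => C * |x|⁻¹) atTop (nhds 0) := by
    simpa using (tendsto_inv_atTop_zero.comp tendsto_abs_atTop_atTop).const_mul C
  have hl1 : Tendsto (fun x => x * p x) atTop (nhds 0) :=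
    squeeze_zero_norm hbound hinv
  have hl2 : Tendsto (fun x => (-x) * p (-x)) atTop (nhds 0) :=
    squeeze_zero_norm (fun x => (hbound (-x)).trans_eq (by rw [abs_neg])) hinv
  have hlim1 := intervalIntegral_tendsto_integral hxp tendsto_neg_atTop_atBot tendsto_id
  have hlim2 := intervalIntegral_tendsto_integral hp.integrable tendsto_neg_atTop_atBot tendsto_id
  have hparts : ∀ R : ℝ, ∫ x in -R..R, x * deriv p x =
      R * p R - (-R) * p (-R) - ∫ x in -R..R, p x := fun R => by
    have h1 := AbsolutelyContinuousOnInterval.integral_mul_deriv_eq_deriv_mul (a := -R) (b := R)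
      (f := fun x => x)
      (ContDiffOn.absolutelyContinuousOnInterval (contDiff_id.contDiffOn (s := Set.uIcc (-R) R)))
      (hp.absCont (-R) R)
    simpa using h1
  -- In the expanded square the cross term thus contributes -2 and the second moment +1.
  have hval : ∫ x, x * deriv p x = -1 := by
    refine tendsto_nhds_unique hlim1 ?_
    have := (hl1.sub hl2).sub hlim2
    rw [hp.integral_eq_one, sub_zero, zero_sub] at this
    exact this.congr fun R => (hparts R).symm
  have hsum : ∫ x, (deriv p x + x * p x) ^ 2 / p x = (∫ x, deriv p x ^ 2 / p x) - 1 := by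
    rw [show (fun x => (deriv p x + x * p x) ^ 2 / p x) = fun x =>
      deriv p x ^ 2 / p x + 2 * (x * deriv p x) + p x * x ^ 2 from funext hp.sq_add_div_eq,
      integral_add (f := fun x => deriv p x ^ 2 / p x + 2 * (x * deriv p x))
        (hI.add (hxp.const_mul 2)) hx2, integral_add hI (hxp.const_mul 2),
      integral_const_mul, hval, ← hp.integral_eq fun x => x ^ 2, hν]
    ring
  have e1 : fisherInfo ν = ENNReal.ofReal (∫ x, deriv p x ^ 2 / p x) := by
    rw [fisherInfo_eq hp, ofReal_integral_eq_lintegral_ofReal hI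
      (Eventually.of_forall fun x => div_nonneg (sq_nonneg _) (hp.nonneg x))]
  have e2 : relFisherInfo ν 0 1 = ENNReal.ofReal (∫ x, (deriv p x + x * p x) ^ 2 / p x) := by
    rw [relFisherInfo_eq hp, ofReal_integral_eq_lintegral_ofReal hint
      (Eventually.of_forall fun x => div_nonneg (sq_nonneg _) (hp.nonneg x))]
  refine ⟨by rw [e1]; exact ENNReal.ofReal_lt_top, ?_⟩
  rw [e1, e2, ← ENNReal.ofReal_one, ← ENNReal.ofReal_add
    (integral_nonneg fun x => div_nonneg (sq_nonneg _) (hp.nonneg x)) zero_le_one, hsum,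
    sub_add_cancel]

theorem toReal_relFisherInfo (hp : IsACDensity ν p)
    (hint : Integrable fun x => (deriv p x + x * p x) ^ 2 / p x) :
    (relFisherInfo ν 0 1).toReal = ∫ x, (deriv p x + x * p x) ^ 2 / p x := by
  have h0 : ∀ x, 0 ≤ (deriv p x + x * p x) ^ 2 / p x := fun x =>
    div_nonneg (sq_nonneg _) (hp.nonneg x)
  rw [relFisherInfo_eq hp, ← ofReal_integral_eq_lintegral_ofReal hint (Eventually.of_forall h0),
    ENNReal.toReal_ofReal (integral_nonneg h0)]

end Identity

/-! ### The standard Gaussian law. -/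

theorem isACDensity_gaussian : IsACDensity (gaussianReal 0 1) (gaussianPDFReal 0 1) := by
  refine ⟨gaussianPDFReal_nonneg 0 1, fun a b => ?_, ?_⟩
  · refine ContDiffOn.absolutelyContinuousOnInterval (ContDiff.contDiffOn ?_)
    rw [show gaussianPDFReal 0 1 = fun x => (√(2 * Real.pi))⁻¹ * Real.exp (-(x ^ 2 / 2)) from
      funext gaussianPDFReal_zero_one]
    fun_prop
  · rw [gaussianReal_of_var_ne_zero 0 one_ne_zero]
    rfl

theorem integral_sq_gaussianReal : ∫ x, x ^ 2 ∂(gaussianReal 0 1) = 1 := by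
  have h := variance_id_gaussianReal (μ := 0) (v := 1)
  rw [variance_of_integral_eq_zero aemeasurable_id (by simp)] at h
  simpa using h

theorem fisherInfo_gaussianReal : fisherInfo (gaussianReal 0 1) = 1 := by
  have hp := isACDensity_gaussian
  have h0 : ∀ x, deriv (gaussianPDFReal 0 1) x + x * gaussianPDFReal 0 1 x = 0 := fun x => by
    rw [(hasDerivAt_gaussianPDFReal x).deriv]
    ring
  obtain ⟨C, hC0, hC⟩ := exists_one_add_abs_pow_mul_exp_le 2 (c := 1 / 2) (by norm_num)
  have h := (fisherInfo_eq_relFisherInfo_add_one hp integral_sq_gaussianReal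
    (C := (√(2 * Real.pi))⁻¹ * C) (fun x => by
      rw [gaussianPDFReal_zero_one, mul_left_comm]
      gcongr
      convert! hC x using 4
      ring) (by simp [h0])).2
  rw [h, relFisherInfo_eq hp]
  simp [h0]

/-! ### Tail integrals. -/

section Tails

theorem integrable_one_add_abs_pow_mul_exp_neg (A : ℕ) :
    Integrable (fun u : ℝ => (1 + |u|) ^ A * Real.exp (-|u|)) := by
  refine (integrable_one_add_abs_inv_sq.const_mul ((A + 2).factorial * Real.exp 1)).mono'
    (by fun_prop) (Eventually.of_forall fun u => ?_)
  have h := Real.pow_div_factorial_le_exp (1 + |u|) (by positivity) (A + 2)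
  rw [div_le_iff₀ (by positivity)] at h
  rw [Real.norm_eq_abs, abs_of_nonneg (by positivity), ← div_eq_mul_inv, le_div_iff₀ (by positivity)]
  calc _ = (1 + |u|) ^ (A + 2) * Real.exp (-|u|) := by ring
    _ ≤ Real.exp (1 + |u|) * (A + 2).factorial * Real.exp (-|u|) := by gcongr
    _ = (A + 2).factorial * (Real.exp (1 + |u|) * Real.exp (-|u|)) := by ring
    _ = _ := by rw [← Real.exp_add, add_neg_cancel_right]

/-- Gaussian tails with polynomial weights. -/
theorem exists_gaussian_tail (A : ℕ) : ∃ C : ℝ, 0 ≤ C ∧ ∀ T : ℝ, 2 ≤ T →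
    IntegrableOn (fun x : ℝ => (1 + |x|) ^ A * Real.exp (-(x ^ 2 / 2) + |x| / T)) {x | T < |x|} ∧
    ∫ x in {x : ℝ | T < |x|}, (1 + |x|) ^ A * Real.exp (-(x ^ 2 / 2) + |x| / T) ≤
      C * ((1 + T) ^ A * Real.exp (-(T ^ 2 / 2))) := by
  set h : ℝ → ℝ := fun u => (1 + |u|) ^ A * Real.exp (-|u|) with hh
  have hi : Integrable h := integrable_one_add_abs_pow_mul_exp_neg A
  have h0 : ∀ u, 0 ≤ h u := fun u => by positivity
  refine ⟨Real.exp 1 * (2 * ∫ u, h u), mul_nonneg (Real.exp_pos _).le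
    (mul_nonneg zero_le_two (integral_nonneg h0)), fun T hT => ?_⟩
  set c := (1 + T) ^ A * Real.exp (-(T ^ 2 / 2)) * Real.exp 1 with hc
  have hc0 : 0 ≤ c := by positivity
  set g : ℝ → ℝ := fun x => c * (h (x - T) + h (x + T)) with hg
  have hgi : Integrable g := ((hi.comp_sub_right T).add (hi.comp_add_right T)).const_mul c
  have hg0 : ∀ x, 0 ≤ g x := fun x => mul_nonneg hc0 (add_nonneg (h0 _) (h0 _))
  have hgint : ∫ x, g x = Real.exp 1 * (2 * ∫ u, h u) * ((1 + T) ^ A * Real.exp (-(T ^ 2 / 2))) := by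
    rw [hg, integral_const_mul, integral_add (hi.comp_sub_right T) (hi.comp_add_right T),
      integral_sub_right_eq_self, integral_add_right_eq_self, hc]
    ring
  have hS : MeasurableSet {x : ℝ | T < |x|} := measurableSet_lt measurable_const measurable_norm
  have hle : ∀ x ∈ {x : ℝ | T < |x|},
      (1 + |x|) ^ A * Real.exp (-(x ^ 2 / 2) + |x| / T) ≤ g x := by
    intro x hx
    have hx' : T < |x| := hx
    set u := |x| - T with hu
    have hu0 : 0 < u := by linarith
    have h1 : (1 + |x|) ^ A ≤ (1 + T) ^ A * (1 + u) ^ A := by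
      rw [← mul_pow]
      gcongr
      nlinarith
    -- With |x| = T + u, the gain -Tu ≤ -2u dominates the loss u/T ≤ u/2, which leaves the
    -- integrable profile e^(-u).
    have h2 : -(x ^ 2 / 2) + |x| / T ≤ -(T ^ 2 / 2) + 1 + -u := by
      rw [← sq_abs, show |x| = T + u by rw [hu]; ring]
      have : (T + u) / T = 1 + u / T := by field_simp
      rw [this]
      have h3 : u / T ≤ u / 2 := by gcongr
      nlinarith
    have h3 : h u ≤ h (x - T) + h (x + T) := by
      rcases abs_cases x with ⟨hx1, _⟩ | ⟨hx1, _⟩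
      · rw [hu, hx1]
        linarith [h0 (x + T)]
      · have : h u = h (x + T) := by
          simp only [hh]
          rw [hu, hx1, ← abs_neg (x + T)]
          congr 3 <;> ring_nf
        rw [this]
        linarith [h0 (x - T)]
    calc _ ≤ ((1 + T) ^ A * (1 + u) ^ A) * Real.exp (-(T ^ 2 / 2) + 1 + -u) := by gcongr
      _ = c * h u := by
          rw [Real.exp_add, Real.exp_add, hc]
          simp only [hh, abs_of_pos hu0]
          ring
      _ ≤ g x := by simp only [hg]; gcongr
  have hint : IntegrableOn (fun x : ℝ => (1 + |x|) ^ A * Real.exp (-(x ^ 2 / 2) + |x| / T))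
      {x | T < |x|} := by
    refine (hgi.integrableOn (s := {x | T < |x|})).mono' (by fun_prop) ?_
    refine (ae_restrict_iff' hS).2 (Eventually.of_forall fun x hx => ?_)
    rw [Real.norm_eq_abs, abs_of_nonneg (by positivity)]
    exact hle x hx
  refine ⟨hint, ?_⟩
  calc _ ≤ ∫ x in {x : ℝ | T < |x|}, g x := setIntegral_mono_on hint hgi.integrableOn hS hle
    _ ≤ ∫ x, g x := setIntegral_le_integral hgi (Eventually.of_forall hg0)
    _ = _ := hgint

theorem setIntegral_one_add_abs_inv_sq_le {T : ℝ} (hT : 0 < T) :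
    ∫ x in {x : ℝ | T < |x|}, ((1 + |x|) ^ 2)⁻¹ ≤ 2 / T := by
  have hS : MeasurableSet {x : ℝ | T < |x|} := measurableSet_lt measurable_const measurable_norm
  have h1 : ∫ x in {x : ℝ | T < |x|}, ((1 + |x|) ^ 2)⁻¹ =
      2 * ∫ x in Set.Ioi T, ((1 + x) ^ 2)⁻¹ := by
    have h2 := integral_comp_abs (f := (Set.Ioi T).indicator fun x : ℝ => ((1 + x) ^ 2)⁻¹)
    rw [setIntegral_indicator measurableSet_Ioi, Set.Ioi_inter_Ioi, max_eq_right hT.le] at h2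
    rw [← h2, ← integral_indicator hS]
    rfl
  have hd : ∀ x ∈ Set.Ici T, HasDerivAt (fun x : ℝ => -(1 + x)⁻¹) ((1 + x) ^ 2)⁻¹ x := by
    intro x hx
    have hx' : T ≤ x := hx
    have := (((hasDerivAt_id x).const_add 1).inv (by simp; linarith)).neg
    convert! this using 1
    simp [neg_div]
  have hlim : Tendsto (fun x : ℝ => -(1 + x)⁻¹) atTop (nhds (-0)) :=
    (tendsto_inv_atTop_zero.comp (tendsto_atTop_add_const_left _ _ tendsto_id)).neg
  have h3 := integral_Ioi_of_hasDerivAt_of_nonneg' hd (fun x _ => by positivity) hlim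
  rw [h1, h3, neg_zero, zero_sub, neg_neg, div_eq_mul_inv]
  gcongr
  linarith

end Tails

end FisherCLT

namespace FisherCLT

/-! ### Bounds for the Edgeworth polynomials -/

theorem exists_abs_eval_le (Q : Polynomial ℝ) :
    ∃ C : ℝ, 0 ≤ C ∧ ∀ x : ℝ, |Q.eval x| ≤ C * (1 + |x|) ^ Q.natDegree := by
  obtain ⟨C, hC, h⟩ := exists_norm_eval_le (Q.map Complex.ofRealHom)
  refine ⟨C, hC, fun x => ?_⟩
  have h1 := h x
  rw [show Polynomial.eval (x : ℂ) (Polynomial.map Complex.ofRealHom Q) = ((Q.eval x : ℝ) : ℂ) from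
    Polynomial.eval_map_apply Complex.ofRealHom x, Complex.norm_real, Real.norm_eq_abs] at h1
  refine h1.trans ?_
  gcongr
  · linarith [abs_nonneg x]
  · exact Polynomial.natDegree_map_le

/-- Polynomials with bounded coefficients in a parameter are uniformly of polynomial growth. -/
theorem exists_abs_eval_sum_le (K : ℕ) (Q : ℕ → Polynomial ℝ) :
    ∃ C : ℝ, 0 ≤ C ∧ ∃ A : ℕ, ∀ z : ℝ, 0 ≤ z → z ≤ 1 → ∀ x : ℝ,
      |(∑ k ∈ Finset.range K, Polynomial.C (z ^ k) * Q k).eval x| ≤ C * (1 + |x|) ^ A := by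
  choose C hC h using fun k => exists_abs_eval_le (Q k)
  refine ⟨∑ k ∈ Finset.range K, C k, Finset.sum_nonneg fun k _ => hC k,
    (Finset.range K).sup fun k => (Q k).natDegree, fun z hz0 hz1 x => ?_⟩
  rw [Polynomial.eval_finsetSum, Finset.sum_mul]
  refine (Finset.abs_sum_le_sum_abs _ _).trans (Finset.sum_le_sum fun k hk => ?_)
  rw [Polynomial.eval_mul, Polynomial.eval_C, abs_mul, abs_of_nonneg (by positivity)]
  have h1 : z ^ k ≤ 1 := pow_le_one₀ hz0 hz1
  calc _ ≤ 1 * (C k * (1 + |x|) ^ (Q k).natDegree) := by gcongr; exact h k x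
    _ ≤ _ := by
        rw [one_mul]
        have := hC k
        gcongr
        · linarith [abs_nonneg x]
        · exact Finset.le_sup (f := fun k => (Q k).natDegree) hk

theorem edgeworthSum_eq (γ : ℕ → ℝ) (K : ℕ) (z : ℝ) :
    edgeworthSum γ K z = 1 + Polynomial.C z *
      ∑ k ∈ Finset.range K, Polynomial.C (z ^ k) * edgeworthPoly γ (k + 1) := by
  rw [edgeworthSum, Finset.sum_range_succ', edgeworthPoly_zero, Finset.mul_sum]
  rw [pow_zero, Polynomial.C_1, mul_one, add_comm]
  congr 1
  refine Finset.sum_congr rfl fun k _ => ?_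
  rw [pow_succ', Polynomial.C_mul, mul_assoc]

theorem gaussDeriv_add (P Q : Polynomial ℝ) : gaussDeriv (P + Q) = gaussDeriv P + gaussDeriv Q := by
  simp only [gaussDeriv, Polynomial.derivative_add]
  ring

theorem gaussDeriv_C_mul (c : ℝ) (Q : Polynomial ℝ) :
    gaussDeriv (Polynomial.C c * Q) = Polynomial.C c * gaussDeriv Q := by
  simp only [gaussDeriv, Polynomial.derivative_C_mul]
  ring

theorem gaussDeriv_sum {ι : Type*} (s : Finset ι) (Q : ι → Polynomial ℝ) :
    gaussDeriv (∑ i ∈ s, Q i) = ∑ i ∈ s, gaussDeriv (Q i) := by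
  simp only [gaussDeriv, Polynomial.derivative_sum, Finset.mul_sum, Finset.sum_sub_distrib]

/-- The constant term 1 contributes -x and x² - 1 to the two Gaussian derivatives; all other terms
carry a factor z, by `edgeworthSum_eq`. -/
theorem exists_edgeworthSum_bounds (γ : ℕ → ℝ) (K : ℕ) :
    ∃ C : ℝ, 1 ≤ C ∧ ∃ A : ℕ, ∀ z : ℝ, 0 ≤ z → z ≤ 1 → ∀ x : ℝ,
      |(edgeworthSum γ K z).eval x - 1| ≤ C * z * (1 + |x|) ^ A ∧
      |(edgeworthSum γ K z).derivative.eval x| ≤ C * z * (1 + |x|) ^ A ∧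
      |(gaussDeriv (edgeworthSum γ K z)).eval x| ≤ (1 + |x|) + C * z * (1 + |x|) ^ A ∧
      |(gaussDeriv (gaussDeriv (edgeworthSum γ K z))).eval x| ≤
        (1 + |x|) ^ 2 + C * z * (1 + |x|) ^ A := by
  obtain ⟨C₁, hC₁, A₁, h₁⟩ := exists_abs_eval_sum_le K fun k => edgeworthPoly γ (k + 1)
  obtain ⟨C₂, hC₂, A₂, h₂⟩ := exists_abs_eval_sum_le K fun k => (edgeworthPoly γ (k + 1)).derivative
  obtain ⟨C₃, hC₃, A₃, h₃⟩ := exists_abs_eval_sum_le K fun k => gaussDeriv (edgeworthPoly γ (k + 1))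
  obtain ⟨C₄, hC₄, A₄, h₄⟩ := exists_abs_eval_sum_le K fun k =>
    gaussDeriv (gaussDeriv (edgeworthPoly γ (k + 1)))
  refine ⟨C₁ + C₂ + C₃ + C₄ + 1, by linarith, A₁ + A₂ + A₃ + A₄, fun z hz0 hz1 x => ?_⟩
  have hx : 1 ≤ 1 + |x| := by linarith [abs_nonneg x]
  have key : ∀ {C : ℝ} {A : ℕ} {v : ℝ}, 0 ≤ C → C ≤ C₁ + C₂ + C₃ + C₄ + 1 → A ≤ A₁ + A₂ + A₃ + A₄ →
      |v| ≤ C * (1 + |x|) ^ A →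
      |z * v| ≤ (C₁ + C₂ + C₃ + C₄ + 1) * z * (1 + |x|) ^ (A₁ + A₂ + A₃ + A₄) := by
    intro C A v hC hCl hA hv
    rw [abs_mul, abs_of_nonneg hz0]
    calc z * |v| ≤ z * ((C₁ + C₂ + C₃ + C₄ + 1) * (1 + |x|) ^ (A₁ + A₂ + A₃ + A₄)) := by
          gcongr
          exact hv.trans (by gcongr)
      _ = _ := by ring
  have e1 : gaussDeriv 1 = -Polynomial.X := by simp [gaussDeriv]
  have e2 : gaussDeriv (-Polynomial.X) = Polynomial.X ^ 2 - 1 := by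
    simp only [gaussDeriv, Polynomial.derivative_neg, Polynomial.derivative_X]
    ring
  rw [edgeworthSum_eq]
  refine ⟨?_, ?_, ?_, ?_⟩
  · rw [Polynomial.eval_add, Polynomial.eval_one, add_sub_cancel_left, Polynomial.eval_mul,
      Polynomial.eval_C]
    exact key hC₁ (by linarith) (by omega) (h₁ z hz0 hz1 x)
  · rw [Polynomial.derivative_add, Polynomial.derivative_one, zero_add, Polynomial.derivative_C_mul,
      Polynomial.derivative_sum, Polynomial.eval_mul, Polynomial.eval_C]
    simp only [Polynomial.derivative_C_mul]
    exact key hC₂ (by linarith) (by omega) (h₂ z hz0 hz1 x)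
  · rw [gaussDeriv_add, gaussDeriv_C_mul, gaussDeriv_sum, e1, Polynomial.eval_add,
      Polynomial.eval_mul, Polynomial.eval_C]
    simp only [gaussDeriv_C_mul]
    refine (abs_add_le _ _).trans (add_le_add ?_ (key hC₃ (by linarith) (by omega) (h₃ z hz0 hz1 x)))
    simp
  · rw [gaussDeriv_add, gaussDeriv_C_mul, gaussDeriv_sum, e1, gaussDeriv_add, gaussDeriv_C_mul,
      gaussDeriv_sum, e2, Polynomial.eval_add, Polynomial.eval_mul, Polynomial.eval_C]
    simp only [gaussDeriv_C_mul]
    refine (abs_add_le _ _).trans (add_le_add ?_ (key hC₄ (by linarith) (by omega) (h₄ z hz0 hz1 x)))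
    simp only [Polynomial.eval_sub, Polynomial.eval_pow, Polynomial.eval_X, Polynomial.eval_one]
    rw [← sq_abs, abs_le]
    constructor <;> nlinarith [abs_nonneg x]

/-- The pointwise comparison of the integrand with its expansion. -/
theorem abs_sq_div_sub_le {φ S S' r D : ℝ} (hφ : 0 < φ) (hS : |S - 1| ≤ 1 / 4) (hr : |r| ≤ φ / 4)
    (K : ℕ) :
    |(φ * S' + D) ^ 2 / (φ * S + r) - φ * (S' ^ 2 * ∑ k ∈ Finset.range K, (1 - S) ^ k)| ≤
      4 * (S' ^ 2 * |r|) + 4 * (|S'| * |D|) + 2 * (D ^ 2 / φ) + 2 * (φ * (S' ^ 2 * |1 - S| ^ K)) := by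
  obtain ⟨hS1, hS2⟩ := abs_le.1 hS
  obtain ⟨hr1, hr2⟩ := abs_le.1 hr
  have hS0 : 0 < S := by linarith
  have hp : φ / 2 ≤ φ * S + r := by nlinarith
  have hp0 : 0 < φ * S + r := by linarith
  have hgeom : (∑ k ∈ Finset.range K, (1 - S) ^ k) = (1 - (1 - S) ^ K) / S := by
    have := mul_neg_geom_sum (1 - S) K
    rw [sub_sub_cancel] at this
    rw [eq_div_iff hS0.ne', mul_comm]
    exact this
  -- Four sources of error: r in the denominator, the cross term, the square of D, and the tail of
  -- the geometric series for 1/S.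
  have hdecomp : (φ * S' + D) ^ 2 / (φ * S + r) - φ * (S' ^ 2 * ∑ k ∈ Finset.range K, (1 - S) ^ k) =
      -(φ * (S' ^ 2 * r) / ((φ * S + r) * S)) + 2 * φ * S' * D / (φ * S + r) + D ^ 2 / (φ * S + r) +
        φ * (S' ^ 2 * (1 - S) ^ K) / S := by
    rw [hgeom]
    field_simp
    ring
  have hinv : 1 / (φ * S + r) ≤ 2 / φ := by
    rw [div_le_div_iff₀ hp0 hφ]
    linarith
  have hSinv : 1 / S ≤ 2 := by
    rw [div_le_iff₀ hS0]
    linarith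
  have t1 : |-(φ * (S' ^ 2 * r) / ((φ * S + r) * S))| ≤ 4 * (S' ^ 2 * |r|) := by
    rw [abs_neg, abs_div, abs_mul, abs_mul, abs_of_pos hφ, abs_of_nonneg (sq_nonneg S'),
      abs_of_pos (mul_pos hp0 hS0)]
    calc _ = φ * (S' ^ 2 * |r|) * (1 / (φ * S + r)) * (1 / S) := by field_simp
      _ ≤ φ * (S' ^ 2 * |r|) * (2 / φ) * 2 := by gcongr
      _ = _ := by field_simp; ring
  have t2 : |2 * φ * S' * D / (φ * S + r)| ≤ 4 * (|S'| * |D|) := by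
    rw [abs_div, abs_mul, abs_mul, abs_mul, abs_of_pos hφ, abs_of_pos hp0, abs_two]
    calc _ = 2 * φ * |S'| * |D| * (1 / (φ * S + r)) := by ring
      _ ≤ 2 * φ * |S'| * |D| * (2 / φ) := by gcongr
      _ = _ := by field_simp; ring
  have t3 : |D ^ 2 / (φ * S + r)| ≤ 2 * (D ^ 2 / φ) := by
    rw [abs_of_nonneg (by positivity)]
    calc _ = D ^ 2 * (1 / (φ * S + r)) := by ring
      _ ≤ D ^ 2 * (2 / φ) := by gcongr
      _ = _ := by ring
  have t4 : |φ * (S' ^ 2 * (1 - S) ^ K) / S| ≤ 2 * (φ * (S' ^ 2 * |1 - S| ^ K)) := by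
    rw [abs_div, abs_mul, abs_mul, abs_of_pos hφ, abs_of_nonneg (sq_nonneg S'), abs_of_pos hS0, abs_pow]
    calc _ = φ * (S' ^ 2 * |1 - S| ^ K) * (1 / S) := by ring
      _ ≤ φ * (S' ^ 2 * |1 - S| ^ K) * 2 := by gcongr
      _ = _ := by ring
  rw [hdecomp]
  refine (abs_add_le _ _).trans ?_
  refine (add_le_add ((abs_add_le _ _).trans (add_le_add (abs_add_le _ _) le_rfl)) le_rfl).trans ?_
  linarith

/-- A weight that is larger in the middle than at the ends of an interval. -/
theorem inv_pow_mul_exp_le {T x : ℝ} (hT : 0 < T) (hx : |x| ≤ T) (m : ℕ) :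
    ((1 + |x|) ^ m)⁻¹ * Real.exp (x ^ 2 / 2) ≤
      Real.exp (T ^ 2 / 8) + 2 ^ m * (T ^ m)⁻¹ * Real.exp (T ^ 2 / 2) := by
  -- For |x| ≤ T/2 the exponential is at most e^(T²/8). Beyond T/2 the weight is of order T^(-m).
  rcases le_total |x| (T / 2) with h | h
  · have h1 : ((1 + |x|) ^ m)⁻¹ ≤ 1 := inv_le_one_of_one_le₀ (one_le_pow₀ (by linarith [abs_nonneg x]))
    calc _ ≤ 1 * Real.exp (T ^ 2 / 8) := by
          refine mul_le_mul h1 (Real.exp_le_exp.2 ?_) (Real.exp_pos _).le zero_le_one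
          rw [← sq_abs]
          nlinarith [abs_nonneg x]
      _ ≤ _ := by
          rw [one_mul]
          exact le_add_of_nonneg_right (by positivity)
  · have h1 : ((1 + |x|) ^ m)⁻¹ ≤ 2 ^ m * (T ^ m)⁻¹ := by
      rw [← div_eq_mul_inv, ← div_pow, ← inv_div, inv_pow]
      gcongr
      linarith
    calc _ ≤ 2 ^ m * (T ^ m)⁻¹ * Real.exp (T ^ 2 / 2) := by
          refine mul_le_mul h1 (Real.exp_le_exp.2 ?_) (Real.exp_pos _).le (by positivity)
          rw [← sq_abs]
          gcongr
      _ ≤ _ := le_add_of_nonneg_left (by positivity)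

end FisherCLT

namespace FisherCLT

/-! ### The integrand of the relative Fisher information -/

/-- The law `ν` has a density `p = φ S + r`, where the polynomial `S` is close to `1` and the
remainder `r` is small together with its derivatives `r₁` and `r₂`. -/
structure EdgeworthApprox (ν : Measure ℝ) (K A : ℕ) (C z e : ℝ) (S : Polynomial ℝ)
    (p r r₁ r₂ : ℝ → ℝ) : Prop where
  dens : IsACDensity ν p
  eq : ∀ x, p x = gaussianPDFReal 0 1 x * S.eval x + r x
  deriv₁ : ∀ x, HasDerivAt r (r₁ x) x
  deriv₂ : ∀ x, HasDerivAt r₁ (r₂ x) x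
  bound₀ : ∀ x, (1 + |x|) ^ (K + 2) * |r x| ≤ e
  bound₁ : ∀ x, (1 + |x|) ^ (K + 2) * |r₁ x| ≤ e
  bound₂ : ∀ x, (1 + |x|) ^ (K + 2) * |r₂ x| ≤ e
  one_le : 1 ≤ C
  z_nonneg : 0 ≤ z
  z_le : z ≤ 1
  sub_one : ∀ x, |S.eval x - 1| ≤ C * z * (1 + |x|) ^ A
  derivative : ∀ x, |S.derivative.eval x| ≤ C * z * (1 + |x|) ^ A
  gaussDeriv : ∀ x, |(gaussDeriv S).eval x| ≤ (1 + |x|) + C * z * (1 + |x|) ^ A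
  gaussDeriv₂ : ∀ x, |(FisherCLT.gaussDeriv (FisherCLT.gaussDeriv S)).eval x| ≤
    (1 + |x|) ^ 2 + C * z * (1 + |x|) ^ A

theorem gaussianPDFReal_le_exp (x : ℝ) : gaussianPDFReal 0 1 x ≤ Real.exp (-(x ^ 2 / 2)) := by
  rw [gaussianPDFReal_zero_one]
  refine mul_le_of_le_one_left (Real.exp_pos _).le (inv_le_one_of_one_le₀ ?_)
  rw [Real.one_le_sqrt]
  linarith [Real.pi_gt_three]

theorem one_div_gaussianPDFReal_le (x : ℝ) :
    1 / gaussianPDFReal 0 1 x ≤ 3 * Real.exp (x ^ 2 / 2) := by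
  have h : √(2 * Real.pi) ≤ 3 := by
    rw [Real.sqrt_le_left (by norm_num)]
    linarith [Real.pi_lt_four]
  rw [gaussianPDFReal_zero_one, one_div, mul_inv, inv_inv, Real.exp_neg, inv_inv]
  gcongr

theorem abs_le_of_one_add_abs_pow_mul_le {K : ℕ} {e v x : ℝ} (hv : (1 + |x|) ^ (K + 2) * |v| ≤ e) :
    |v| ≤ e * ((1 + |x|) ^ (K + 2))⁻¹ := by
  rw [← div_eq_mul_inv, le_div_iff₀ (by positivity), mul_comm]
  exact hv

theorem integrable_one_add_abs_pow_mul_gaussian (B : ℕ) :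
    Integrable (fun x : ℝ => (1 + |x|) ^ B * gaussianPDFReal 0 1 x) := by
  obtain ⟨C, hC, h⟩ := exists_one_add_abs_pow_mul_exp_le (B + 2) (c := 1 / 2) (by norm_num)
  have hm : Measurable (gaussianPDFReal 0 1) := measurable_gaussianPDFReal 0 1
  refine (integrable_one_add_abs_inv_sq.const_mul C).mono' (by fun_prop)
    (Eventually.of_forall fun x => ?_)
  have hφ := gaussianPDFReal_nonneg 0 1 x
  rw [Real.norm_eq_abs, abs_of_nonneg (by positivity), ← div_eq_mul_inv, le_div_iff₀ (by positivity)]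
  calc _ = (1 + |x|) ^ (B + 2) * gaussianPDFReal 0 1 x := by ring
    _ ≤ (1 + |x|) ^ (B + 2) * Real.exp (-(1 / 2 * x ^ 2)) := by
        gcongr
        refine (gaussianPDFReal_le_exp x).trans_eq ?_
        congr 1
        ring
    _ ≤ C := h x

variable {ν : Measure ℝ} {K A : ℕ} {C z e : ℝ} {S : Polynomial ℝ} {p r r₁ r₂ : ℝ → ℝ}

/-- The expansion of the integrand in the relative Fisher information, divided by `φ`. -/
noncomputable def expansionPoly (K : ℕ) (S : Polynomial ℝ) : Polynomial ℝ :=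
  S.derivative ^ 2 * ∑ k ∈ Finset.range K, (1 - S) ^ k

namespace EdgeworthApprox

theorem hasDerivAt (h : EdgeworthApprox ν K A C z e S p r r₁ r₂) (x : ℝ) : HasDerivAt p
    (gaussianPDFReal 0 1 x * (FisherCLT.gaussDeriv S).eval x + r₁ x) x := by
  rw [show p = _ from funext h.eq]
  exact (hasDerivAt_gaussianPDFReal_mul_eval S x).add (h.deriv₁ x)

theorem hasDerivAt₂ (h : EdgeworthApprox ν K A C z e S p r r₁ r₂) (x : ℝ) : HasDerivAt
    (fun x => gaussianPDFReal 0 1 x * (FisherCLT.gaussDeriv S).eval x + r₁ x)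
    (gaussianPDFReal 0 1 x * (FisherCLT.gaussDeriv (FisherCLT.gaussDeriv S)).eval x + r₂ x) x :=
  (hasDerivAt_gaussianPDFReal_mul_eval _ x).add (h.deriv₂ x)

theorem e_nonneg (h : EdgeworthApprox ν K A C z e S p r r₁ r₂) :
    0 ≤ e := le_trans (by positivity) (h.bound₀ 0)

/-- In the tail φ gives no lower bound for p, so p'²/p is bounded by 4M with M a bound for |p''| on
the window |y - x| ≤ 1/T. On a window of this size φ stays below e^(-x²/2 + |x|/T), and T|p'(x)| ≤
M, as `sq_deriv_le_mul_of_nonneg` requires. -/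
theorem deriv_sq_div_le (h : EdgeworthApprox ν K A C z e S p r r₁ r₂)
    {T x : ℝ} (hT : 2 ≤ T) (hx : T < |x|) :
    deriv p x ^ 2 / p x ≤ 4 * (4 * ((1 + |x|) ^ 2 * Real.exp (-(x ^ 2 / 2) + |x| / T)) +
      C * 2 ^ A * z * ((1 + |x|) ^ (A + 1) * Real.exp (-(x ^ 2 / 2) + |x| / T)) +
      2 ^ (K + 2) * T * e * ((1 + |x|) ^ (K + 2))⁻¹) := by
  set E := Real.exp (-(x ^ 2 / 2) + |x| / T) with hE
  set M := 4 * ((1 + |x|) ^ 2 * E) + C * 2 ^ A * z * ((1 + |x|) ^ (A + 1) * E) +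
      2 ^ (K + 2) * T * e * ((1 + |x|) ^ (K + 2))⁻¹ with hM
  have hC := h.one_le
  have hz := h.z_nonneg
  have he := h.e_nonneg
  have hT0 : 0 < T := by linarith
  have hE0 : 0 < E := Real.exp_pos _
  have hM0 : 0 ≤ M := by positivity
  have hTinv : 1 / T ≤ 1 / 2 := by gcongr
  have hsecond : ∀ y, |y - x| ≤ 1 / T →
      |gaussianPDFReal 0 1 y * (FisherCLT.gaussDeriv (FisherCLT.gaussDeriv S)).eval y + r₂ y| ≤ M := by
    intro y hy
    have hyx : |y| ≤ |x| + 1 / T := by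
      have := abs_sub_abs_le_abs_sub y x
      linarith
    have hyx' : |x| - 1 / T ≤ |y| := by
      have := abs_sub_abs_le_abs_sub x y
      rw [abs_sub_comm] at this
      linarith
    have hφ0 := gaussianPDFReal_nonneg 0 1 y
    have hφ : gaussianPDFReal 0 1 y ≤ E := by
      refine (gaussianPDFReal_le_exp y).trans (Real.exp_le_exp.2 ?_)
      have h1 : (|x| - 1 / T) ^ 2 ≤ |y| ^ 2 := by
        gcongr
        linarith
      have h2 : (|x| - 1 / T) ^ 2 = |x| ^ 2 - 2 * (|x| / T) + (1 / T) ^ 2 := by ring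
      rw [← sq_abs x, ← sq_abs y]
      nlinarith [sq_nonneg (1 / T)]
    have hy2 : 1 + |y| ≤ 2 * (1 + |x|) := by linarith
    have hy3 : (1 + |x|) / 2 ≤ 1 + |y| := by linarith
    have h1 : (1 + |y|) ^ A ≤ 2 ^ A * (1 + |x|) ^ (A + 1) := by
      calc _ ≤ (2 * (1 + |x|)) ^ A := by gcongr
        _ = 2 ^ A * (1 + |x|) ^ A := mul_pow _ _ _
        _ ≤ _ := by
          gcongr
          · linarith [abs_nonneg x]
          · omega
    have h2 : ((1 + |y|) ^ (K + 2))⁻¹ ≤ 2 ^ (K + 2) * ((1 + |x|) ^ (K + 2))⁻¹ := by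
      calc _ ≤ (((1 + |x|) / 2) ^ (K + 2))⁻¹ := by gcongr
        _ = _ := by rw [div_pow, inv_div, div_eq_mul_inv]
    calc _ ≤ |gaussianPDFReal 0 1 y * (FisherCLT.gaussDeriv (FisherCLT.gaussDeriv S)).eval y| + |r₂ y| :=
          abs_add_le _ _
      _ ≤ E * ((2 * (1 + |x|)) ^ 2 + C * z * (2 ^ A * (1 + |x|) ^ (A + 1))) +
          e * (2 ^ (K + 2) * ((1 + |x|) ^ (K + 2))⁻¹) := by
          refine add_le_add ?_ ((abs_le_of_one_add_abs_pow_mul_le (h.bound₂ y)).trans (by gcongr))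
          rw [abs_mul, abs_of_nonneg hφ0]
          refine mul_le_mul hφ ((h.gaussDeriv₂ y).trans ?_) (abs_nonneg _) hE0.le
          gcongr
      _ ≤ E * ((2 * (1 + |x|)) ^ 2 + C * z * (2 ^ A * (1 + |x|) ^ (A + 1))) +
          T * (e * (2 ^ (K + 2) * ((1 + |x|) ^ (K + 2))⁻¹)) := by
          exact add_le_add le_rfl (le_mul_of_one_le_left (by positivity) (by linarith))
      _ = M := by rw [hM]; ring
  have hfirst : |gaussianPDFReal 0 1 x * (FisherCLT.gaussDeriv S).eval x + r₁ x| ≤ M * (1 / T) := by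
    have hφ0 := gaussianPDFReal_nonneg 0 1 x
    have hφ : gaussianPDFReal 0 1 x ≤ E := by
      refine (gaussianPDFReal_le_exp x).trans (Real.exp_le_exp.2 ?_)
      have : 0 ≤ |x| / T := by positivity
      linarith
    rw [mul_one_div, le_div_iff₀ hT0]
    have hTx : T ≤ 1 + |x| := by linarith
    have h2A : (1 : ℝ) ≤ 2 ^ A := one_le_pow₀ (by norm_num)
    have h2K : (1 : ℝ) ≤ 2 ^ (K + 2) := one_le_pow₀ (by norm_num)
    have hX : 0 < 1 + |x| := by positivity
    calc _ ≤ (|gaussianPDFReal 0 1 x * (FisherCLT.gaussDeriv S).eval x| + |r₁ x|) * T := by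
          gcongr
          exact abs_add_le _ _
      _ ≤ (E * ((1 + |x|) + C * z * (1 + |x|) ^ A) + e * ((1 + |x|) ^ (K + 2))⁻¹) * T := by
          gcongr
          · rw [abs_mul, abs_of_nonneg hφ0]
            exact mul_le_mul hφ (h.gaussDeriv x) (abs_nonneg _) hE0.le
          · exact abs_le_of_one_add_abs_pow_mul_le (h.bound₁ x)
      _ = E * ((1 + |x|) + C * z * (1 + |x|) ^ A) * T + 1 * (T * e * ((1 + |x|) ^ (K + 2))⁻¹) := by ring
      _ ≤ E * ((1 + |x|) + C * z * (1 + |x|) ^ A) * (1 + |x|) +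
          2 ^ (K + 2) * (T * e * ((1 + |x|) ^ (K + 2))⁻¹) := by gcongr
      _ = 1 * ((1 + |x|) ^ 2 * E) + 1 * (C * z * ((1 + |x|) ^ (A + 1) * E)) +
          2 ^ (K + 2) * (T * e * ((1 + |x|) ^ (K + 2))⁻¹) := by ring
      _ ≤ 4 * ((1 + |x|) ^ 2 * E) + 2 ^ A * (C * z * ((1 + |x|) ^ (A + 1) * E)) +
          2 ^ (K + 2) * (T * e * ((1 + |x|) ^ (K + 2))⁻¹) := by
          gcongr
          norm_num
      _ = M := by rw [hM]; ring
  have hL := sq_deriv_le_mul_of_nonneg h.dens.nonneg h.hasDerivAt h.hasDerivAt₂ hM0 hsecond hfirst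
  rw [(h.hasDerivAt x).deriv]
  rcases (h.dens.nonneg x).eq_or_lt with h0 | h0
  · rw [← h0, div_zero]
    positivity
  · rw [div_le_iff₀ h0]
    exact hL

/-- S'² supplies z²; one factor z suffices where this bound is used, in the Gaussian tails. -/
theorem abs_expansionPoly_le (h : EdgeworthApprox ν K A C z e S p r r₁ r₂) (x : ℝ) :
    |(expansionPoly K S).eval x| ≤ K * C ^ (K + 2) * z * (1 + |x|) ^ (A * (K + 2) + 1) := by
  have hC := h.one_le
  have hz := h.z_nonneg
  have hz1 := h.z_le
  have hX : 1 ≤ 1 + |x| := by linarith [abs_nonneg x]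
  rw [expansionPoly, Polynomial.eval_mul, Polynomial.eval_finsetSum, Polynomial.eval_pow, abs_mul,
    abs_pow]
  have h1 : ∀ k ∈ Finset.range K, |((1 - S) ^ k).eval x| ≤ C ^ K * (1 + |x|) ^ (A * K) := by
    intro k hk
    have hk' := (Finset.mem_range.1 hk).le
    rw [Polynomial.eval_pow, abs_pow, Polynomial.eval_sub, Polynomial.eval_one, abs_sub_comm]
    calc _ ≤ (C * z * (1 + |x|) ^ A) ^ k := by gcongr; exact h.sub_one x
      _ ≤ (C * 1 * (1 + |x|) ^ A) ^ k := by gcongr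
      _ = C ^ k * (1 + |x|) ^ (A * k) := by rw [mul_one, mul_pow, ← pow_mul]
      _ ≤ _ := by gcongr
  calc _ ≤ (C * z * (1 + |x|) ^ A) ^ 2 * ∑ k ∈ Finset.range K, (C ^ K * (1 + |x|) ^ (A * K)) := by
        gcongr
        · exact h.derivative x
        · exact (Finset.abs_sum_le_sum_abs _ _).trans (Finset.sum_le_sum h1)
    _ = K * C ^ (K + 2) * (z * z) * (1 + |x|) ^ (A * (K + 2)) := by
        rw [Finset.sum_const, Finset.card_range, nsmul_eq_mul]
        ring
    _ ≤ K * C ^ (K + 2) * (z * 1) * (1 + |x|) ^ (A * (K + 2) + 1) := by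
        gcongr
        omega
    _ = _ := by ring

/-- In p' + xp the Gaussian part collapses to φS', leaving D = r' + xr, whose factor x costs one
power of the weight. The critical error is D²/φ, of size e² e^(x²/2) (1+|x|)^(-2(K+1)). -/
theorem sub_expansion_inner (h : EdgeworthApprox ν K A C z e S p r r₁ r₂)
    {T x : ℝ} (hT : 0 < T) (hx : |x| ≤ T)
    (hS : |S.eval x - 1| ≤ 1 / 4) (hr : |r x| ≤ gaussianPDFReal 0 1 x / 4) :
    |(deriv p x + x * p x) ^ 2 / p x - gaussianPDFReal 0 1 x * (expansionPoly K S).eval x| ≤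
      (8 * C ^ 2 * (z * e * (1 + T) ^ (2 * A)) + 6 * (e ^ 2 * (Real.exp (T ^ 2 / 8) +
        2 ^ (2 * (K + 1)) * (T ^ (2 * (K + 1)))⁻¹ * Real.exp (T ^ 2 / 2)))) +
      2 * C ^ (K + 2) * z ^ (K + 2) *
        ((1 + |x|) ^ (A * (K + 2)) * gaussianPDFReal 0 1 x) := by
  have hC := h.one_le
  have hz := h.z_nonneg
  have hz1 := h.z_le
  have he := h.e_nonneg
  have hφ := gaussianPDFReal_pos 0 1 x one_ne_zero
  have hX : 1 ≤ 1 + |x| := by linarith [abs_nonneg x]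
  set D := r₁ x + x * r x with hD
  have hnum : deriv p x + x * p x = gaussianPDFReal 0 1 x * S.derivative.eval x + D := by
    rw [(h.hasDerivAt x).deriv, h.eq x, hD, FisherCLT.gaussDeriv]
    simp only [Polynomial.eval_sub, Polynomial.eval_mul, Polynomial.eval_X]
    ring
  have hpoly : (expansionPoly K S).eval x =
      S.derivative.eval x ^ 2 * ∑ k ∈ Finset.range K, (1 - S.eval x) ^ k := by
    simp [expansionPoly, Polynomial.eval_finsetSum]
  rw [hnum, h.eq x, hpoly]
  refine (abs_sq_div_sub_le hφ hS hr K).trans ?_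
  have hr0 : |r x| ≤ e := by
    refine le_trans ?_ (h.bound₀ x)
    exact le_mul_of_one_le_left (abs_nonneg _) (one_le_pow₀ hX)
  have hD1 : |D| ≤ e * ((1 + |x|) ^ (K + 1))⁻¹ := by
    rw [← div_eq_mul_inv, le_div_iff₀ (by positivity)]
    have h0 := h.bound₀ x
    have h1 := h.bound₁ x
    have h3 : |D| ≤ |r₁ x| + |x| * |r x| := by
      rw [hD, ← abs_mul]
      exact abs_add_le _ _
    have h4 : (1 + |x|) * (|D| * (1 + |x|) ^ (K + 1)) ≤ (1 + |x|) * e := by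
      calc (1 + |x|) * (|D| * (1 + |x|) ^ (K + 1)) = (1 + |x|) ^ (K + 2) * |D| := by ring
        _ ≤ (1 + |x|) ^ (K + 2) * (|r₁ x| + |x| * |r x|) := by gcongr
        _ = (1 + |x|) ^ (K + 2) * |r₁ x| + |x| * ((1 + |x|) ^ (K + 2) * |r x|) := by ring
        _ ≤ e + |x| * e := by gcongr
        _ = _ := by ring
    exact le_of_mul_le_mul_left h4 (by linarith)
  have hDe : |D| ≤ e := hD1.trans (mul_le_of_le_one_right he
    (inv_le_one_of_one_le₀ (one_le_pow₀ hX)))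
  have hS1 : |S.derivative.eval x| ≤ C * z * (1 + T) ^ A :=
    (h.derivative x).trans (by gcongr)
  have t1 : 4 * (S.derivative.eval x ^ 2 * |r x|) ≤ 4 * C ^ 2 * (z * e * (1 + T) ^ (2 * A)) := by
    rw [← sq_abs]
    calc _ ≤ 4 * ((C * z * (1 + T) ^ A) ^ 2 * e) := by gcongr
      _ = 4 * C ^ 2 * (z * z * e * (1 + T) ^ (2 * A)) := by ring
      _ ≤ 4 * C ^ 2 * (z * 1 * e * (1 + T) ^ (2 * A)) := by gcongr
      _ = _ := by ring
  have t2 : 4 * (|S.derivative.eval x| * |D|) ≤ 4 * C ^ 2 * (z * e * (1 + T) ^ (2 * A)) := by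
    calc _ ≤ 4 * ((C * z * (1 + T) ^ A) * e) := by gcongr
      _ = 4 * (C ^ 1 * (z * e * (1 + T) ^ (1 * A))) := by ring
      _ ≤ 4 * (C ^ 2 * (z * e * (1 + T) ^ (2 * A))) := by
          gcongr
          · norm_num
          · linarith
          · norm_num
      _ = _ := by ring
  have t3 : 2 * (D ^ 2 / gaussianPDFReal 0 1 x) ≤ 6 * (e ^ 2 * (Real.exp (T ^ 2 / 8) +
        2 ^ (2 * (K + 1)) * (T ^ (2 * (K + 1)))⁻¹ * Real.exp (T ^ 2 / 2))) := by
    rw [← sq_abs D, div_eq_mul_one_div]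
    calc _ ≤ 2 * ((e * ((1 + |x|) ^ (K + 1))⁻¹) ^ 2 * (3 * Real.exp (x ^ 2 / 2))) := by
          gcongr
          exact one_div_gaussianPDFReal_le x
      _ = 6 * (e ^ 2 * (((1 + |x|) ^ (2 * (K + 1)))⁻¹ * Real.exp (x ^ 2 / 2))) := by
          rw [mul_pow, inv_pow, ← pow_mul, mul_comm (K + 1) 2]
          ring
      _ ≤ _ := by
          gcongr
          exact inv_pow_mul_exp_le hT hx _
  have t4 : 2 * (gaussianPDFReal 0 1 x * (S.derivative.eval x ^ 2 * |1 - S.eval x| ^ K)) ≤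
      2 * C ^ (K + 2) * z ^ (K + 2) * ((1 + |x|) ^ (A * (K + 2)) * gaussianPDFReal 0 1 x) := by
    rw [← sq_abs, abs_sub_comm]
    calc _ ≤ 2 * (gaussianPDFReal 0 1 x * ((C * z * (1 + |x|) ^ A) ^ 2 * (C * z * (1 + |x|) ^ A) ^ K)) := by
          gcongr
          · exact h.derivative x
          · exact h.sub_one x
      _ = _ := by ring
  linarith

end EdgeworthApprox

end FisherCLT

namespace FisherCLT

/-! ### Splitting the relative Fisher information -/

/-- The error in the expansion of the relative Fisher information, for a splitting of the line
at the level `T`. -/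
noncomputable def splitError (K B : ℕ) (z e T τ : ℝ) : ℝ :=
  z * e * (1 + T) ^ B +
    e ^ 2 * T * (Real.exp (T ^ 2 / 8) + (T ^ (2 * (K + 1)))⁻¹ * Real.exp (T ^ 2 / 2)) +
    z ^ (K + 2) + (1 + T) ^ 2 * Real.exp (-(T ^ 2 / 2)) + z * (1 + T) ^ B * Real.exp (-(T ^ 2 / 2)) +
    T * e * ((1 + T) ^ K)⁻¹ + τ

/-- On [-T,T] the pointwise expansion is integrated. Outside, the integrand is at most 2p'²/p + 2x²p
and the expansion polynomial has Gaussian tails; both are estimated separately, since nothing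
cancels there. The constant is uniform in ν, z, e and T. -/
theorem exists_relative_expansion_bound (K A : ℕ) (C : ℝ) : ∃ C₀ : ℝ, 0 ≤ C₀ ∧
    ∀ (ν : Measure ℝ) (z e : ℝ) (S : Polynomial ℝ) (p r r₁ r₂ : ℝ → ℝ),
    EdgeworthApprox ν K A C z e S p r r₁ r₂ → ∀ T τ : ℝ, 2 ≤ T →
    (∀ x, |x| ≤ T → |S.eval x - 1| ≤ 1 / 4) → (∀ x, |x| ≤ T → |r x| ≤ gaussianPDFReal 0 1 x / 4) →
    Integrable (fun x => p x * x ^ 2) → ∫ x in {x : ℝ | T < |x|}, p x * x ^ 2 ≤ τ →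
    Integrable (fun x => (deriv p x + x * p x) ^ 2 / p x) ∧
    |(∫ x, (deriv p x + x * p x) ^ 2 / p x) -
      ∫ x, gaussianPDFReal 0 1 x * (expansionPoly K S).eval x| ≤
      C₀ * splitError K (A * (K + 2) + 1) z e T τ := by
  set B := A * (K + 2) + 1 with hB
  have hAB : A + 1 ≤ B := by rw [hB]; nlinarith
  have hAB2 : 2 * A + 1 ≤ B := by rw [hB]; nlinarith
  have hAB3 : A * (K + 2) ≤ B := by omega
  obtain ⟨G₂, hG₂, ht₂⟩ := exists_gaussian_tail 2
  obtain ⟨G₃, hG₃, ht₃⟩ := exists_gaussian_tail B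
  set J := ∫ x : ℝ, (1 + |x|) ^ (A * (K + 2)) * gaussianPDFReal 0 1 x with hJ
  have hJi := integrable_one_add_abs_pow_mul_gaussian (A * (K + 2))
  have hJ0 : 0 ≤ J := integral_nonneg fun x =>
    mul_nonneg (by positivity) (gaussianPDFReal_nonneg 0 1 x)
  set J₂ := ∫ x : ℝ, ((1 + |x|) ^ 2)⁻¹ with hJ₂
  have hJ₂0 : 0 ≤ J₂ := integral_nonneg fun x => by positivity
  set c := 8 * (|C| * 2 ^ A) + K * |C| ^ (K + 2) with hc
  have hc0 : 0 ≤ c := by positivity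
  refine ⟨16 * C ^ 2 + 12 * 2 ^ (2 * (K + 1)) + 2 * |C| ^ (K + 2) * J + 32 * G₂ + c * G₃ +
    8 * 2 ^ (K + 2) * J₂ + 2, by positivity, fun ν z e S p r r₁ r₂ h T τ hT hS hr hx2 hτ => ?_⟩
  have hC := h.one_le
  have hCabs : |C| = C := abs_of_pos (by linarith)
  rw [hCabs] at hc ⊢
  have hz := h.z_nonneg
  have he := h.e_nonneg
  have hT0 : 0 < T := by linarith
  set Φ : ℝ → ℝ := fun x => (deriv p x + x * p x) ^ 2 / p x with hΦ
  set Ψ : ℝ → ℝ := fun x => gaussianPDFReal 0 1 x * (expansionPoly K S).eval x with hΨ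
  have hΨi : Integrable Ψ := integrable_gaussianPDFReal_mul_eval _
  have hΦm : Measurable Φ := by
    have h1 := measurable_deriv p
    have h2 := h.dens.continuous.measurable
    exact ((h1.add (measurable_id.mul h2)).pow_const 2).div h2
  have hdm : AEStronglyMeasurable (fun x => Φ x - Ψ x) :=
    hΦm.aestronglyMeasurable.sub hΨi.aestronglyMeasurable
  set U : Set ℝ := {x : ℝ | T < |x|} with hU
  have hUm : MeasurableSet U := measurableSet_lt measurable_const measurable_norm
  have hUc : Uᶜ = Set.Icc (-T) T := by
    ext x
    simp [hU, abs_le]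
  -- the inner part
  set k₁ := 8 * C ^ 2 * (z * e * (1 + T) ^ (2 * A)) + 6 * (e ^ 2 * (Real.exp (T ^ 2 / 8) +
        2 ^ (2 * (K + 1)) * (T ^ (2 * (K + 1)))⁻¹ * Real.exp (T ^ 2 / 2))) with hk₁
  have hk₁0 : 0 ≤ k₁ := by positivity
  have hin : ∀ x ∈ Uᶜ, ‖Φ x - Ψ x‖ ≤ k₁ + 2 * C ^ (K + 2) * z ^ (K + 2) *
        ((1 + |x|) ^ (A * (K + 2)) * gaussianPDFReal 0 1 x) := by
    intro x hx
    have hx' : |x| ≤ T := not_lt.1 hx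
    exact h.sub_expansion_inner hT0 hx' (hS x hx') (hr x hx')
  have hini : IntegrableOn (fun x => k₁ + 2 * C ^ (K + 2) * z ^ (K + 2) *
        ((1 + |x|) ^ (A * (K + 2)) * gaussianPDFReal 0 1 x)) Uᶜ := by
    refine Integrable.add ?_ (hJi.const_mul _).integrableOn
    rw [hUc]
    exact integrableOn_const (by simp)
  have hin1 : IntegrableOn (fun x => Φ x - Ψ x) Uᶜ :=
    hini.mono' hdm.restrict ((ae_restrict_iff' hUm.compl).2 (Eventually.of_forall hin))
  have hin2 : ‖∫ x in Uᶜ, (Φ x - Ψ x)‖ ≤ 2 * T * k₁ + 2 * C ^ (K + 2) * z ^ (K + 2) * J := by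
    refine (norm_integral_le_of_norm_le hini
      ((ae_restrict_iff' hUm.compl).2 (Eventually.of_forall hin))).trans ?_
    rw [integral_add (by rw [hUc]; exact integrableOn_const (by simp)) (hJi.const_mul _).integrableOn]
    refine add_le_add ?_ ?_
    · rw [hUc, setIntegral_const, Real.volume_real_Icc_of_le (by linarith), smul_eq_mul]
      exact (by ring_nf; exact le_rfl)
    · rw [integral_const_mul]
      gcongr
      exact setIntegral_le_integral hJi (Eventually.of_forall fun x =>
        mul_nonneg (by positivity) (gaussianPDFReal_nonneg 0 1 x))
  -- the outer part
  set g : ℝ → ℝ := fun x => 32 * ((1 + |x|) ^ 2 * Real.exp (-(x ^ 2 / 2) + |x| / T)) +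
    c * z * ((1 + |x|) ^ B * Real.exp (-(x ^ 2 / 2) + |x| / T)) +
    8 * 2 ^ (K + 2) * (T * e * ((1 + T) ^ K)⁻¹) * ((1 + |x|) ^ 2)⁻¹ + 2 * (p x * x ^ 2) with hg
  have hout : ∀ x ∈ U, ‖Φ x - Ψ x‖ ≤ g x := by
    intro x hx
    have hx' : T < |x| := hx
    set E := Real.exp (-(x ^ 2 / 2) + |x| / T) with hE
    have hE0 : 0 < E := Real.exp_pos _
    have hφ : gaussianPDFReal 0 1 x ≤ E := by
      refine (gaussianPDFReal_le_exp x).trans (Real.exp_le_exp.2 ?_)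
      have : 0 ≤ |x| / T := by positivity
      linarith
    have hφ0 := gaussianPDFReal_nonneg 0 1 x
    have hX : 1 ≤ 1 + |x| := by linarith [abs_nonneg x]
    have h1 := h.dens.sq_add_div_le x
    have h2 := h.deriv_sq_div_le hT hx'
    have h3 := h.abs_expansionPoly_le x
    have h4 : |Ψ x| ≤ K * C ^ (K + 2) * z * ((1 + |x|) ^ B * E) := by
      simp only [hΨ]
      rw [abs_mul, abs_of_nonneg hφ0]
      calc _ ≤ E * (K * C ^ (K + 2) * z * (1 + |x|) ^ B) := by gcongr
        _ = _ := by ring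
    have h5 : 0 ≤ Φ x := div_nonneg (sq_nonneg _) (h.dens.nonneg x)
    have h6 : (1 + |x|) ^ (A + 1) * E ≤ (1 + |x|) ^ B * E := by gcongr
    -- Two powers are kept for integrability; the other K give the decay in T.
    have h7 : ((1 + |x|) ^ (K + 2))⁻¹ ≤ ((1 + T) ^ K)⁻¹ * ((1 + |x|) ^ 2)⁻¹ := by
      rw [← mul_inv, pow_add]
      gcongr
    have h8 : C * 2 ^ A * z * ((1 + |x|) ^ (A + 1) * E) ≤ C * 2 ^ A * z * ((1 + |x|) ^ B * E) := by
      gcongr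
    have h9 : 2 ^ (K + 2) * T * e * ((1 + |x|) ^ (K + 2))⁻¹ ≤
        2 ^ (K + 2) * T * e * (((1 + T) ^ K)⁻¹ * ((1 + |x|) ^ 2)⁻¹) := by
      gcongr
    have h10 : ‖Φ x - Ψ x‖ ≤ Φ x + |Ψ x| := by
      rw [Real.norm_eq_abs]
      exact (abs_sub _ _).trans (by rw [abs_of_nonneg h5])
    simp only [hg, hc]
    simp only [hΦ] at h10 ⊢
    linarith
  have hxU : IntegrableOn (fun x => p x * x ^ 2) U := hx2.integrableOn
  obtain ⟨i₂, b₂⟩ := ht₂ T hT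
  obtain ⟨i₃, b₃⟩ := ht₃ T hT
  have i₄ : IntegrableOn (fun x : ℝ => ((1 + |x|) ^ 2)⁻¹) U := integrable_one_add_abs_inv_sq.integrableOn
  have b₄ : ∫ x in U, ((1 + |x|) ^ 2)⁻¹ ≤ J₂ :=
    setIntegral_le_integral integrable_one_add_abs_inv_sq (Eventually.of_forall fun x => by positivity)
  have ia := (i₂.const_mul 32).add (i₃.const_mul (c * z))
  have ib := ia.add (i₄.const_mul (8 * 2 ^ (K + 2) * (T * e * ((1 + T) ^ K)⁻¹)))
  have hgi : IntegrableOn g U := ib.add (hxU.const_mul 2)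
  have hout1 : IntegrableOn (fun x => Φ x - Ψ x) U :=
    hgi.mono' hdm.restrict ((ae_restrict_iff' hUm).2 (Eventually.of_forall hout))
  have hout2 : ‖∫ x in U, (Φ x - Ψ x)‖ ≤ 32 * (G₂ * ((1 + T) ^ 2 * Real.exp (-(T ^ 2 / 2)))) +
      c * z * (G₃ * ((1 + T) ^ B * Real.exp (-(T ^ 2 / 2)))) +
      8 * 2 ^ (K + 2) * (T * e * ((1 + T) ^ K)⁻¹) * J₂ + 2 * τ := by
    refine (norm_integral_le_of_norm_le hgi
      ((ae_restrict_iff' hUm).2 (Eventually.of_forall hout))).trans ?_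
    have : ∫ x in U, g x = 32 * (∫ x in U, (1 + |x|) ^ 2 * Real.exp (-(x ^ 2 / 2) + |x| / T)) +
        c * z * (∫ x in U, (1 + |x|) ^ B * Real.exp (-(x ^ 2 / 2) + |x| / T)) +
        8 * 2 ^ (K + 2) * (T * e * ((1 + T) ^ K)⁻¹) * (∫ x in U, ((1 + |x|) ^ 2)⁻¹) +
        2 * ∫ x in U, p x * x ^ 2 := by
      have s₁ := integral_add' (i₂.const_mul 32) (i₃.const_mul (c * z))
      have s₂ := integral_add' ia (i₄.const_mul (8 * 2 ^ (K + 2) * (T * e * ((1 + T) ^ K)⁻¹)))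
      have s₃ := integral_add' ib (hxU.const_mul 2)
      rw [s₂, s₁, integral_const_mul, integral_const_mul, integral_const_mul,
        integral_const_mul] at s₃
      exact s₃
    rw [this]
    gcongr
  have hdi : Integrable (fun x => Φ x - Ψ x) := by
    rw [← integrableOn_univ, ← Set.union_compl_self U]
    exact hout1.union hin1
  have hΦi : Integrable Φ := by
    have := hdi.add hΨi
    refine this.congr (Eventually.of_forall fun x => ?_)
    simp
  refine ⟨hΦi, ?_⟩
  rw [← integral_sub hΦi hΨi, ← integral_add_compl hUm hdi]
  refine (abs_add_le _ _).trans ((add_le_add hout2 hin2).trans ?_)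
  have hτ0 : 0 ≤ τ := le_trans (setIntegral_nonneg hUm fun x _ =>
    mul_nonneg (h.dens.nonneg x) (sq_nonneg x)) hτ
  -- comparison of the constants
  set X₁ := z * e * (1 + T) ^ B with hX₁
  set X₂ := e ^ 2 * T * (Real.exp (T ^ 2 / 8) + (T ^ (2 * (K + 1)))⁻¹ * Real.exp (T ^ 2 / 2)) with hX₂
  set X₃ := z ^ (K + 2) with hX₃
  set X₄ := (1 + T) ^ 2 * Real.exp (-(T ^ 2 / 2)) with hX₄
  set X₅ := z * (1 + T) ^ B * Real.exp (-(T ^ 2 / 2)) with hX₅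
  set X₆ := T * e * ((1 + T) ^ K)⁻¹ with hX₆
  have hX₁0 : 0 ≤ X₁ := by positivity
  have hX₂0 : 0 ≤ X₂ := by positivity
  have hX₃0 : 0 ≤ X₃ := by positivity
  have hX₄0 : 0 ≤ X₄ := by positivity
  have hX₅0 : 0 ≤ X₅ := by positivity
  have hX₆0 : 0 ≤ X₆ := by positivity
  -- The factor T comes from the length of the inner interval; B was chosen with 2A + 1 ≤ B to
  -- absorb it.
  have hpow : T * (1 + T) ^ (2 * A) ≤ (1 + T) ^ B := by
    calc _ ≤ (1 + T) * (1 + T) ^ (2 * A) := by gcongr; linarith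
      _ = (1 + T) ^ (2 * A + 1) := by ring
      _ ≤ _ := pow_le_pow_right₀ (by linarith) hAB2
  have q₁ : 2 * T * (8 * C ^ 2 * (z * e * (1 + T) ^ (2 * A))) ≤ 16 * C ^ 2 * X₁ := by
    calc _ = 16 * C ^ 2 * (z * e * (T * (1 + T) ^ (2 * A))) := by ring
      _ ≤ _ := by rw [hX₁]; gcongr
  have h2p : (1 : ℝ) ≤ 2 ^ (2 * (K + 1)) := one_le_pow₀ (by norm_num)
  have q₂ : 2 * T * (6 * (e ^ 2 * (Real.exp (T ^ 2 / 8) +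
        2 ^ (2 * (K + 1)) * (T ^ (2 * (K + 1)))⁻¹ * Real.exp (T ^ 2 / 2)))) ≤
        12 * 2 ^ (2 * (K + 1)) * X₂ := by
    calc _ = 12 * (e ^ 2 * T * (1 * Real.exp (T ^ 2 / 8) +
        2 ^ (2 * (K + 1)) * ((T ^ (2 * (K + 1)))⁻¹ * Real.exp (T ^ 2 / 2)))) := by ring
      _ ≤ 12 * (e ^ 2 * T * (2 ^ (2 * (K + 1)) * Real.exp (T ^ 2 / 8) +
        2 ^ (2 * (K + 1)) * ((T ^ (2 * (K + 1)))⁻¹ * Real.exp (T ^ 2 / 2)))) := by gcongr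
      _ = _ := by rw [hX₂]; ring
  have q₃ : 2 * C ^ (K + 2) * z ^ (K + 2) * J = 2 * C ^ (K + 2) * J * X₃ := by rw [hX₃]; ring
  have q₅ : c * z * (G₃ * ((1 + T) ^ B * Real.exp (-(T ^ 2 / 2)))) = c * G₃ * X₅ := by
    rw [hX₅]; ring
  have hsum : 2 * T * k₁ = 2 * T * (8 * C ^ 2 * (z * e * (1 + T) ^ (2 * A))) +
      2 * T * (6 * (e ^ 2 * (Real.exp (T ^ 2 / 8) +
        2 ^ (2 * (K + 1)) * (T ^ (2 * (K + 1)))⁻¹ * Real.exp (T ^ 2 / 2)))) := by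
    rw [hk₁, mul_add]
  have a₁ : 0 ≤ 16 * C ^ 2 := by positivity
  have a₂ : (0 : ℝ) ≤ 12 * 2 ^ (2 * (K + 1)) := by positivity
  have a₃ : 0 ≤ 2 * C ^ (K + 2) * J := by positivity
  have a₄ : 0 ≤ 32 * G₂ := by positivity
  have a₅ : 0 ≤ c * G₃ := by positivity
  have a₆ : 0 ≤ 8 * 2 ^ (K + 2) * J₂ := by positivity
  set D := 16 * C ^ 2 + 12 * 2 ^ (2 * (K + 1)) + 2 * C ^ (K + 2) * J + 32 * G₂ + c * G₃ +
    8 * 2 ^ (K + 2) * J₂ + 2 with hD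
  have m : ∀ {a X : ℝ}, 0 ≤ X → a ≤ D → a * X ≤ D * X := fun hX ha =>
    mul_le_mul_of_nonneg_right ha hX
  have m₁ := m (a := 16 * C ^ 2) hX₁0 (by linarith)
  have m₂ := m (a := 12 * 2 ^ (2 * (K + 1))) hX₂0 (by linarith)
  have m₃ := m (a := 2 * C ^ (K + 2) * J) hX₃0 (by linarith)
  have m₄ := m (a := 32 * G₂) hX₄0 (by linarith)
  have m₅ := m (a := c * G₃) hX₅0 (by linarith)
  have m₆ := m (a := 8 * 2 ^ (K + 2) * J₂) hX₆0 (by linarith)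
  have m₇ := m (a := 2) hτ0 (by linarith)
  rw [splitError, ← hX₁, ← hX₂, ← hX₃, ← hX₄, ← hX₅, ← hX₆, hsum, q₃, q₅]
  have hexp : D * (X₁ + X₂ + X₃ + X₄ + X₅ + X₆ + τ) =
      D * X₁ + D * X₂ + D * X₃ + D * X₄ + D * X₅ + D * X₆ + D * τ := by ring
  rw [hexp]
  linarith

end FisherCLT

namespace FisherCLT

/-! ### Tails of the second moment -/

theorem gaussianPDFReal_neg (x : ℝ) : gaussianPDFReal 0 1 (-x) = gaussianPDFReal 0 1 x := by
  simp [gaussianPDFReal_zero_one]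

theorem integral_gaussian_mul_eval_eq_zero {Q : Polynomial ℝ} (hQ : ∀ x, Q.eval (-x) = -Q.eval x) :
    ∫ x, gaussianPDFReal 0 1 x * Q.eval x = 0 := by
  have h := integral_neg_eq_self (fun x => gaussianPDFReal 0 1 x * Q.eval x) volume
  simp only [gaussianPDFReal_neg, hQ, mul_neg, integral_neg] at h
  linarith

theorem hermite_comp_neg_X (m : ℕ) :
    (Polynomial.hermite m).comp (-Polynomial.X) = (-1) ^ m * Polynomial.hermite m := by
  induction m with
  | zero => simp
  | succ m ih =>
    have hd := congrArg Polynomial.derivative ih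
    rw [Polynomial.derivative_comp, Polynomial.derivative_neg, Polynomial.derivative_X] at hd
    have hc : ((-1 : Polynomial ℤ) ^ m * Polynomial.hermite m).derivative =
        (-1) ^ m * (Polynomial.hermite m).derivative := by
      rw [show ((-1 : Polynomial ℤ)) ^ m = Polynomial.C ((-1) ^ m) by simp,
        Polynomial.derivative_C_mul]
    rw [hc] at hd
    rw [Polynomial.hermite_succ, Polynomial.sub_comp, Polynomial.mul_comp, Polynomial.X_comp, ih]
    have hd' : (Polynomial.hermite m).derivative.comp (-Polynomial.X) =
        -((-1) ^ m * (Polynomial.hermite m).derivative) := by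
      rw [← hd]
      ring
    rw [hd']
    ring

theorem eval_neg_hermite (m : ℕ) (x : ℝ) :
    ((Polynomial.hermite m).map (algebraMap ℤ ℝ)).eval (-x) =
      (-1) ^ m * ((Polynomial.hermite m).map (algebraMap ℤ ℝ)).eval x := by
  have h := congrArg (fun Q => (Q.map (algebraMap ℤ ℝ)).eval x) (hermite_comp_neg_X m)
  simpa [Polynomial.map_comp] using h

/-- All Hermite degrees k + 2l in q_k have the parity of k. This is why odd powers of z disappear
from the expansion. -/
theorem eval_neg_edgeworthPoly (γ : ℕ → ℝ) (k : ℕ) (x : ℝ) :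
    (edgeworthPoly γ k).eval (-x) = (-1) ^ k * (edgeworthPoly γ k).eval x := by
  rw [edgeworthPoly, Polynomial.eval_finsetSum, Polynomial.eval_finsetSum, Finset.mul_sum]
  simp only [Polynomial.eval_mul, Polynomial.eval_C, eval_neg_hermite]
  refine Finset.sum_congr rfl fun r _ => ?_
  rw [pow_add, pow_mul, neg_one_sq, one_pow]
  ring

/-- Only K ≤ 1 needs the second moment of the approximation: q_0 = φ has second moment 1, and q_1 is
odd. -/
theorem integral_sq_mul_edgeworthSum (γ : ℕ → ℝ) {K : ℕ} (hK : K ≤ 1) (z : ℝ) :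
    ∫ x, gaussianPDFReal 0 1 x * (edgeworthSum γ K z).eval x * x ^ 2 = 1 := by
  have h1 : ∫ x, gaussianPDFReal 0 1 x * x ^ 2 = 1 := by
    rw [← isACDensity_gaussian.integral_eq fun x => x ^ 2]
    exact integral_sq_gaussianReal
  have h1i : Integrable fun x => gaussianPDFReal 0 1 x * x ^ 2 := by
    refine (integrable_gaussianPDFReal_mul_eval (Polynomial.X ^ 2)).congr
      (Eventually.of_forall fun x => ?_)
    simp
  interval_cases K
  · simpa [edgeworthSum, edgeworthPoly_zero] using h1
  · have h2 : ∫ x, gaussianPDFReal 0 1 x * (edgeworthPoly γ 1 * Polynomial.X ^ 2).eval x = 0 := by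
      refine integral_gaussian_mul_eval_eq_zero fun x => ?_
      simp [eval_neg_edgeworthPoly]
    have h3 : (fun x => gaussianPDFReal 0 1 x * (edgeworthSum γ 1 z).eval x * x ^ 2) = fun x =>
        gaussianPDFReal 0 1 x * x ^ 2 +
          z * (gaussianPDFReal 0 1 x * (edgeworthPoly γ 1 * Polynomial.X ^ 2).eval x) := by
      ext x
      simp [edgeworthSum, edgeworthPoly_zero, Finset.sum_range_succ]
      ring
    rw [h3, integral_add h1i ((integrable_gaussianPDFReal_mul_eval _).const_mul z),
      integral_const_mul, h2, h1]
    simp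

/-- Tails of the second moment. -/
theorem exists_second_moment_tail (K A : ℕ) (C : ℝ) : ∃ D : ℝ, 0 ≤ D ∧
    ∀ (ν : Measure ℝ) (z e : ℝ) (S : Polynomial ℝ) (p r r₁ r₂ : ℝ → ℝ),
    EdgeworthApprox ν K A C z e S p r r₁ r₂ → ∀ T : ℝ, 2 ≤ T → Integrable (fun x => p x * x ^ 2) →
    (2 ≤ K → ∫ x in {x : ℝ | T < |x|}, p x * x ^ 2 ≤
      D * ((1 + T) ^ 2 * Real.exp (-(T ^ 2 / 2)) + z * (1 + T) ^ (A + 2) * Real.exp (-(T ^ 2 / 2))) +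
        2 / T * (e * ((1 + T) ^ (K - 2))⁻¹)) ∧
    (∀ τ, ∫ x, p x * x ^ 2 = 1 → ∫ x, gaussianPDFReal 0 1 x * S.eval x * x ^ 2 = 1 →
      |∫ x in -T..T, x ^ 2 * r x| ≤ τ → ∫ x in {x : ℝ | T < |x|}, p x * x ^ 2 ≤
      D * ((1 + T) ^ 2 * Real.exp (-(T ^ 2 / 2)) + z * (1 + T) ^ (A + 2) * Real.exp (-(T ^ 2 / 2))) +
        τ) := by
  obtain ⟨G₂, hG₂, ht₂⟩ := exists_gaussian_tail 2
  obtain ⟨G₃, hG₃, ht₃⟩ := exists_gaussian_tail (A + 2)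
  refine ⟨G₂ + |C| * G₃, by positivity, fun ν z e S p r r₁ r₂ h T hT hx2 => ?_⟩
  have hC := h.one_le
  rw [abs_of_pos (by linarith : 0 < C)]
  have hz := h.z_nonneg
  have he := h.e_nonneg
  have hT0 : 0 < T := by linarith
  obtain ⟨i₂, b₂⟩ := ht₂ T hT
  obtain ⟨i₃, b₃⟩ := ht₃ T hT
  set U : Set ℝ := {x : ℝ | T < |x|} with hU
  have hUm : MeasurableSet U := measurableSet_lt measurable_const measurable_norm
  have hUc : Uᶜ = Set.Icc (-T) T := by
    ext x
    simp [hU, abs_le]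
  have hφS : Integrable (fun x => gaussianPDFReal 0 1 x * S.eval x * x ^ 2) := by
    have := integrable_gaussianPDFReal_mul_eval (S * Polynomial.X ^ 2)
    refine this.congr (Eventually.of_forall fun x => ?_)
    simp
    ring
  have hri : Integrable (fun x => r x * x ^ 2) := by
    refine (hx2.sub hφS).congr (Eventually.of_forall fun x => ?_)
    simp only [Pi.sub_apply, h.eq x]
    ring
  have hgauss : ∫ x in U, gaussianPDFReal 0 1 x * S.eval x * x ^ 2 ≤ (G₂ + C * G₃) *
      ((1 + T) ^ 2 * Real.exp (-(T ^ 2 / 2)) + z * (1 + T) ^ (A + 2) * Real.exp (-(T ^ 2 / 2))) := by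
    have hle : ∀ x ∈ U, gaussianPDFReal 0 1 x * S.eval x * x ^ 2 ≤
        (1 + |x|) ^ 2 * Real.exp (-(x ^ 2 / 2) + |x| / T) +
          C * z * ((1 + |x|) ^ (A + 2) * Real.exp (-(x ^ 2 / 2) + |x| / T)) := by
      intro x _
      set E := Real.exp (-(x ^ 2 / 2) + |x| / T) with hE
      have hE0 : 0 < E := Real.exp_pos _
      have hφ : gaussianPDFReal 0 1 x ≤ E := by
        refine (gaussianPDFReal_le_exp x).trans (Real.exp_le_exp.2 ?_)
        have : 0 ≤ |x| / T := by positivity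
        linarith
      have hφ0 := gaussianPDFReal_nonneg 0 1 x
      have hSx : S.eval x ≤ 1 + C * z * (1 + |x|) ^ A := by
        have := (abs_le.1 (h.sub_one x)).2
        linarith
      have hx : x ^ 2 ≤ (1 + |x|) ^ 2 := by
        rw [← sq_abs]
        gcongr
        linarith
      calc _ ≤ gaussianPDFReal 0 1 x * (1 + C * z * (1 + |x|) ^ A) * x ^ 2 := by gcongr
        _ ≤ E * (1 + C * z * (1 + |x|) ^ A) * (1 + |x|) ^ 2 := by gcongr
        _ = _ := by ring
    refine (setIntegral_mono_on hφS.integrableOn (i₂.add (i₃.const_mul (C * z))) hUm hle).trans ?_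
    rw [integral_add' i₂ (i₃.const_mul (C * z)), integral_const_mul]
    have hq : 0 ≤ (1 + T) ^ 2 * Real.exp (-(T ^ 2 / 2)) := by positivity
    have hq' : 0 ≤ z * (1 + T) ^ (A + 2) * Real.exp (-(T ^ 2 / 2)) := by positivity
    calc _ ≤ G₂ * ((1 + T) ^ 2 * Real.exp (-(T ^ 2 / 2))) +
          C * z * (G₃ * ((1 + T) ^ (A + 2) * Real.exp (-(T ^ 2 / 2)))) := by gcongr
      _ = G₂ * ((1 + T) ^ 2 * Real.exp (-(T ^ 2 / 2))) +
          C * G₃ * (z * (1 + T) ^ (A + 2) * Real.exp (-(T ^ 2 / 2))) := by ring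
      _ ≤ _ := by
          have h1 : 0 ≤ C * G₃ * ((1 + T) ^ 2 * Real.exp (-(T ^ 2 / 2))) := by positivity
          have h2 : 0 ≤ G₂ * (z * (1 + T) ^ (A + 2) * Real.exp (-(T ^ 2 / 2))) := by positivity
          linarith
  have hsplit : ∫ x in U, p x * x ^ 2 =
      (∫ x in U, gaussianPDFReal 0 1 x * S.eval x * x ^ 2) + ∫ x in U, r x * x ^ 2 := by
    rw [← integral_add hφS.integrableOn hri.integrableOn]
    refine integral_congr_ae (Eventually.of_forall fun x => ?_)
    simp only [h.eq x]
    ring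
  -- For K ≥ 2 the weight of r makes x² r absolutely integrable with decay in T. The second clause
  -- serves K ≤ 1: since p and φS have the same second moment, the tail of x² r is minus its
  -- integral over [-T,T].
  refine ⟨fun hK => ?_, fun τ hp1 hS1 hτ => ?_⟩
  · rw [hsplit]
    refine add_le_add hgauss ?_
    have hle : ∀ x ∈ U, r x * x ^ 2 ≤ e * ((1 + T) ^ (K - 2))⁻¹ * ((1 + |x|) ^ 2)⁻¹ := by
      intro x hx
      have hx' : T < |x| := hx
      have hb := h.bound₀ x
      obtain ⟨j, rfl⟩ := Nat.exists_eq_add_of_le hK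
      rw [Nat.add_sub_cancel_left, ← div_eq_mul_inv, ← div_eq_mul_inv, div_div,
        le_div_iff₀ (by positivity)]
      have hxx : x ^ 2 ≤ (1 + |x|) ^ 2 := by
        rw [← sq_abs]
        gcongr
        linarith
      calc r x * x ^ 2 * ((1 + T) ^ j * (1 + |x|) ^ 2) ≤
            |r x| * (1 + |x|) ^ 2 * ((1 + |x|) ^ j * (1 + |x|) ^ 2) := by
            refine mul_le_mul (mul_le_mul (le_abs_self _) hxx (sq_nonneg x) (abs_nonneg _)) ?_
              (by positivity) (by positivity)
            gcongr
        _ = (1 + |x|) ^ (2 + j + 2) * |r x| := by ring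
        _ ≤ e := hb
    refine (setIntegral_mono_on hri.integrableOn
      (integrable_one_add_abs_inv_sq.integrableOn.const_mul _) hUm hle).trans ?_
    rw [integral_const_mul, mul_comm]
    gcongr
    exact setIntegral_one_add_abs_inv_sq_le hT0
  · have h1 := integral_add_compl hUm hx2
    have h2 := integral_add_compl hUm hφS
    have h3 : ∫ x in Uᶜ, p x * x ^ 2 =
        (∫ x in Uᶜ, gaussianPDFReal 0 1 x * S.eval x * x ^ 2) + ∫ x in Uᶜ, r x * x ^ 2 := by
      rw [← integral_add hφS.integrableOn hri.integrableOn]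
      refine integral_congr_ae (Eventually.of_forall fun x => ?_)
      simp only [h.eq x]
      ring
    have h4 : ∫ x in Uᶜ, r x * x ^ 2 = ∫ x in -T..T, x ^ 2 * r x := by
      rw [hUc, integral_Icc_eq_integral_Ioc, ← intervalIntegral.integral_of_le (by linarith)]
      simp only [mul_comm]
    have h5 := (abs_le.1 hτ).1
    linarith

end FisherCLT

namespace FisherCLT

/-! ### The choice of the splitting level -/

/-- With K = k + 1 and l = √(log n), the quantity R = z^(k+1) l^(-k) is the target rate. Apart from
τ, each of the seven error terms is at most εR. -/
theorem splitError_le {k B : ℕ} {ε z l T τ : ℝ} (hε0 : 0 < ε) (hε1 : ε ≤ 1) (hz0 : 0 < z)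
    (hz1 : z ≤ 1) (hl : 1 ≤ l) (hlT : l ≤ T)
    (hexp : Real.exp (-(T ^ 2 / 2)) = z ^ (k + 1) * (l ^ (k + 3))⁻¹)
    (s₁ : z * (1 + T) ^ B * l ^ k ≤ ε) (s₂ : z ^ (k + 1) * l ^ k * T * Real.exp (T ^ 2 / 8) ≤ 1)
    (s₃ : z * l ^ k ≤ ε) (s₄ : (1 + T) ^ 2 * (l ^ 3)⁻¹ ≤ ε) :
    splitError (k + 1) B z (ε * z ^ (k + 1)) T τ ≤ 7 * ε * (z ^ (k + 1) * (l ^ k)⁻¹) + τ := by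
  have hl0 : 0 < l := by linarith
  have hT0 : 0 < T := by linarith
  set R := z ^ (k + 1) * (l ^ k)⁻¹ with hR
  have hR0 : 0 < R := by positivity
  have hRl : z ^ (k + 1) = R * l ^ k := by rw [hR]; field_simp
  have hexp' : Real.exp (T ^ 2 / 2) = (z ^ (k + 1))⁻¹ * l ^ (k + 3) := by
    rw [← inv_inj, ← Real.exp_neg, hexp, mul_inv, inv_inv]
  have hεε : ε * ε ≤ ε := mul_le_of_le_one_left hε0.le hε1
  have x₁ : z * (ε * z ^ (k + 1)) * (1 + T) ^ B ≤ ε * R := by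
    calc _ = ε * R * (z * (1 + T) ^ B * l ^ k) := by rw [hRl]; ring
      _ ≤ ε * R * 1 := by gcongr; exact s₁.trans hε1
      _ = _ := mul_one _
  have x₂ : (ε * z ^ (k + 1)) ^ 2 * T * Real.exp (T ^ 2 / 8) ≤ ε * R := by
    calc _ = ε * ε * R * (z ^ (k + 1) * l ^ k * T * Real.exp (T ^ 2 / 8)) := by
          rw [hR]; field_simp
      _ ≤ ε * R * 1 := by gcongr
      _ = _ := mul_one _
  -- The critical term: e^(T²/2) = z^(-(k+1)) l^(k+3) uses up one of the two factors z^(k+1), and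
  -- T^(-(2k+3)) ≤ l^(-(2k+3)) pays for l^(k+3), leaving l^(-k).
  have x₂' : (ε * z ^ (k + 1)) ^ 2 * T * ((T ^ (2 * (k + 1 + 1)))⁻¹ * Real.exp (T ^ 2 / 2)) ≤ ε * R := by
    have h1 : T * (T ^ (2 * (k + 1 + 1)))⁻¹ * l ^ (k + 3) ≤ (l ^ k)⁻¹ := by
      rw [← one_div (l ^ k), le_div_iff₀ (by positivity)]
      calc _ = T * l ^ (2 * k + 3) * (T ^ (2 * (k + 1 + 1)))⁻¹ := by ring
        _ ≤ T * T ^ (2 * k + 3) * (T ^ (2 * (k + 1 + 1)))⁻¹ := by gcongr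
        _ = T ^ (2 * (k + 1 + 1)) * (T ^ (2 * (k + 1 + 1)))⁻¹ := by ring
        _ = 1 := mul_inv_cancel₀ (by positivity)
    calc _ = ε * ε * z ^ (k + 1) * (T * (T ^ (2 * (k + 1 + 1)))⁻¹ * l ^ (k + 3)) := by
          rw [hexp']; field_simp
      _ ≤ ε * z ^ (k + 1) * (l ^ k)⁻¹ := by gcongr
      _ = _ := by rw [hR]; ring
  have x₃ : z ^ (k + 1 + 2) ≤ ε * R := by
    calc _ = R * (z * (z * l ^ k)) := by rw [pow_add, hRl]; ring
      _ ≤ R * (1 * ε) := by gcongr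
      _ = _ := by ring
  have x₄ : (1 + T) ^ 2 * Real.exp (-(T ^ 2 / 2)) ≤ ε * R := by
    calc _ = R * ((1 + T) ^ 2 * (l ^ 3)⁻¹) := by rw [hexp, hR, pow_add l]; field_simp
      _ ≤ R * ε := by gcongr
      _ = _ := by ring
  have x₅ : z * (1 + T) ^ B * Real.exp (-(T ^ 2 / 2)) ≤ ε * R := by
    have h1 : (l ^ 3)⁻¹ ≤ l ^ k :=
      (inv_le_one_of_one_le₀ (one_le_pow₀ hl)).trans (one_le_pow₀ hl)
    calc _ = R * (z * (1 + T) ^ B * (l ^ 3)⁻¹) := by rw [hexp, hR, pow_add l]; field_simp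
      _ ≤ R * (z * (1 + T) ^ B * l ^ k) := by gcongr
      _ ≤ R * ε := by gcongr
      _ = _ := by ring
  have x₆ : T * (ε * z ^ (k + 1)) * ((1 + T) ^ (k + 1))⁻¹ ≤ ε * R := by
    have h1 : T * ((1 + T) ^ (k + 1))⁻¹ ≤ (l ^ k)⁻¹ := by
      calc _ ≤ T * (T ^ (k + 1))⁻¹ := by gcongr; linarith
        _ = (T ^ k)⁻¹ := by rw [pow_succ]; field_simp
        _ ≤ _ := by gcongr
    calc _ = ε * z ^ (k + 1) * (T * ((1 + T) ^ (k + 1))⁻¹) := by ring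
      _ ≤ ε * z ^ (k + 1) * (l ^ k)⁻¹ := by gcongr
      _ = _ := by rw [hR]; ring
  rw [splitError, mul_add ((ε * z ^ (k + 1)) ^ 2 * T)]
  linarith

theorem tendsto_inv_sqrt_mul_sqrt_log_pow (m : ℕ) :
    Tendsto (fun n : ℕ => (√(n : ℝ))⁻¹ * √(Real.log n) ^ m) atTop (nhds 0) := by
  have h1 : Tendsto (fun x : ℝ => Real.log x ^ m / x) atTop (nhds 0) :=
    (Real.isLittleO_pow_log_id_atTop (n := m)).tendsto_div_nhds_zero
  have h2 := (Real.continuous_sqrt.tendsto 0).comp (h1.comp tendsto_natCast_atTop_atTop)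
  rw [Real.sqrt_zero] at h2
  refine h2.congr fun n => ?_
  simp only [Function.comp]
  rcases Nat.eq_zero_or_pos n with rfl | hn
  · simp
  have hlog : 0 ≤ Real.log n := Real.log_natCast_nonneg n
  rw [Real.sqrt_div (by positivity), div_eq_inv_mul]
  congr 1
  rw [Real.sqrt_eq_iff_mul_self_eq (by positivity) (by positivity), ← mul_pow,
    Real.mul_self_sqrt hlog]

theorem tendsto_sqrt_log : Tendsto (fun n : ℕ => √(Real.log n)) atTop atTop :=
  Real.tendsto_sqrt_atTop.comp (Real.tendsto_log_atTop.comp tendsto_natCast_atTop_atTop)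

/-- The choice of the splitting level. -/
theorem exists_splitting_level (k B : ℕ) {ε : ℝ} (hε : 0 < ε) :
    ∀ᶠ n : ℕ in atTop, ∃ T : ℝ, 2 ≤ T ∧ 1 ≤ √(Real.log n) ∧ √(Real.log n) ≤ T ∧
      0 < (√(n : ℝ))⁻¹ ∧ (√(n : ℝ))⁻¹ ≤ 1 ∧
      Real.exp (-(T ^ 2 / 2)) = (√(n : ℝ))⁻¹ ^ (k + 1) * (√(Real.log n) ^ (k + 3))⁻¹ ∧
      (√(n : ℝ))⁻¹ * (1 + T) ^ B * √(Real.log n) ^ k ≤ ε ∧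
      (√(n : ℝ))⁻¹ ^ (k + 1) * √(Real.log n) ^ k * T * Real.exp (T ^ 2 / 8) ≤ 1 ∧
      (√(n : ℝ))⁻¹ * √(Real.log n) ^ k ≤ ε ∧ (1 + T) ^ 2 * (√(Real.log n) ^ 3)⁻¹ ≤ ε := by
  -- Twice the constant in T ≤ (2k+4) l, so that Dl bounds 1 + T.
  set D : ℝ := 4 * k + 8 with hD
  have hD0 : 0 < D := by positivity
  have e₁ := ((tendsto_inv_sqrt_mul_sqrt_log_pow (B + k)).const_mul (D ^ B)).eventually
    (ge_mem_nhds (show D ^ B * 0 < ε by simpa using hε))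
  have e₂ := ((tendsto_inv_sqrt_mul_sqrt_log_pow (4 * k + (k + 3) + 4)).const_mul (D ^ 4)).eventually
    (ge_mem_nhds (show D ^ 4 * 0 < 1 by simp))
  have e₃ := (tendsto_inv_sqrt_mul_sqrt_log_pow k).eventually (ge_mem_nhds hε)
  have e₄ := tendsto_sqrt_log.eventually_ge_atTop (D ^ 2 / ε)
  filter_upwards [e₁, e₂, e₃, e₄, tendsto_sqrt_log.eventually_ge_atTop 2, eventually_ge_atTop 1] with
    n h₁ h₂ h₃ h₄ h₅ hn
  set z := (√(n : ℝ))⁻¹ with hz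
  set L := Real.log n with hL
  set l := √L with hl
  have hn' : (1 : ℝ) ≤ n := by exact_mod_cast hn
  have hL0 : 0 ≤ L := Real.log_natCast_nonneg n
  have hlL : l ^ 2 = L := Real.sq_sqrt hL0
  have hL1 : 1 ≤ L := by rw [← hlL]; nlinarith
  have hlogL0 : 0 ≤ Real.log L := Real.log_nonneg hL1
  have hlogL : Real.log L ≤ L := (Real.log_le_sub_one_of_pos (by linarith)).trans (by linarith)
  have hz0 : 0 < z := by positivity
  have hz1 : z ≤ 1 := inv_le_one_of_one_le₀ (Real.one_le_sqrt.2 hn')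
  -- This solves e^(-T²/2) = z^(k+1) l^(-(k+3)). The exponent k + 3 is forced up to less than one
  -- unit: the tail T² e^(-T²/2) must be o(z^(k+1) l^(-k)), so it exceeds k + 2, while the inner
  -- error D²/φ allows at most k + 3.
  set T := √((k + 1) * L + (k + 3) * Real.log L) with hT
  have hT2 : T ^ 2 = (k + 1) * L + (k + 3) * Real.log L := Real.sq_sqrt (by positivity)
  have hk : (0 : ℝ) ≤ k := by positivity
  have hlT : l ≤ T := Real.sqrt_le_sqrt (by nlinarith)
  have hl2 : 2 ≤ l := h₅
  have hT2' : 2 ≤ T := hl2.trans hlT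
  have hTl : T ≤ (2 * k + 4) * l := by
    rw [hT, Real.sqrt_le_left (by positivity), mul_pow, hlL]
    nlinarith
  have h1T : 1 + T ≤ D * l := by rw [hD]; linarith
  have hz_exp : z = Real.exp (-(L / 2)) := by
    rw [hz, Real.exp_neg, Real.exp_half, Real.exp_log (by linarith)]
  have hl_exp : l = Real.exp (Real.log L / 2) := by
    rw [Real.exp_half, Real.exp_log (by linarith)]
  have hexp : Real.exp (-(T ^ 2 / 2)) = z ^ (k + 1) * (l ^ (k + 3))⁻¹ := by
    rw [hT2]
    conv_rhs => rw [hz_exp, hl_exp]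
    rw [← Real.exp_nat_mul, ← Real.exp_nat_mul, ← Real.exp_neg, ← Real.exp_add]
    congr 1
    push_cast
    ring
  refine ⟨T, hT2', by linarith, hlT, hz0, hz1, hexp, ?_, ?_, h₃, ?_⟩
  · calc _ ≤ z * (D * l) ^ B * l ^ k := by gcongr
      _ = D ^ B * (z * l ^ (B + k)) := by rw [mul_pow, pow_add]; ring
      _ ≤ ε := h₁
  -- The fourth power turns e^(T²/8) into the known e^(T²/2).
  · rw [← pow_le_one_iff_of_nonneg (n := 4) (by positivity) (by norm_num)]
    have h8 : Real.exp (T ^ 2 / 8) ^ 4 = (z ^ (k + 1))⁻¹ * l ^ (k + 3) := by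
      rw [← Real.exp_nat_mul, ← inv_inj, ← Real.exp_neg, mul_inv, inv_inv, ← hexp]
      congr 1
      push_cast
      ring
    have hTD : T ≤ D * l := by linarith
    have hzk : (z ^ (k + 1)) ^ 3 ≤ z := by
      rw [← pow_mul]
      exact pow_le_of_le_one hz0.le hz1 (by positivity)
    calc _ = (z ^ (k + 1)) ^ 4 * (l ^ k) ^ 4 * T ^ 4 * ((z ^ (k + 1))⁻¹ * l ^ (k + 3)) := by
          rw [mul_pow, mul_pow, mul_pow, h8]
      _ = (z ^ (k + 1)) ^ 3 * l ^ (4 * k + (k + 3)) * T ^ 4 := by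
          field_simp
          ring
      _ ≤ z * l ^ (4 * k + (k + 3)) * (D * l) ^ 4 := by gcongr
      _ = D ^ 4 * (z * l ^ (4 * k + (k + 3) + 4)) := by ring
      _ ≤ 1 := h₂
  · have hl0 : 0 < l := by linarith
    calc _ ≤ (D * l) ^ 2 * (l ^ 3)⁻¹ := by gcongr
      _ = D ^ 2 / l := by field_simp
      _ ≤ ε := by
          rw [div_le_iff₀ hl0]
          rw [div_le_iff₀ hε] at h₄
          linarith

/-- This supplies the decay for the integration by parts in `fisherInfo_eq_relFisherInfo_add_one`.
-/
theorem EdgeworthApprox.exists_bound {ν : Measure ℝ} {K A : ℕ} {C z e : ℝ} {S : Polynomial ℝ}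
    {p r r₁ r₂ : ℝ → ℝ} (h : EdgeworthApprox ν K A C z e S p r r₁ r₂) :
    ∃ M : ℝ, ∀ x, (1 + |x|) ^ 2 * p x ≤ M := by
  obtain ⟨M₁, hM₁, h₁⟩ := exists_one_add_abs_pow_mul_exp_le (A + 2) (c := 1 / 2) (by norm_num)
  have hC := h.one_le
  have hz := h.z_nonneg
  refine ⟨(1 + C * z) * M₁ + e, fun x => ?_⟩
  have hX : 1 ≤ 1 + |x| := by linarith [abs_nonneg x]
  have hφ0 := gaussianPDFReal_nonneg 0 1 x
  have hφ : gaussianPDFReal 0 1 x ≤ Real.exp (-(1 / 2 * x ^ 2)) :=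
    (gaussianPDFReal_le_exp x).trans_eq (by ring_nf)
  have hS : S.eval x ≤ (1 + C * z) * (1 + |x|) ^ A := by
    have h2 := (abs_le.1 (h.sub_one x)).2
    have h3 : 1 ≤ (1 + |x|) ^ A := one_le_pow₀ hX
    linarith
  have hr : (1 + |x|) ^ 2 * r x ≤ e := by
    calc _ ≤ (1 + |x|) ^ 2 * |r x| := by gcongr; exact le_abs_self _
      _ ≤ (1 + |x|) ^ (K + 2) * |r x| := by
          gcongr
          omega
      _ ≤ e := h.bound₀ x
  rw [h.eq x, mul_add]
  refine add_le_add ?_ hr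
  calc _ ≤ (1 + |x|) ^ 2 * (gaussianPDFReal 0 1 x * ((1 + C * z) * (1 + |x|) ^ A)) := by gcongr
    _ ≤ (1 + |x|) ^ 2 * (Real.exp (-(1 / 2 * x ^ 2)) * ((1 + C * z) * (1 + |x|) ^ A)) := by gcongr
    _ = (1 + C * z) * ((1 + |x|) ^ (A + 2) * Real.exp (-(1 / 2 * x ^ 2))) := by ring
    _ ≤ _ := by gcongr; exact h₁ x

end FisherCLT

namespace FisherCLT

/-! ### The expansion of the relative Fisher information in terms of the Edgeworth sum -/

variable {μ : Measure ℝ} [IsProbabilityMeasure μ]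

theorem integrable_density_mul_sq {ν : Measure ℝ} {p : ℝ → ℝ} (hp : IsACDensity ν p)
    (hν : MemLp id 2 ν) : Integrable (fun x => p x * x ^ 2) :=
  (hp.integrable_mul_iff _).1 (by simpa using hν.integrable_sq)

/-- The condition that allows to replace the density by the Gaussian one on `[-T, T]`. -/
theorem abs_le_gaussian_div_four {K : ℕ} {e T x v : ℝ} (hT : 0 < T) (hx : |x| ≤ T) (he : 0 ≤ e)
    (hv : (1 + |x|) ^ (K + 2) * |v| ≤ e)
    (h : 12 * (e * (Real.exp (T ^ 2 / 8) + 2 ^ (K + 2) * (T ^ (K + 2))⁻¹ * Real.exp (T ^ 2 / 2))) ≤ 1) :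
    |v| ≤ gaussianPDFReal 0 1 x / 4 := by
  have hφ := gaussianPDFReal_pos 0 1 x one_ne_zero
  have h1 := abs_le_of_one_add_abs_pow_mul_le hv
  have h2 := inv_pow_mul_exp_le hT hx (K + 2)
  have h3 := one_div_gaussianPDFReal_le x
  rw [le_div_iff₀ (by norm_num)]
  have h4 : |v| * 4 * (1 / gaussianPDFReal 0 1 x) ≤ 1 := by
    calc _ ≤ e * ((1 + |x|) ^ (K + 2))⁻¹ * 4 * (3 * Real.exp (x ^ 2 / 2)) := by gcongr
      _ = 12 * (e * (((1 + |x|) ^ (K + 2))⁻¹ * Real.exp (x ^ 2 / 2))) := by ring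
      _ ≤ _ := by gcongr
      _ ≤ 1 := h
  rw [mul_one_div, div_le_one hφ] at h4
  exact h4

theorem relative_expansion_of_succ {k m : ℕ} (hμ : MemLp id (k + 1 + 2 : ℕ) μ) (hmean : ∫ x, x ∂μ = 0)
    (hvar : ∫ x, x ^ 2 ∂μ = 1) (hm : m ≠ 0) {C : ℝ}
    (hdecay : ∀ t, |t| * ‖charFun μ t‖ ^ m ≤ C) {δ : ℝ} (hδ : 0 < δ) :
    ∀ᶠ n : ℕ in atTop, ∀ ν : Measure ℝ, IsProbabilityMeasure ν → MemLp id 2 ν → ∫ x, x ^ 2 ∂ν = 1 →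
      (∀ t, charFun ν t = charFun μ ((√(n : ℝ))⁻¹ * t) ^ n) →
      ∃ p : ℝ → ℝ, IsACDensity ν p ∧ (∃ M, ∀ x, (1 + |x|) ^ 2 * p x ≤ M) ∧
        Integrable (fun x => (deriv p x + x * p x) ^ 2 / p x) ∧
        |(∫ x, (deriv p x + x * p x) ^ 2 / p x) - ∫ x, gaussianPDFReal 0 1 x *
          (expansionPoly (k + 1) (edgeworthSum (cumulant μ) (k + 1) (√(n : ℝ))⁻¹)).eval x| ≤
          δ * ((√(n : ℝ))⁻¹ ^ (k + 1) * (√(Real.log n) ^ k)⁻¹) := by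
  obtain ⟨C₁, hC₁, A, hS⟩ := exists_edgeworthSum_bounds (cumulant μ) (k + 1)
  obtain ⟨C₀, hC₀, hrel⟩ := exists_relative_expansion_bound (k + 1) A C₁
  obtain ⟨D, hD, htail⟩ := exists_second_moment_tail (k + 1) A C₁
  -- One more than the exponent in `splitError`, so that A + 2 ≤ B also when A = 0.
  set B := A * (k + 1 + 2) + 2 with hB
  have hAB : A + 2 ≤ B := by rw [hB]; nlinarith
  -- The three bounds give |S - 1| ≤ 1/4 on [-T,T], |r| ≤ φ/4 there, and the final constant δ. Here
  -- 9 + 2D collects 7 from `splitError_le` and 2D + 2 from the tail of the second moment.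
  set ε := min (min (1 / (4 * C₁)) (1 / (12 * (1 + 2 ^ (k + 3))))) (δ / (C₀ * (9 + 2 * D) + 1)) with hε
  have hε0 : 0 < ε := by
    have : 0 < C₁ := by linarith
    positivity
  have hεC : C₁ * ε ≤ 1 / 4 := by
    have h1 : ε ≤ 1 / (4 * C₁) := (min_le_left _ _).trans (min_le_left _ _)
    rw [le_div_iff₀ (by positivity)] at h1
    linarith
  have hε1 : ε ≤ 1 := by nlinarith
  have hε2 : 12 * (ε * (1 + 2 ^ (k + 3))) ≤ 1 := by
    have h1 : ε ≤ 1 / (12 * (1 + 2 ^ (k + 3))) := (min_le_left _ _).trans (min_le_right _ _)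
    rw [le_div_iff₀ (by positivity)] at h1
    linarith
  have hε3 : C₀ * ((9 + 2 * D) * ε) ≤ δ := by
    have h1 : ε ≤ δ / (C₀ * (9 + 2 * D) + 1) := min_le_right _ _
    rw [le_div_iff₀ (by positivity)] at h1
    linarith
  filter_upwards [density_approx hμ hmean hvar hm hdecay hε0, exists_splitting_level k B hε0] with
    n hn ⟨T, hT2, hl, hlT, hz0, hz1, hexp, s₁, s₂, s₃, s₄⟩ ν hνp hν2 hν1 hchar
  obtain ⟨p, r, r₁, r₂, hp, hpe, hd₁, hd₂, hb₀, hb₁, hb₂, hx⟩ := hn ν hνp hν2 hν1 hchar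
  set z := (√(n : ℝ))⁻¹ with hz
  set l := √(Real.log n) with hldef
  set S := edgeworthSum (cumulant μ) (k + 1) z with hSdef
  set e := ε * z ^ (k + 1) with he
  have he0 : 0 ≤ e := by positivity
  have hT0 : 0 < T := by linarith
  have hl0 : 0 < l := by linarith
  have happ : EdgeworthApprox ν (k + 1) A C₁ z e S p r r₁ r₂ :=
    ⟨hp, hpe, hd₁, hd₂, hb₀, hb₁, hb₂, hC₁, hz0.le, hz1, fun x => (hS z hz0.le hz1 x).1,
      fun x => (hS z hz0.le hz1 x).2.1, fun x => (hS z hz0.le hz1 x).2.2.1,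
      fun x => (hS z hz0.le hz1 x).2.2.2⟩
  have hlk : 1 ≤ l ^ k := one_le_pow₀ hl
  have hmono : ∀ {a : ℕ}, a ≤ B → z * (1 + T) ^ a * l ^ k ≤ ε := fun {a} ha => by
    refine le_trans ?_ s₁
    gcongr
    linarith
  have hS4 : ∀ x, |x| ≤ T → |S.eval x - 1| ≤ 1 / 4 := by
    intro x hxT
    refine (happ.sub_one x).trans (le_trans ?_ hεC)
    calc C₁ * z * (1 + |x|) ^ A ≤ C₁ * z * (1 + T) ^ A := by gcongr
      _ = C₁ * (z * (1 + T) ^ A * 1) := by ring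
      _ ≤ C₁ * (z * (1 + T) ^ A * l ^ k) := by gcongr
      _ ≤ C₁ * ε := by gcongr; exact hmono (by omega)
  have hexp' : Real.exp (T ^ 2 / 2) = (z ^ (k + 1))⁻¹ * l ^ (k + 3) := by
    rw [← inv_inj, ← Real.exp_neg, hexp, mul_inv, inv_inv]
  have hz8 : z ^ (k + 1) * Real.exp (T ^ 2 / 8) ≤ 1 := by
    refine le_trans ?_ s₂
    calc _ = z ^ (k + 1) * 1 * 1 * Real.exp (T ^ 2 / 8) := by ring
      _ ≤ _ := by gcongr; linarith
  have hr4 : ∀ x, |x| ≤ T → |r x| ≤ gaussianPDFReal 0 1 x / 4 := by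
    intro x hxT
    refine abs_le_gaussian_div_four hT0 hxT he0 (hb₀ x) (le_trans ?_ hε2)
    have h1 : z ^ (k + 1) * ((T ^ (k + 1 + 2))⁻¹ * Real.exp (T ^ 2 / 2)) ≤ 1 := by
      rw [hexp']
      calc _ = l ^ (k + 3) * (T ^ (k + 3))⁻¹ := by field_simp
        _ ≤ T ^ (k + 3) * (T ^ (k + 3))⁻¹ := by gcongr
        _ = 1 := mul_inv_cancel₀ (by positivity)
    calc _ = 12 * (ε * (z ^ (k + 1) * Real.exp (T ^ 2 / 8) +
          2 ^ (k + 3) * (z ^ (k + 1) * ((T ^ (k + 1 + 2))⁻¹ * Real.exp (T ^ 2 / 2))))) := by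
          rw [he]; ring
      _ ≤ 12 * (ε * (1 + 2 ^ (k + 3) * 1)) := by gcongr
      _ = _ := by rw [mul_one]
  have hx2 := integrable_density_mul_sq hp hν2
  set R := z ^ (k + 1) * (l ^ k)⁻¹ with hR
  have hR0 : 0 < R := by positivity
  have y₄ : (1 + T) ^ 2 * Real.exp (-(T ^ 2 / 2)) ≤ ε * R := by
    calc _ = R * ((1 + T) ^ 2 * (l ^ 3)⁻¹) := by rw [hexp, hR, pow_add l]; field_simp
      _ ≤ R * ε := by gcongr
      _ = _ := by ring
  have y₅ : z * (1 + T) ^ (A + 2) * Real.exp (-(T ^ 2 / 2)) ≤ ε * R := by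
    have h1 : (l ^ 3)⁻¹ ≤ l ^ k := (inv_le_one_of_one_le₀ (one_le_pow₀ hl)).trans hlk
    calc _ = R * (z * (1 + T) ^ (A + 2) * (l ^ 3)⁻¹) := by rw [hexp, hR, pow_add l]; field_simp
      _ ≤ R * (z * (1 + T) ^ (A + 2) * l ^ k) := by gcongr
      _ ≤ R * ε := by gcongr; exact hmono hAB
      _ = _ := by ring
  have hτ : ∫ x in {x : ℝ | T < |x|}, p x * x ^ 2 ≤ (2 * D + 2) * ε * R := by
    obtain ⟨ht₁, ht₂⟩ := htail ν z e S p r r₁ r₂ happ T hT2 hx2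
    have hgauss : D * ((1 + T) ^ 2 * Real.exp (-(T ^ 2 / 2)) +
        z * (1 + T) ^ (A + 2) * Real.exp (-(T ^ 2 / 2))) ≤ D * (ε * R + ε * R) := by gcongr
    -- k = 0 means K = 1, where absolute integration of x² r fails and the bound on its integrals
    -- over [-T,T] is used instead.
    rcases Nat.eq_zero_or_pos k with hk | hk
    · subst hk
      have h3 := ht₂ e (by rw [← hp.integral_eq fun x => x ^ 2, hν1])
        (integral_sq_mul_edgeworthSum _ le_rfl z) (hx le_rfl T hT0.le)
      have h4 : e = ε * R := by rw [he, hR, pow_zero, inv_one, mul_one]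
      have h5 : 0 < ε * R := by positivity
      linarith
    · have h3 := ht₁ (by omega)
      have h4 : 2 / T * (e * ((1 + T) ^ (k + 1 - 2))⁻¹) ≤ 2 * (ε * R) := by
        obtain ⟨j, rfl⟩ := Nat.exists_eq_add_of_le' hk
        rw [show j + 1 + 1 - 2 = j by omega]
        have h5 : (T * (1 + T) ^ j)⁻¹ ≤ (l ^ (j + 1))⁻¹ := by
          gcongr
          calc l ^ (j + 1) = l * l ^ j := by ring
            _ ≤ T * (1 + T) ^ j := by
              gcongr
              linarith
        calc _ = 2 * (ε * z ^ (j + 1 + 1) * (T * (1 + T) ^ j)⁻¹) := by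
              rw [he, mul_inv]; ring
          _ ≤ 2 * (ε * z ^ (j + 1 + 1) * (l ^ (j + 1))⁻¹) := by gcongr
          _ = _ := by rw [hR]; ring
      linarith
  obtain ⟨hint, hmain⟩ := hrel ν z e S p r r₁ r₂ happ T _ hT2 hS4 hr4 hx2 hτ
  refine ⟨p, hp, happ.exists_bound, hint, hmain.trans ?_⟩
  have hsplit := splitError_le (B := A * (k + 1 + 2) + 1) (τ := (2 * D + 2) * ε * R) hε0 hε1 hz0 hz1
    hl hlT hexp (hmono (by omega)) s₂ s₃ s₄
  rw [← he, ← hR] at hsplit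
  calc _ ≤ C₀ * (7 * ε * R + (2 * D + 2) * ε * R) := by gcongr
    _ = C₀ * ((9 + 2 * D) * ε) * R := by ring
    _ ≤ δ * R := by gcongr

/-- For K = 0 no rate is claimed, so T can be fixed: first T large enough for the Gaussian tails,
then ε small in terms of T, then n large. The integral of x² r over [-T,T] is bounded trivially by
2Tε. -/
theorem relative_expansion_of_zero {m : ℕ} (hμ : MemLp id (0 + 2 : ℕ) μ) (hmean : ∫ x, x ∂μ = 0)
    (hvar : ∫ x, x ^ 2 ∂μ = 1) (hm : m ≠ 0) {C : ℝ}
    (hdecay : ∀ t, |t| * ‖charFun μ t‖ ^ m ≤ C) {δ : ℝ} (hδ : 0 < δ) :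
    ∀ᶠ n : ℕ in atTop, ∀ ν : Measure ℝ, IsProbabilityMeasure ν → MemLp id 2 ν → ∫ x, x ^ 2 ∂ν = 1 →
      (∀ t, charFun ν t = charFun μ ((√(n : ℝ))⁻¹ * t) ^ n) →
      ∃ p : ℝ → ℝ, IsACDensity ν p ∧ (∃ M, ∀ x, (1 + |x|) ^ 2 * p x ≤ M) ∧
        Integrable (fun x => (deriv p x + x * p x) ^ 2 / p x) ∧
        |∫ x, (deriv p x + x * p x) ^ 2 / p x| ≤ δ := by
  obtain ⟨C₁, hC₁, A, hS⟩ := exists_edgeworthSum_bounds (cumulant μ) 0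
  obtain ⟨C₀, hC₀, hrel⟩ := exists_relative_expansion_bound 0 A C₁
  obtain ⟨D, hD, htail⟩ := exists_second_moment_tail 0 A C₁
  have hS1 : ∀ z, edgeworthSum (cumulant μ) 0 z = 1 := fun z => by
    simp [edgeworthSum, edgeworthPoly_zero]
  -- the level
  have hlim : Tendsto (fun T : ℝ => C₀ * (1 + D) * ((1 + T) ^ 2 * Real.exp (-(T ^ 2 / 2)))) atTop
      (nhds 0) := by
    obtain ⟨M, hM, hb⟩ := exists_one_add_abs_pow_mul_exp_le 3 (c := 1 / 2) (by norm_num)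
    have h1 : Tendsto (fun T : ℝ => C₀ * (1 + D) * (M * (1 + T)⁻¹)) atTop (nhds 0) := by
      have := (tendsto_inv_atTop_zero.comp (tendsto_atTop_add_const_left atTop (1 : ℝ) tendsto_id))
      simpa using (this.const_mul M).const_mul (C₀ * (1 + D))
    refine squeeze_zero' (Eventually.of_forall fun T => by positivity) ?_ h1
    filter_upwards [eventually_ge_atTop 0] with T hT
    refine mul_le_mul_of_nonneg_left ?_ (by positivity)
    rw [← div_eq_mul_inv, le_div_iff₀ (by positivity)]
    have := hb T
    rw [abs_of_nonneg hT] at this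
    calc _ = (1 + T) ^ 3 * Real.exp (-(1 / 2 * T ^ 2)) := by ring_nf
      _ ≤ M := this
  obtain ⟨T, hTδ, hT2⟩ := ((hlim.eventually (ge_mem_nhds (show (0 : ℝ) < δ / 2 by positivity))).and
    (eventually_ge_atTop 2)).exists
  have hT0 : 0 < T := by linarith
  -- the size of the remainder
  set Q := Real.exp (T ^ 2 / 8) + 2 ^ (0 + 2) * (T ^ (0 + 2))⁻¹ * Real.exp (T ^ 2 / 2) with hQ
  have hQ0 : 0 < Q := by positivity
  set H := T * (Real.exp (T ^ 2 / 8) + (T ^ (2 * (0 + 1)))⁻¹ * Real.exp (T ^ 2 / 2)) + T + 2 * T with hH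
  have hH0 : 0 < H := by positivity
  set ε := min (min 1 (1 / (12 * Q))) (δ / 2 / (C₀ * H + 1)) with hε
  have hε0 : 0 < ε := by positivity
  have hε1 : ε ≤ 1 := (min_le_left _ _).trans (min_le_left _ _)
  have hε2 : 12 * (ε * Q) ≤ 1 := by
    have h1 : ε ≤ 1 / (12 * Q) := (min_le_left _ _).trans (min_le_right _ _)
    rw [le_div_iff₀ (by positivity)] at h1
    linarith
  have hε3 : C₀ * (ε * H) ≤ δ / 2 := by
    have h1 : ε ≤ δ / 2 / (C₀ * H + 1) := min_le_right _ _
    rw [le_div_iff₀ (by positivity)] at h1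
    linarith
  filter_upwards [density_approx hμ hmean hvar hm hdecay hε0] with n hn ν hνp hν2 hν1 hchar
  obtain ⟨p, r, r₁, r₂, hp, hpe, hd₁, hd₂, hb₀, hb₁, hb₂, -⟩ := hn ν hνp hν2 hν1 hchar
  simp only [pow_zero, mul_one, hS1] at hpe hb₀ hb₁ hb₂
  have hS' := hS 0 le_rfl zero_le_one
  rw [hS1] at hS'
  -- Since S = 1, the parameter z may be set to 0, which removes most terms of `splitError`.
  have happ : EdgeworthApprox ν 0 A C₁ 0 ε 1 p r r₁ r₂ :=
    ⟨hp, hpe, hd₁, hd₂, hb₀, hb₁, hb₂, hC₁, le_rfl, zero_le_one, fun x => (hS' x).1,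
      fun x => (hS' x).2.1, fun x => (hS' x).2.2.1, fun x => (hS' x).2.2.2⟩
  have hx2 := integrable_density_mul_sq hp hν2
  have hr4 : ∀ x, |x| ≤ T → |r x| ≤ gaussianPDFReal 0 1 x / 4 := fun x hxT =>
    abs_le_gaussian_div_four hT0 hxT hε0.le (hb₀ x) hε2
  have hxr : |∫ x in -T..T, x ^ 2 * r x| ≤ 2 * T * ε := by
    have h1 := intervalIntegral.norm_integral_le_of_norm_le_const (a := -T) (b := T) (C := ε)
      (f := fun x => x ^ 2 * r x) (fun x _ => by
        rw [Real.norm_eq_abs, abs_mul, abs_of_nonneg (sq_nonneg x)]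
        refine le_trans ?_ (hb₀ x)
        rw [← sq_abs, zero_add]
        gcongr
        linarith)
    rw [Real.norm_eq_abs, sub_neg_eq_add, abs_of_pos (by linarith : 0 < T + T)] at h1
    linarith
  have hτ := (htail ν 0 ε 1 p r r₁ r₂ happ T hT2 hx2).2 _
    (by rw [← hp.integral_eq fun x => x ^ 2, hν1])
    (by rw [← hS1 0]; exact integral_sq_mul_edgeworthSum _ zero_le_one 0) hxr
  obtain ⟨hint, hmain⟩ := hrel ν 0 ε 1 p r r₁ r₂ happ T _ hT2 (fun x _ => by simp) hr4 hx2 hτ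
  refine ⟨p, hp, happ.exists_bound, hint, ?_⟩
  have hzero : ∫ x, gaussianPDFReal 0 1 x * (expansionPoly 0 (1 : Polynomial ℝ)).eval x = 0 := by
    simp [expansionPoly]
  rw [hzero, sub_zero] at hmain
  refine hmain.trans ?_
  have hεε : ε ^ 2 ≤ ε := by
    rw [sq]
    exact mul_le_of_le_one_left hε0.le hε1
  have hcomp : splitError 0 (A * (0 + 2) + 1) 0 ε T (D * ((1 + T) ^ 2 * Real.exp (-(T ^ 2 / 2)) +
      0 * (1 + T) ^ (A + 2) * Real.exp (-(T ^ 2 / 2))) + 2 * T * ε) ≤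
      (1 + D) * ((1 + T) ^ 2 * Real.exp (-(T ^ 2 / 2))) + ε * H := by
    have h1 : ε ^ 2 * T * (Real.exp (T ^ 2 / 8) + (T ^ (2 * (0 + 1)))⁻¹ * Real.exp (T ^ 2 / 2)) ≤
        ε * T * (Real.exp (T ^ 2 / 8) + (T ^ (2 * (0 + 1)))⁻¹ * Real.exp (T ^ 2 / 2)) := by gcongr
    rw [splitError, hH]
    simp only [zero_mul, pow_zero, inv_one, mul_one, add_zero, zero_add, ne_eq, OfNat.ofNat_ne_zero,
      not_false_eq_true, zero_pow] at h1 ⊢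
    linarith
  calc _ ≤ C₀ * ((1 + D) * ((1 + T) ^ 2 * Real.exp (-(T ^ 2 / 2))) + ε * H) := by gcongr
    _ = C₀ * (1 + D) * ((1 + T) ^ 2 * Real.exp (-(T ^ 2 / 2))) + C₀ * (ε * H) := by ring
    _ ≤ δ := by linarith

end FisherCLT

namespace FisherCLT

/-! ### The coefficients of the expansion -/

/-- The linear functional `Q ↦ ∫ φ Q` on polynomials. -/
noncomputable def gaussInt : Polynomial ℝ →ₗ[ℝ] ℝ where
  toFun Q := ∫ x, gaussianPDFReal 0 1 x * Q.eval x
  map_add' P Q := by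
    rw [← integral_add (integrable_gaussianPDFReal_mul_eval P)
      (integrable_gaussianPDFReal_mul_eval Q)]
    simp only [Polynomial.eval_add, mul_add]
  map_smul' c Q := by
    rw [RingHom.id_apply, smul_eq_mul, ← integral_const_mul]
    simp only [Polynomial.eval_smul, smul_eq_mul, mul_left_comm]

theorem gaussInt_apply (Q : Polynomial ℝ) :
    gaussInt Q = ∫ x, gaussianPDFReal 0 1 x * Q.eval x := rfl

theorem gaussInt_C_mul (c : ℝ) (Q : Polynomial ℝ) : gaussInt (Polynomial.C c * Q) = c * gaussInt Q := by
  rw [← Polynomial.smul_eq_C_mul, map_smul, smul_eq_mul]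

/-- The polynomial `b_{r_1}' b_{r_2}' b_{r_3} ⋯ b_{r_k}`, where `q_r = φ b_r`. -/
noncomputable def tuplePoly (γ : ℕ → ℝ) {k : ℕ} (r : Fin k → ℕ) : Polynomial ℝ :=
  ∏ i : Fin k, if (i : ℕ) < 2 then (edgeworthPoly γ (r i)).derivative else edgeworthPoly γ (r i)

theorem deriv_edgeworthFun_add (γ : ℕ → ℝ) (k : ℕ) (x : ℝ) :
    deriv (edgeworthFun γ k) x + x * edgeworthFun γ k x =
      gaussianPDFReal 0 1 x * (edgeworthPoly γ k).derivative.eval x := by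
  have h : edgeworthFun γ k = fun x => gaussianPDFReal 0 1 x * (edgeworthPoly γ k).eval x :=
    funext (edgeworthFun_eq γ k)
  rw [h, (hasDerivAt_gaussianPDFReal_mul_eval _ x).deriv]
  simp only [Polynomial.eval_sub, Polynomial.eval_mul, Polynomial.eval_X]
  ring

/-- With q_r = φ b_r one has q_r' + x q_r = φ b_r', so k factors φ against φ^(k-1) leave a
polynomial integrated against φ. -/
theorem fisherCoeff_eq (γ : ℕ → ℝ) (j : ℕ) :
    fisherCoeff γ j = ∑ k ∈ Finset.Icc 2 (2 * j), (-1 : ℝ) ^ k *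
      ∑ r ∈ positiveTuples k (2 * j), gaussInt (tuplePoly γ r) := by
  refine Finset.sum_congr rfl fun k hk => ?_
  congr 1
  refine Finset.sum_congr rfl fun r _ => integral_congr_ae (Eventually.of_forall fun x => ?_)
  have hφ := gaussianPDFReal_pos 0 1 x one_ne_zero
  obtain ⟨m, rfl⟩ : ∃ m, k = m + 1 := ⟨k - 1, by have := (Finset.mem_Icc.1 hk).1; omega⟩
  simp only [deriv_edgeworthFun_add]
  simp only [edgeworthFun_eq, ← mul_ite]
  rw [Finset.prod_mul_distrib, Finset.prod_const, Finset.card_univ, Fintype.card_fin,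
    Nat.add_sub_cancel, tuplePoly, Polynomial.eval_prod, pow_succ, mul_assoc,
    mul_div_cancel_left₀ _ (pow_ne_zero m hφ.ne')]
  congr 1
  exact Finset.prod_congr rfl fun i _ => by split_ifs <;> rfl

theorem eval_neg_derivative {Q : Polynomial ℝ} {c : ℝ} (h : ∀ x, Q.eval (-x) = c * Q.eval x) (x : ℝ) :
    Q.derivative.eval (-x) = -(c * Q.derivative.eval x) := by
  have h1 : HasDerivAt (fun x => Q.eval (-x)) (Q.derivative.eval (-x) * -1) x :=
    (Q.hasDerivAt (-x)).comp x (hasDerivAt_neg x)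
  have h2 : HasDerivAt (fun x => c * Q.eval x) (c * Q.derivative.eval x) x :=
    (Q.hasDerivAt x).const_mul c
  rw [← funext h] at h2
  linarith [h1.unique h2]

/-- Each of the two derivatives reverses the parity; together they cancel. -/
theorem eval_neg_tuplePoly (γ : ℕ → ℝ) {k : ℕ} (hk : 2 ≤ k) (r : Fin k → ℕ) (x : ℝ) :
    (tuplePoly γ r).eval (-x) = (-1) ^ (∑ i, r i) * (tuplePoly γ r).eval x := by
  obtain ⟨m, rfl⟩ := Nat.exists_eq_add_of_le' hk
  have h1 : ∀ i : Fin (m + 2), (if (i : ℕ) < 2 then (edgeworthPoly γ (r i)).derivative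
      else edgeworthPoly γ (r i)).eval (-x) = (if (i : ℕ) < 2 then -1 else 1) * ((-1) ^ r i *
      (if (i : ℕ) < 2 then (edgeworthPoly γ (r i)).derivative else edgeworthPoly γ (r i)).eval x) := by
    intro i
    split_ifs
    · rw [eval_neg_derivative (eval_neg_edgeworthPoly γ (r i))]; ring
    · rw [eval_neg_edgeworthPoly]; ring
  have h2 : ∏ i : Fin (m + 2), (if (i : ℕ) < 2 then (-1 : ℝ) else 1) = 1 := by
    simp [Fin.prod_univ_succ]
  rw [tuplePoly, Polynomial.eval_prod, Finset.prod_congr rfl fun i _ => h1 i,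
    Finset.prod_mul_distrib, h2, one_mul, Finset.prod_mul_distrib, Finset.prod_pow_eq_pow_sum,
    Polynomial.eval_prod]

theorem gaussInt_tuplePoly_of_odd (γ : ℕ → ℝ) {k : ℕ} (hk : 2 ≤ k) (r : Fin k → ℕ)
    (hr : Odd (∑ i, r i)) : gaussInt (tuplePoly γ r) = 0 :=
  integral_gaussian_mul_eval_eq_zero fun x => by
    rw [eval_neg_tuplePoly γ hk, hr.neg_one_pow, neg_one_mul]

/-- S'² (S - 1)^i is multiplied out over the i + 2 factors. The sign (-1)^i of (1 - S)^i is that of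
(-1)^k for k = i + 2. -/
theorem expansionPoly_edgeworthSum (γ : ℕ → ℝ) (K : ℕ) (z : ℝ) :
    expansionPoly K (edgeworthSum γ K z) = ∑ i ∈ Finset.range K,
      ∑ r ∈ Fintype.piFinset fun _ : Fin (i + 2) => Finset.Icc 1 K,
        Polynomial.C ((-1) ^ i * z ^ ∑ a, r a) * tuplePoly γ r := by
  have hS : edgeworthSum γ K z = 1 + ∑ k ∈ Finset.Icc 1 K, Polynomial.C (z ^ k) * edgeworthPoly γ k := by
    rw [edgeworthSum, Finset.range_eq_Ico, Finset.sum_eq_sum_Ico_succ_bot (by omega), pow_zero,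
      edgeworthPoly_zero, Polynomial.C_1, one_mul]
    rfl
  have hd : (edgeworthSum γ K z).derivative =
      ∑ k ∈ Finset.Icc 1 K, Polynomial.C (z ^ k) * (edgeworthPoly γ k).derivative := by
    rw [hS]
    simp only [Polynomial.derivative_add, Polynomial.derivative_one, zero_add,
      Polynomial.derivative_sum, Polynomial.derivative_C_mul]
  rw [expansionPoly, Finset.mul_sum]
  refine Finset.sum_congr rfl fun i _ => ?_
  have h1 : ∏ a : Fin (i + 2), ∑ k ∈ Finset.Icc 1 K, Polynomial.C (z ^ k) *
      (if (a : ℕ) < 2 then (edgeworthPoly γ k).derivative else edgeworthPoly γ k) =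
      (edgeworthSum γ K z).derivative ^ 2 * (edgeworthSum γ K z - 1) ^ i := by
    rw [Fin.prod_univ_succ, Fin.prod_univ_succ, hd, hS, add_sub_cancel_left]
    simp only [Fin.val_zero, Fin.val_succ, Nat.ofNat_pos, if_true, zero_add, Nat.one_lt_ofNat,
      add_assoc, Nat.reduceAdd]
    simp only [Nat.not_lt.2 (Nat.le_add_left 2 _), if_false, Finset.prod_const, Finset.card_univ,
      Fintype.card_fin]
    ring
  have h2 : (1 - edgeworthSum γ K z) ^ i =
      Polynomial.C ((-1) ^ i) * (edgeworthSum γ K z - 1) ^ i := by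
    rw [← neg_sub, neg_pow, Polynomial.C_pow, Polynomial.C_neg, Polynomial.C_1]
  rw [h2, mul_left_comm, ← h1, Finset.prod_univ_sum, Finset.mul_sum]
  refine Finset.sum_congr rfl fun r _ => ?_
  rw [Finset.prod_mul_distrib, ← map_prod, Finset.prod_pow_eq_pow_sum, ← mul_assoc, ← map_mul,
    tuplePoly]

theorem positiveTuples_eq_filter {k K m : ℕ} (hm : m ≤ K) :
    positiveTuples k m = (Fintype.piFinset fun _ : Fin k => Finset.Icc 1 K).filter
      fun r => ∑ i, r i = m := by
  ext r
  simp only [positiveTuples, Finset.mem_filter, Fintype.mem_piFinset, Finset.mem_Icc]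
  refine and_congr_left fun h => forall_congr' fun i => and_congr_right fun _ => ?_
  have h1 : r i ≤ m := h ▸ Finset.single_le_sum (fun _ _ => Nat.zero_le _) (Finset.mem_univ i)
  omega

theorem le_of_mem_positiveTuples {k m : ℕ} {r : Fin k → ℕ} (hr : r ∈ positiveTuples k m) : k ≤ m := by
  simp only [positiveTuples, Finset.mem_filter, Fintype.mem_piFinset, Finset.mem_Icc] at hr
  calc k = ∑ _i : Fin k, 1 := by simp
    _ ≤ ∑ i, r i := Finset.sum_le_sum fun i _ => (hr.1 i).1
    _ = m := hr.2

theorem positiveTuples_eq_empty {k m : ℕ} (h : m < k) : positiveTuples k m = ∅ :=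
  Finset.eq_empty_of_forall_notMem fun _ hr => absurd (le_of_mem_positiveTuples hr) (by omega)

/-- The coefficient of `z ^ m` in the expansion. -/
noncomputable def levelCoeff (γ : ℕ → ℝ) (m : ℕ) : ℝ :=
  ∑ k ∈ Finset.Icc 2 m, (-1 : ℝ) ^ k * ∑ r ∈ positiveTuples k m, gaussInt (tuplePoly γ r)

theorem levelCoeff_of_odd (γ : ℕ → ℝ) {m : ℕ} (hm : Odd m) : levelCoeff γ m = 0 := by
  refine Finset.sum_eq_zero fun k hk => ?_
  rw [Finset.sum_eq_zero fun r hr => ?_, mul_zero]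
  refine gaussInt_tuplePoly_of_odd γ (Finset.mem_Icc.1 hk).1 r ?_
  rwa [(Finset.mem_filter.1 hr).2]

theorem sum_levelCoeff (γ : ℕ → ℝ) (K : ℕ) (z : ℝ) :
    ∑ m ∈ Finset.range (K + 1), z ^ m * levelCoeff γ m =
      ∑ j ∈ Finset.Icc 1 (K / 2), fisherCoeff γ j * z ^ (2 * j) := by
  symm
  refine Finset.sum_of_injOn (fun j => 2 * j) (fun a _ b _ h => by simpa using h) ?_ ?_ ?_
  · intro j hj
    simp only [Finset.coe_Icc, Set.mem_Icc, Finset.coe_range, Set.mem_Iio] at hj ⊢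
    omega
  · intro m hm hm'
    rcases Nat.even_or_odd' m with ⟨j, rfl | rfl⟩
    · rcases Nat.eq_zero_or_pos j with rfl | hj
      · simp [levelCoeff]
      · refine absurd ⟨j, ?_, rfl⟩ hm'
        simp only [Finset.coe_Icc, Set.mem_Icc, Finset.mem_range] at hm ⊢
        omega
    · rw [levelCoeff_of_odd γ (odd_two_mul_add_one j), mul_zero]
  · intro j _
    rw [fisherCoeff_eq, levelCoeff, mul_comm]

/-- The truncation loses nothing up to z^K: positive tuples with sum m ≤ K have at most K entries,
each at most K. The finitely many remaining tuples have sum above K and contribute O(z^(K+1)). -/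
theorem exists_integral_expansionPoly_bound (γ : ℕ → ℝ) (K : ℕ) : ∃ C : ℝ, 0 ≤ C ∧
    ∀ z : ℝ, 0 ≤ z → z ≤ 1 →
      |(∫ x, gaussianPDFReal 0 1 x * (expansionPoly K (edgeworthSum γ K z)).eval x) -
        ∑ j ∈ Finset.Icc 1 (K / 2), fisherCoeff γ j * z ^ (2 * j)| ≤ C * z ^ (K + 1) := by
  classical
  set U : (i : ℕ) → Finset (Fin (i + 2) → ℕ) := fun i =>
    Fintype.piFinset fun _ : Fin (i + 2) => Finset.Icc 1 K with hU
  refine ⟨∑ i ∈ Finset.range K, ∑ r ∈ U i with ¬ ∑ a, r a < K + 1, |gaussInt (tuplePoly γ r)|,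
    by positivity, fun z hz0 hz1 => ?_⟩
  have h1 : ∫ x, gaussianPDFReal 0 1 x * (expansionPoly K (edgeworthSum γ K z)).eval x =
      ∑ i ∈ Finset.range K, ∑ r ∈ U i, (-1) ^ i * z ^ (∑ a, r a) * gaussInt (tuplePoly γ r) := by
    rw [← gaussInt_apply, expansionPoly_edgeworthSum, map_sum]
    refine Finset.sum_congr rfl fun i _ => ?_
    rw [map_sum]
    exact Finset.sum_congr rfl fun r _ => gaussInt_C_mul _ _
  have h2 : ∑ i ∈ Finset.range K, ∑ r ∈ U i with ∑ a, r a < K + 1,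
      (-1) ^ i * z ^ (∑ a, r a) * gaussInt (tuplePoly γ r) =
      ∑ j ∈ Finset.Icc 1 (K / 2), fisherCoeff γ j * z ^ (2 * j) := by
    rw [← sum_levelCoeff]
    have h3 : ∀ i ∈ Finset.range K, ∑ r ∈ U i with ∑ a, r a < K + 1,
        (-1) ^ i * z ^ (∑ a, r a) * gaussInt (tuplePoly γ r) =
        ∑ m ∈ Finset.range (K + 1), z ^ m * ((-1) ^ i *
          ∑ r ∈ positiveTuples (i + 2) m, gaussInt (tuplePoly γ r)) := by
      intro i _
      rw [← Finset.sum_fiberwise_of_maps_to (t := Finset.range (K + 1)) 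
        (g := fun r : Fin (i + 2) → ℕ => ∑ a, r a)
        (fun r hr => Finset.mem_range.2 (Finset.mem_filter.1 hr).2)]
      refine Finset.sum_congr rfl fun m hm => ?_
      have hm' := Finset.mem_range.1 hm
      rw [positiveTuples_eq_filter (Nat.lt_succ_iff.1 hm'), Finset.mul_sum, Finset.mul_sum,
        Finset.filter_filter]
      refine Finset.sum_congr (Finset.filter_congr fun r _ => ?_) fun r hr => ?_
      · exact ⟨fun h => h.2, fun h => ⟨by omega, h⟩⟩
      · rw [(Finset.mem_filter.1 hr).2]; ring
    rw [Finset.sum_congr rfl h3, Finset.sum_comm]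
    refine Finset.sum_congr rfl fun m hm => ?_
    have hm' := Finset.mem_range.1 hm
    rw [← Finset.mul_sum, levelCoeff]
    congr 1
    symm
    -- i = k - 2 is the exponent of 1 - S; the values of i without a partner k ≤ m have no positive
    -- tuples.
    refine Finset.sum_of_injOn (fun k => k - 2) ?_ ?_ ?_ ?_
    · intro a ha b hb h
      simp only [Finset.coe_Icc, Set.mem_Icc] at ha hb h
      omega
    · intro a ha
      simp only [Finset.coe_Icc, Set.mem_Icc, Finset.coe_range, Set.mem_Iio] at ha ⊢
      omega
    · intro i _ hi
      rw [positiveTuples_eq_empty, Finset.sum_empty, mul_zero]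
      by_contra! hlt
      exact hi ⟨i + 2, by simp only [Finset.coe_Icc, Set.mem_Icc]; omega, by simp⟩
    · intro k hk
      obtain ⟨i, rfl⟩ := Nat.exists_eq_add_of_le' (Finset.mem_Icc.1 hk).1
      simp only [Nat.add_sub_cancel]
      rw [pow_add, neg_one_sq, mul_one]
      rfl
  have h4 : ∀ i, ∑ r ∈ U i, (-1) ^ i * z ^ (∑ a, r a) * gaussInt (tuplePoly γ r) =
      ∑ r ∈ U i with ∑ a, r a < K + 1, (-1) ^ i * z ^ (∑ a, r a) * gaussInt (tuplePoly γ r) +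
      ∑ r ∈ U i with ¬ ∑ a, r a < K + 1, (-1) ^ i * z ^ (∑ a, r a) * gaussInt (tuplePoly γ r) :=
    fun i => (Finset.sum_filter_add_sum_filter_not _ _ _).symm
  rw [h1, Finset.sum_congr rfl fun i _ => h4 i, Finset.sum_add_distrib, h2, add_sub_cancel_left,
    Finset.sum_mul]
  refine (Finset.abs_sum_le_sum_abs _ _).trans (Finset.sum_le_sum fun i _ => ?_)
  rw [Finset.sum_mul]
  refine (Finset.abs_sum_le_sum_abs _ _).trans (Finset.sum_le_sum fun r hr => ?_)
  have hr' := not_lt.1 (Finset.mem_filter.1 hr).2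
  rw [abs_mul, abs_mul, abs_pow, abs_neg, abs_one, one_pow, one_mul, abs_of_nonneg (by positivity),
    mul_comm]
  exact mul_le_mul_of_nonneg_left (pow_le_pow_of_le_one hz0 hz1 hr') (abs_nonneg _)

end FisherCLT

namespace FisherCLT

/-! ### The coefficients as polynomials in the cumulants -/

/-- The evaluation of the variables of `ℝ[y_0, …, y_{N-1}][X]` at the numbers `γ_3, …, γ_{N+2}`. -/
noncomputable def specialize (N : ℕ) (γ : ℕ → ℝ) :
    Polynomial (MvPolynomial (Fin N) ℝ) →+* Polynomial ℝ :=
  Polynomial.mapRingHom (MvPolynomial.eval fun i : Fin N => γ ((i : ℕ) + 3))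

/-- The same formula over the ring of polynomials in indeterminate cumulants; q_k involves only γ_3,
…, γ_{k+2}. -/
theorem exists_specialize_eq_edgeworthPoly {N k : ℕ} (hk : k ≤ N) :
    ∃ R : Polynomial (MvPolynomial (Fin N) ℝ), ∀ γ, specialize N γ R = edgeworthPoly γ k := by
  refine ⟨∑ r ∈ weightedSolutions k, Polynomial.C (∏ i : Fin k,
      ((MvPolynomial.C ((((i : ℕ) + 3).factorial : ℝ)⁻¹) * MvPolynomial.X (Fin.castLE hk i)) ^ r i *
        MvPolynomial.C (((r i).factorial : ℝ)⁻¹))) *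
    (Polynomial.hermite (k + 2 * ∑ i, r i)).map (algebraMap ℤ _), fun γ => ?_⟩
  rw [edgeworthPoly, map_sum]
  refine Finset.sum_congr rfl fun r _ => ?_
  rw [map_mul]
  congr 1
  · rw [specialize, Polynomial.coe_mapRingHom, Polynomial.map_C, map_prod]
    congr 1
    refine Finset.prod_congr rfl fun i _ => ?_
    rw [map_mul, map_pow, map_mul, MvPolynomial.eval_C, MvPolynomial.eval_C, MvPolynomial.eval_X,
      Fin.val_castLE, div_eq_mul_inv, div_eq_mul_inv, mul_comm (γ _)]
  · rw [specialize, Polynomial.coe_mapRingHom, Polynomial.map_map]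
    congr 1
    exact RingHom.ext_int _ _

/-- Integration against φ acts only on x: each x^n is replaced by its Gaussian moment, a fixed
number. -/
theorem exists_eval_eq_gaussInt {N : ℕ} (R : Polynomial (MvPolynomial (Fin N) ℝ)) :
    ∃ Q : MvPolynomial (Fin N) ℝ, ∀ γ : ℕ → ℝ,
      gaussInt (specialize N γ R) = MvPolynomial.eval (fun i : Fin N => γ ((i : ℕ) + 3)) Q := by
  refine ⟨∑ n ∈ R.support, R.coeff n * MvPolynomial.C (gaussInt (Polynomial.X ^ n)), fun γ => ?_⟩
  conv_lhs => rw [R.as_sum_support_C_mul_X_pow]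
  rw [map_sum, map_sum, map_sum]
  refine Finset.sum_congr rfl fun n _ => ?_
  rw [map_mul (specialize N γ), map_mul (MvPolynomial.eval _), map_pow, MvPolynomial.eval_C]
  simp only [specialize, Polynomial.coe_mapRingHom, Polynomial.map_C, Polynomial.map_X]
  exact gaussInt_C_mul _ _

theorem exists_eval_eq_gaussInt_tuplePoly {N k : ℕ} {r : Fin k → ℕ} (hr : ∀ i, r i ≤ N) :
    ∃ Q : MvPolynomial (Fin N) ℝ, ∀ γ : ℕ → ℝ,
      gaussInt (tuplePoly γ r) = MvPolynomial.eval (fun i : Fin N => γ ((i : ℕ) + 3)) Q := by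
  choose R hR using fun i => exists_specialize_eq_edgeworthPoly (hr i)
  obtain ⟨Q, hQ⟩ := exists_eval_eq_gaussInt
    (∏ i : Fin k, if (i : ℕ) < 2 then (R i).derivative else R i)
  refine ⟨Q, fun γ => ?_⟩
  rw [← hQ, map_prod, tuplePoly]
  congr 1
  refine Finset.prod_congr rfl fun i _ => ?_
  split_ifs
  · rw [← hR i γ, specialize, Polynomial.coe_mapRingHom, Polynomial.derivative_map]
  · rw [hR]

/-- `c_j` is a polynomial in `γ_3, …, γ_{2j+1}`. -/
theorem exists_eval_eq_fisherCoeff (j : ℕ) : ∃ Q : MvPolynomial (Fin (2 * j - 1)) ℝ, ∀ γ : ℕ → ℝ,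
    fisherCoeff γ j = MvPolynomial.eval (fun i : Fin (2 * j - 1) => γ ((i : ℕ) + 3)) Q := by
  classical
  have h : ∀ k, ∀ r : Fin k → ℕ, ∃ Q : MvPolynomial (Fin (2 * j - 1)) ℝ,
      2 ≤ k → r ∈ positiveTuples k (2 * j) → ∀ γ : ℕ → ℝ,
      gaussInt (tuplePoly γ r) =
        MvPolynomial.eval (fun i : Fin (2 * j - 1) => γ ((i : ℕ) + 3)) Q := by
    intro k r
    by_cases hkr : 2 ≤ k ∧ r ∈ positiveTuples k (2 * j)
    -- A tuple has at least two entries, each at least 1, with sum 2j; so each is at most 2j - 1 and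
    -- the last cumulant is γ_{2j+1}.
    · obtain ⟨Q, hQ⟩ := exists_eval_eq_gaussInt_tuplePoly (N := 2 * j - 1) (r := r) fun i => by
        obtain ⟨hk, hr⟩ := hkr
        simp only [positiveTuples, Finset.mem_filter, Fintype.mem_piFinset, Finset.mem_Icc] at hr
        obtain ⟨i', hi'⟩ : ∃ i' : Fin k, i' ≠ i := by
          have : Nontrivial (Fin k) := Fin.nontrivial_iff_two_le.2 hk
          exact exists_ne i
        have h1 : r i + r i' ≤ ∑ a, r a := by
          rw [← Finset.sum_pair hi'.symm]
          exact Finset.sum_le_sum_of_subset (Finset.subset_univ _)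
        have := (hr.1 i').1
        omega
      exact ⟨Q, fun _ _ => hQ⟩
    · exact ⟨0, fun h1 h2 => absurd ⟨h1, h2⟩ hkr⟩
  choose Q hQ using h
  refine ⟨∑ k ∈ Finset.Icc 2 (2 * j), MvPolynomial.C ((-1 : ℝ) ^ k) *
    ∑ r ∈ positiveTuples k (2 * j), Q k r, fun γ => ?_⟩
  rw [fisherCoeff_eq, map_sum]
  refine Finset.sum_congr rfl fun k hk => ?_
  rw [map_mul, MvPolynomial.eval_C, map_sum]
  congr 1
  exact Finset.sum_congr rfl fun r hr => hQ k r (Finset.mem_Icc.1 hk).1 hr γ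

/-! ### The coefficient c_1. -/

theorem gaussInt_X_pow_two : gaussInt (Polynomial.X ^ 2) = 1 := by
  rw [gaussInt_apply, ← integral_sq_gaussianReal, isACDensity_gaussian.integral_eq fun x => x ^ 2]
  simp

theorem gaussInt_gaussDeriv (Q : Polynomial ℝ) : gaussInt (gaussDeriv Q) = 0 :=
  integral_eq_zero_of_hasDerivAt_of_integrable (hasDerivAt_gaussianPDFReal_mul_eval Q)
    (integrable_gaussianPDFReal_mul_eval _) (integrable_gaussianPDFReal_mul_eval _)

theorem edgeworthPoly_one (γ : ℕ → ℝ) :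
    edgeworthPoly γ 1 = Polynomial.C (γ 3 / 6) * (Polynomial.X ^ 3 - 3 * Polynomial.X) := by
  have h1 : weightedSolutions 1 = {fun _ => 1} := by decide
  have h2 : (Polynomial.hermite 3).map (algebraMap ℤ ℝ) =
      Polynomial.X ^ 3 - 3 * Polynomial.X := by
    simp only [Polynomial.hermite_succ, Polynomial.hermite_zero]
    simp
    ring
  rw [edgeworthPoly, h1, Finset.sum_singleton]
  simp only [Finset.univ_unique, Fin.default_eq_zero, Finset.sum_singleton, Finset.prod_singleton,
    Fin.val_zero, zero_add, pow_one, Nat.factorial_one, Nat.cast_one, div_one, mul_one,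
    Nat.reduceAdd, h2]
  norm_num [Nat.factorial]

theorem fisherCoeff_one (γ : ℕ → ℝ) : fisherCoeff γ 1 = γ 3 ^ 2 / 2 := by
  have h1 : positiveTuples 2 2 = {fun _ => 1} := by decide
  -- Here b_1' = (γ_3/2)(x² - 1), and (x² - 1)² = x² + 1 - (3x² - x⁴). The bracket times φ is the
  -- derivative of φx³, so no fourth moment is needed.
  have h2 : tuplePoly γ (fun _ : Fin 2 => 1) = Polynomial.C (γ 3 ^ 2 / 4) *
      (Polynomial.X ^ 2 + 1 - gaussDeriv (Polynomial.X ^ 3)) := by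
    have hC2 : Polynomial.C (2 : ℝ) = 2 := map_ofNat _ 2
    have hC3 : Polynomial.C (3 : ℝ) = 3 := map_ofNat _ 3
    have h3 : (edgeworthPoly γ 1).derivative =
        Polynomial.C (γ 3 / 2) * (Polynomial.X ^ 2 - 1) := by
      rw [edgeworthPoly_one, Polynomial.derivative_C_mul,
        show (γ 3 / 2) = γ 3 / 6 * 3 by ring, Polynomial.C_mul, mul_assoc]
      congr 1
      simp [hC2, hC3]
      ring
    rw [tuplePoly, Fin.prod_univ_two]
    simp only [Fin.val_zero, Fin.val_one, Nat.ofNat_pos, Nat.one_lt_ofNat, if_true, h3]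
    rw [show γ 3 ^ 2 / 4 = γ 3 / 2 * (γ 3 / 2) by ring, Polynomial.C_mul, gaussDeriv]
    simp [hC2]
    ring
  have h4 : gaussInt 1 = 1 := by
    rw [gaussInt_apply]
    simpa using integral_gaussianPDFReal_eq_one 0 one_ne_zero
  rw [fisherCoeff_eq, show Finset.Icc 2 (2 * 1) = {2} from rfl, Finset.sum_singleton, mul_one, h1,
    Finset.sum_singleton, h2, gaussInt_C_mul, map_sub, map_add, gaussInt_gaussDeriv,
    gaussInt_X_pow_two, h4]
  ring

end FisherCLT

namespace FisherCLT

/-! ### The expansion of the relative Fisher information -/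

theorem exists_charFun_decay {Ω : Type*} [MeasurableSpace Ω] {P : Measure Ω} [IsProbabilityMeasure P]
    {X : ℕ → Ω → ℝ} (hindep : iIndepFun X P) (hident : ∀ i, IdentDistrib (X i) (X 0) P P)
    {n₀ : ℕ} (hn₀ : 1 ≤ n₀) (hI : fisherInfo (P.map (normSum X n₀)) < ∞) :
    ∃ C, ∀ t, |t| * ‖charFun (P.map (X 0)) t‖ ^ n₀ ≤ C := by
  have := Measure.isProbabilityMeasure_map (μ := P) (aemeasurable_normSum hident n₀)
  obtain ⟨C, hC⟩ := exists_abs_mul_norm_charFun_le hI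
  have hn : 0 < √(n₀ : ℝ) := Real.sqrt_pos.2 (by exact_mod_cast hn₀)
  refine ⟨C / √(n₀ : ℝ), fun t => ?_⟩
  have h := hC (√(n₀ : ℝ) * t)
  rw [charFun_map_normSum hindep hident, inv_mul_cancel_left₀ hn.ne', norm_pow, abs_mul,
    abs_of_pos hn] at h
  rw [le_div_iff₀ hn]
  linarith

/-- The expansion of the relative Fisher information of the law with characteristic function
`t ↦ f(t / √n) ^ n`, where `f` is the characteristic function of `μ`. -/
theorem relative_fisher_expansion {μ : Measure ℝ} [IsProbabilityMeasure μ] {K m : ℕ}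
    (hμ : MemLp id (K + 2 : ℕ) μ) (hmean : ∫ x, x ∂μ = 0)
    (hvar : ∫ x, x ^ 2 ∂μ = 1) (hm : m ≠ 0) {C : ℝ}
    (hdecay : ∀ t, |t| * ‖charFun μ t‖ ^ m ≤ C) {δ : ℝ} (hδ : 0 < δ) :
    ∀ᶠ n : ℕ in atTop, ∀ ν : Measure ℝ, IsProbabilityMeasure ν → MemLp id 2 ν → ∫ x, x ^ 2 ∂ν = 1 →
      (∀ t, charFun ν t = charFun μ ((√(n : ℝ))⁻¹ * t) ^ n) →
      ∃ p : ℝ → ℝ, IsACDensity ν p ∧ (∃ M, ∀ x, (1 + |x|) ^ 2 * p x ≤ M) ∧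
        Integrable (fun x => (deriv p x + x * p x) ^ 2 / p x) ∧
        |(∫ x, (deriv p x + x * p x) ^ 2 / p x) -
          ∑ j ∈ Finset.Icc 1 (K / 2), fisherCoeff (cumulant μ) j * (√(n : ℝ))⁻¹ ^ (2 * j)| ≤
        δ * ((√(n : ℝ))⁻¹ ^ K * (√(Real.log n) ^ (K - 1))⁻¹) := by
  -- For K = 0 the truncated exponent K - 1 is 0 and the sum is empty, so the claim reduces to
  -- convergence to 0.
  rcases K with _ | k
  · simpa using relative_expansion_of_zero hμ hmean hvar hm hdecay hδ
  · obtain ⟨D, hD, hexp⟩ := exists_integral_expansionPoly_bound (cumulant μ) (k + 1)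
    -- The polynomial expansion has error O(z^(K+1)); the spare factor z beats the power l^k of
    -- √(log n) in the rate.
    have hlim := (tendsto_inv_sqrt_mul_sqrt_log_pow k).const_mul D
    rw [mul_zero] at hlim
    filter_upwards [relative_expansion_of_succ hμ hmean hvar hm hdecay (half_pos hδ),
      hlim.eventually (ge_mem_nhds (half_pos hδ)), eventually_ge_atTop 2]
      with n hn hsmall hn2 ν h1 h2 h3 h4
    obtain ⟨p, hp, hM, hint, hb⟩ := hn ν h1 h2 h3 h4
    refine ⟨p, hp, hM, hint, ?_⟩
    rw [Nat.add_sub_cancel]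
    have hn2' : (2 : ℝ) ≤ n := by exact_mod_cast hn2
    have hz0 : 0 < (√(n : ℝ))⁻¹ := by positivity
    have hz1 : (√(n : ℝ))⁻¹ ≤ 1 := inv_le_one_of_one_le₀ (Real.one_le_sqrt.2 (by linarith))
    have hl : 0 < √(Real.log n) ^ k := pow_pos (Real.sqrt_pos.2 (Real.log_pos (by linarith))) k
    have h5 := hexp _ hz0.le hz1
    have h6 : D * (√(n : ℝ))⁻¹ ^ (k + 1 + 1) ≤
        δ / 2 * ((√(n : ℝ))⁻¹ ^ (k + 1) * (√(Real.log n) ^ k)⁻¹) := by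
      rw [← mul_assoc, ← div_eq_mul_inv, le_div_iff₀ hl]
      calc _ = (D * ((√(n : ℝ))⁻¹ * √(Real.log n) ^ k)) * (√(n : ℝ))⁻¹ ^ (k + 1) := by ring
        _ ≤ _ := by gcongr
    refine (abs_sub_le _ _ _).trans ((add_le_add hb (h5.trans h6)).trans (le_of_eq ?_))
    ring

/-- Truncated subtraction in s - 2 - 1 plays the role of the positive part (s - 3)_+. -/
theorem inv_sqrt_pow_mul_eq (n : ℕ) {s : ℕ} (hs : 2 ≤ s) :
    (√(n : ℝ))⁻¹ ^ (s - 2) * (√(Real.log n) ^ (s - 2 - 1))⁻¹ =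
      (n : ℝ) ^ (-(((s : ℝ) - 2) / 2)) * Real.log (n : ℝ) ^ (-(max ((s : ℝ) - 3) 0 / 2)) := by
  have hn0 : (0 : ℝ) ≤ n := Nat.cast_nonneg n
  have hl : 0 ≤ Real.log n := Real.log_natCast_nonneg n
  congr 1
  · rw [Real.rpow_neg hn0, inv_pow, Real.sqrt_eq_rpow, ← Real.rpow_mul_natCast hn0,
      Nat.cast_sub hs]
    congr 2
    push_cast
    ring
  · rw [Real.rpow_neg hl, Real.sqrt_eq_rpow, ← Real.rpow_mul_natCast hl]
    congr 2
    rcases hs.eq_or_lt with rfl | hs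
    · norm_num
    · have h3 : (3 : ℝ) ≤ s := by exact_mod_cast hs
      rw [max_eq_left (by linarith), Nat.sub_sub, Nat.cast_sub (by omega)]
      push_cast
      ring

end FisherCLT

open FisherCLT
theorem theorem1p1 {Ω : Type*} [MeasurableSpace Ω] (P : Measure Ω) [IsProbabilityMeasure P]
    (X : ℕ → Ω → ℝ)
    (hindep : iIndepFun X P)
    (hident : ∀ i, IdentDistrib (X i) (X 0) P P)
    (hmean : ∫ ω, X 0 ω ∂P = 0)
    (hvar : variance (X 0) P = 1)
    (s : ℕ) (hs : 2 ≤ s)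
    (hmoment : Integrable (fun ω => |X 0 ω| ^ s) P)
    (n₀ : ℕ) (hn₀ : 1 ≤ n₀)
    (hI : fisherInfo (P.map (normSum X n₀)) < ∞) :
    -- for large `n` the Fisher information is finite and `I(Z_n||Z) = I(Z_n) - I(Z)`
    (∀ᶠ n : ℕ in atTop,
      fisherInfo (P.map (normSum X n)) < ∞ ∧
      fisherInfo (P.map (normSum X n)) =
        relFisherInfo (P.map (normSum X n)) 0 1 + fisherInfo (gaussianReal 0 1)) ∧
    -- the expansion
    ((fun n : ℕ =>
        (relFisherInfo (P.map (normSum X n)) 0 1).toReal -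
          ∑ j ∈ Finset.Icc 1 ((s - 2) / 2),
            fisherCoeff (cumulant (P.map (X 0))) j / (n : ℝ) ^ j)
      =o[atTop] fun n : ℕ =>
        (n : ℝ) ^ (-(((s : ℝ) - 2) / 2)) *
          Real.log (n : ℝ) ^ (-(max ((s : ℝ) - 3) 0 / 2))) ∧
    -- the coefficient `c_j` is a universal polynomial in `γ_3, …, γ_{2j+1}`
    (∀ j : ℕ, 1 ≤ j → ∃ Q : MvPolynomial (Fin (2 * j - 1)) ℝ, ∀ γ : ℕ → ℝ,
      fisherCoeff γ j = MvPolynomial.eval (fun i : Fin (2 * j - 1) => γ ((i : ℕ) + 3)) Q) ∧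
    -- the first coefficient
    fisherCoeff (cumulant (P.map (X 0))) 1 = cumulant (P.map (X 0)) 3 ^ 2 / 2 := by
  have hm0 : AEMeasurable (X 0) P := (hident 0).aemeasurable_fst
  have := Measure.isProbabilityMeasure_map hm0
  have hLs := memLp_of_integrable_abs_pow hs hm0 hmoment
  have hL2 : MemLp (X 0) 2 P := hLs.mono_exponent (by exact_mod_cast hs)
  have hμ : MemLp id ((s - 2 + 2 : ℕ) : ℝ≥0∞) (P.map (X 0)) := by
    rw [Nat.sub_add_cancel hs]
    exact (memLp_map_measure_iff aestronglyMeasurable_id hm0).2 hLs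
  have hμ1 : ∫ x, x ∂(P.map (X 0)) = 0 := by
    rw [integral_map hm0 (by fun_prop)]
    exact hmean
  have hμ2 : ∫ x, x ^ 2 ∂(P.map (X 0)) = 1 := by
    rw [integral_map hm0 (by fun_prop)]
    rw [variance_of_integral_eq_zero hm0 hmean] at hvar
    exact hvar
  obtain ⟨C, hC⟩ := exists_charFun_decay hindep hident hn₀ hI
  -- Used with K = s - 2 and decay exponent n₀: δ = 1 gives finiteness and the identity, arbitrary δ
  -- the little-o.
  have hmain := fun {δ : ℝ} (hδ : 0 < δ) => relative_fisher_expansion hμ hμ1 hμ2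
    (by omega : n₀ ≠ 0) hC hδ
  have hlaw : ∀ n, 1 ≤ n → IsProbabilityMeasure (P.map (normSum X n)) ∧
      MemLp id 2 (P.map (normSum X n)) ∧ ∫ x, x ^ 2 ∂(P.map (normSum X n)) = 1 := fun n hn =>
    ⟨Measure.isProbabilityMeasure_map (aemeasurable_normSum hident n),
      memLp_two_normSum hindep hident hL2 hmean hvar hn⟩
  refine ⟨?_, ?_, fun j _ => exists_eval_eq_fisherCoeff j, fisherCoeff_one _⟩
  · filter_upwards [hmain one_pos, eventually_ge_atTop 1] with n hn hn1
    obtain ⟨h1, h2, h3⟩ := hlaw n hn1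
    obtain ⟨p, hp, ⟨M, hM⟩, hint, -⟩ := hn _ h1 h2 h3 (charFun_map_normSum hindep hident n)
    rw [fisherInfo_gaussianReal]
    exact fisherInfo_eq_relFisherInfo_add_one hp h3 hM hint
  · refine isLittleO_iff.2 fun δ hδ => ?_
    filter_upwards [hmain hδ, eventually_ge_atTop 1] with n hn hn1
    obtain ⟨h1, h2, h3⟩ := hlaw n hn1
    obtain ⟨p, hp, -, hint, hb⟩ := hn _ h1 h2 h3 (charFun_map_normSum hindep hident n)
    rw [toReal_relFisherInfo hp hint, ← inv_sqrt_pow_mul_eq n hs, Real.norm_eq_abs,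
      Real.norm_of_nonneg (by positivity)]
    convert hb using 3
    refine Finset.sum_congr rfl fun j _ => ?_
    rw [pow_mul, inv_pow, Real.sq_sqrt (Nat.cast_nonneg n), inv_pow, div_eq_mul_inv]
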